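/- For $n\ge 1$ let $(G_t)_{t\in[0,1]}$ be the dynamical Erdős–Rényi graph on the vertex set $\{1,\dots,n\}$: the graph $G_0$ is distributed as $\mathrm{ER}(n,1/n)$ (each pair of vertices is joined by an edge with probability $1/n$, independently of all other pairs), and, independently for each pair $\{v,w\}$ with $v\ne w$, at the times of a rate $1$ Poisson process the edge $vw$ is removed if it is present and is then placed with probability $1/n$, independently of everything else. Let $|L_n(t)|$ be the number of vertices of a largest connected component of $G_t$. Then for every $\beta\in\mathbb R$, as $n\to\infty$, $$\mathbb P\Big(\sup_{t\in[0,1]}|L_n(t)|>\beta\, n^{2/3}(\log n)^{1/3}\Big)\longrightarrow\begin{cases}1&\text{if }\beta<2/3^{2/3},\\ 0&\text{if }\beta>2/3^{1/3}.\end{cases}$$ -/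

import Mathlib

open MeasureTheory ProbabilityTheory Filter Topology

namespace DynamicalER

noncomputable section

/-- The edge probability `1/n` of the critical Erdős–Rényi graph on `n` vertices. -/
def edgeProb (n : ℕ) : unitInterval :=
  ⟨1 / (n : ℝ), by positivity, by
    rcases Nat.eq_zero_or_pos n with rfl | h
    · simp
    · exact (div_le_one (by exact_mod_cast h)).2 (by exact_mod_cast h)⟩

/-- The randomness attached to one edge: the successive waiting times of its Poisson clock, and
the outcomes of its successive resamplings. -/
abbrev EdgeSample : Type := (ℕ → ℝ) × (ℕ → Bool)

/-- The sample space: an initial graph, together with a clock and resampling outcomes for every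
unordered pair of vertices. (The entries at the diagonal pairs are never used.) -/
abbrev Sample (n : ℕ) : Type := SimpleGraph (Fin n) × (Sym2 (Fin n) → EdgeSample)

/-- The law for one edge: i.i.d. rate-one exponential waiting times, that is, a rate-one Poisson
process, and, independently, i.i.d. outcomes that are `true` with probability `1/n`. -/
def edgeLaw (n : ℕ) : Measure EdgeSample :=
  (Measure.infinitePi fun _ : ℕ => expMeasure 1).prod
    (Measure.infinitePi fun _ : ℕ => bernoulliMeasure true false (edgeProb n))

/-- The probability measure of the dynamical Erdős–Rényi graph: the initial graph is `ER(n, 1/n)`,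
and it is independent of the clocks and outcomes, which are i.i.d. over the edges. -/
def law (n : ℕ) : Measure (Sample n) :=
  (SimpleGraph.binomialRandom (Fin n) (edgeProb n)).prod
    (Measure.infinitePi fun _ : Sym2 (Fin n) => edgeLaw n)

/-- The product measures above are genuine probability measures. -/
theorem isProbabilityMeasure_law (n : ℕ) : IsProbabilityMeasure (law n) := by
  have := isProbabilityMeasure_expMeasure (r := 1) one_pos
  have (_ : Sym2 (Fin n)) : IsProbabilityMeasure (edgeLaw n) := by
    unfold edgeLaw; infer_instance
  unfold law; infer_instance

/-- The number of rings up to and including time `t` of a clock with waiting times `τ`: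
the `k`-th ring (counted from `k = 0`) is at time `τ 0 + ⋯ + τ k`. -/
def ringCount (τ : ℕ → ℝ) (t : ℝ) : ℕ :=
  {k : ℕ | ∑ i ∈ Finset.range (k + 1), τ i ≤ t}.ncard

/-- Whether the edge `e` is present at time `t`: its initial state if its clock has not rung yet,
and otherwise the outcome of the last resampling. -/
def present {n : ℕ} (ω : Sample n) (t : ℝ) (e : Sym2 (Fin n)) : Prop :=
  match ringCount (ω.2 e).1 t with
  | 0 => e ∈ ω.1.edgeSet
  | k + 1 => (ω.2 e).2 k = true

/-- The graph `G_t`. -/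
def graphAt {n : ℕ} (ω : Sample n) (t : ℝ) : SimpleGraph (Fin n) :=
  SimpleGraph.fromEdgeSet {e | present ω t e}

/-- The number of vertices of a largest connected component. -/
def largestSize {n : ℕ} (G : SimpleGraph (Fin n)) : ℕ :=
  ⨆ c : G.ConnectedComponent, c.supp.ncard

/-- `sup_{t ∈ [0,1]} |L_n(t)|`. -/
def supLargestSize {n : ℕ} (ω : Sample n) : ℕ :=
  ⨆ t : Set.Icc (0 : ℝ) 1, largestSize (graphAt ω t)

end

end DynamicalER

/-! Write r for the cube root of n and L for the cube root of log n, so that the scale in question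
is r²L and r = exp(L³/3). Let q(s) be the probability that the component of a fixed vertex of ER(n,
p) has more than s vertices. Exploring a component vertex by vertex turns q into a recursion in the
numbers of active and unexplored vertices, `survival` (see `ex_comp`). Heuristically, for p = 1/n
and s = b r²L, q is n^(-1/3 - b³/8) to leading exponential order. The factor n^(-1/3) is the price
for a critical exploration started from one vertex to last for about r² steps; the factor
exp(-b³L³/8) is the price for keeping it alive while the unexplored vertices are used up.
Exponential functions of the number of unexplored vertices, which are harmonic for the exploration,
give bounds in both directions.

Upper bound. Cut [0,1] into about r intervals of length 1/r. Almost surely all graphs seen during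
one interval are subgraphs of a single random graph whose edges are independent with probability at
most (1 + 2/r)/n, which is still in the critical window (`edgeModel_everPresent_le`,
`law_ae_le_everConfig`). A component with more than k vertices puts at least k + 1 vertices into
large components, so Markov's inequality bounds its probability by n q(k)/(k+1). If β³ > 8/3 then q
is at most r^(-2) (`survival_eventually_le`), and the union bound over the intervals leaves O(1/L)
(`law_supLargestSize_le`).

Lower bound. Apply the second moment method to the number of vertices in large components, summed
over M equally spaced times. At a single time, two vertices lie in the same component or in two
negatively correlated ones (`ex_largeCount_sq_le`). At two different times the graphs are noisy
copies of each other, where an edge is kept with the probability ρ that its clock does not ring. The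
Fourier–Walsh expansion damps degree m by ρ^m, and the Schramm–Steif inequality bounds the weight of
degree m by means of the edges that the exploration of a component reads. The resulting covariance
bound is 2 E|C| · nq / (1-ρ)² (`ex₂_mul_self_le`, `ex₂_largeCount_le`), where |C| is the size of the
component of a vertex. For b³ = 8/9, q is at least n^(-11/24) (`survival_eventually_ge`) and E|C| is
at most 17 r L² (`sum_survival_eventually_le`), so that M about n^(7/48) makes the variance
negligible against the squared mean. The exponents leave some room here, and a lower bound on q with
a slightly wrong constant in the exponent suffices. -/

namespace DynamicalER

set_option linter.unusedSectionVars false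

/-! ### Product Bernoulli spaces: stopping sets, Fourier–Walsh analysis and noise. -/

section ProductSpace

open scoped Finset

variable {E : Type*} [Fintype E] [DecidableEq E]

/-- The Bernoulli weights with parameter `p`. -/
noncomputable def bern (p : ℝ) (b : Bool) : ℝ := if b then p else 1 - p

/-- The weight of a configuration under the product of Bernoulli measures. -/
noncomputable def wt (p : ℝ) (ω : E → Bool) : ℝ := ∏ e, bern p (ω e)

/-- The expectation under the product of Bernoulli measures. -/
noncomputable def ex (p : ℝ) (f : (E → Bool) → ℝ) : ℝ := ∑ ω, wt p ω * f ω

theorem sum_bool_prod (g : E → Bool → ℝ) :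
    ∑ ω : E → Bool, ∏ e, g e (ω e) = ∏ e, ∑ b, g e b := by
  rw [Finset.prod_univ_sum, Fintype.piFinset_univ]

theorem bern_nonneg {p : ℝ} (h0 : 0 ≤ p) (h1 : p ≤ 1) (b : Bool) : 0 ≤ bern p b := by
  unfold bern; split_ifs <;> linarith

theorem sum_bern (p : ℝ) : ∑ b, bern p b = 1 := by simp [bern]

theorem wt_nonneg {p : ℝ} (h0 : 0 ≤ p) (h1 : p ≤ 1) (ω : E → Bool) : 0 ≤ wt p ω :=
  Finset.prod_nonneg fun _ _ => bern_nonneg h0 h1 _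

theorem sum_wt (p : ℝ) : ∑ ω : E → Bool, wt p ω = 1 := by
  simp only [wt]
  rw [sum_bool_prod fun _ b => bern p b]
  simp only [sum_bern, Finset.prod_const_one]

theorem ex_const (p c : ℝ) : ex p (fun _ : E → Bool => c) = c := by
  rw [ex, ← Finset.sum_mul, sum_wt, one_mul]

theorem ex_mono {p : ℝ} (h0 : 0 ≤ p) (h1 : p ≤ 1) {f g : (E → Bool) → ℝ} (h : ∀ ω, f ω ≤ g ω) :
    ex p f ≤ ex p g :=
  Finset.sum_le_sum fun ω _ => mul_le_mul_of_nonneg_left (h ω) (wt_nonneg h0 h1 ω)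

theorem ex_nonneg {p : ℝ} (h0 : 0 ≤ p) (h1 : p ≤ 1) {f : (E → Bool) → ℝ} (h : ∀ ω, 0 ≤ f ω) :
    0 ≤ ex p f :=
  Finset.sum_nonneg fun ω _ => mul_nonneg (wt_nonneg h0 h1 ω) (h ω)

theorem ex_add (p : ℝ) (f g : (E → Bool) → ℝ) : ex p (fun ω => f ω + g ω) = ex p f + ex p g := by
  simp [ex, mul_add, Finset.sum_add_distrib]

theorem ex_sub (p : ℝ) (f g : (E → Bool) → ℝ) : ex p (fun ω => f ω - g ω) = ex p f - ex p g := by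
  simp [ex, mul_sub, Finset.sum_sub_distrib]

theorem ex_const_mul (p c : ℝ) (f : (E → Bool) → ℝ) : ex p (fun ω => c * f ω) = c * ex p f := by
  simp only [ex, Finset.mul_sum]; exact Finset.sum_congr rfl fun _ _ => by ring

theorem ex_mul_const (p c : ℝ) (f : (E → Bool) → ℝ) : ex p (fun ω => f ω * c) = ex p f * c := by
  simp only [ex, Finset.sum_mul]; exact Finset.sum_congr rfl fun _ _ => by ring

theorem ex_sum {ι : Type*} (p : ℝ) (s : Finset ι) (f : ι → (E → Bool) → ℝ) :
    ex p (fun ω => ∑ i ∈ s, f i ω) = ∑ i ∈ s, ex p (f i) := by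
  simp only [ex, Finset.mul_sum]; rw [Finset.sum_comm]

theorem ex_mul_sq_le {p : ℝ} (h0 : 0 ≤ p) (h1 : p ≤ 1) (f g : (E → Bool) → ℝ) :
    ex p (fun ω => f ω * g ω) ^ 2 ≤ ex p (fun ω => f ω ^ 2) * ex p (fun ω => g ω ^ 2) := by
  have := Finset.sum_mul_sq_le_sq_mul_sq (Finset.univ : Finset (E → Bool))
    (fun ω => √(wt p ω) * f ω) (fun ω => √(wt p ω) * g ω)
  have e : ∀ a b : ℝ, ∀ ω : E → Bool, √(wt p ω) * a * (√(wt p ω) * b) = wt p ω * (a * b) := by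
    intro a b ω
    have := Real.mul_self_sqrt (wt_nonneg h0 h1 ω)
    calc _ = √(wt p ω) * √(wt p ω) * (a * b) := by ring
      _ = _ := by rw [this]
  simp only [e, pow_two, ex] at this ⊢
  simpa only [mul_assoc] using this

/-! ### Splicing along a stopping set -/

/-- The configuration that equals `ω` on `J` and `ω'` off `J`. -/
def splice (J : Finset E) (ω ω' : E → Bool) : E → Bool := fun e => if e ∈ J then ω e else ω' e

/-- A random set of coordinates is a stopping set if it is determined by the coordinates in it. -/
def IsStopping (J : (E → Bool) → Finset E) : Prop :=
  ∀ ω ω', (∀ e ∈ J ω, ω e = ω' e) → J ω' = J ω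

theorem splice_of_mem {J : Finset E} {e : E} (h : e ∈ J) (ω ω' : E → Bool) :
    splice J ω ω' e = ω e := if_pos h

theorem splice_of_notMem {J : Finset E} {e : E} (h : e ∉ J) (ω ω' : E → Bool) :
    splice J ω ω' e = ω' e := if_neg h

theorem IsStopping.splice_eq {J : (E → Bool) → Finset E} (hJ : IsStopping J) (ω ω' : E → Bool) :
    J (splice (J ω) ω ω') = J ω :=
  hJ ω _ fun _ he => (splice_of_mem he ω ω').symm

theorem isStopping_const (J : Finset E) : IsStopping fun _ => J := fun _ _ _ => rfl

/-- Exchanging the coordinates of ω and ω' off J(ω) is an involution, since the stopping property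
leaves J unchanged, and it preserves the product weight. This is the strong Markov property: what
lies off the revealed set may be resampled. -/
theorem ex_splice {J : (E → Bool) → Finset E} (hJ : IsStopping J) (p : ℝ)
    (F : (E → Bool) → (E → Bool) → ℝ) :
    ex p (fun ω => ex p fun ω' => F (splice (J ω) ω ω') (splice (J ω) ω' ω)) =
      ex p (fun ω => ex p fun ω' => F ω ω') := by
  let σ : (E → Bool) × (E → Bool) → (E → Bool) × (E → Bool) :=
    fun x => (splice (J x.1) x.1 x.2, splice (J x.1) x.2 x.1)
  have hσ : Function.Involutive σ := by
    rintro ⟨ω, ω'⟩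
    simp only [σ, hJ.splice_eq, Prod.mk.injEq]
    constructor <;> funext e <;> by_cases he : e ∈ J ω <;> simp [splice, he]
  have hw : ∀ x, wt p (σ x).1 * wt p (σ x).2 = wt p x.1 * wt p x.2 := by
    rintro ⟨ω, ω'⟩
    simp only [σ, wt, ← Finset.prod_mul_distrib]
    refine Finset.prod_congr rfl fun e _ => ?_
    by_cases he : e ∈ J ω <;> simp [splice, he, mul_comm]
  have key := Equiv.sum_comp hσ.toPerm (fun x => wt p x.1 * wt p x.2 * F x.1 x.2)
  simp only [Function.Involutive.coe_toPerm, hw] at key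
  simp only [ex, Finset.mul_sum, ← mul_assoc]
  simpa only [Fintype.sum_prod_type] using key

theorem ex_mul_of_disjoint (p : ℝ) (J : Finset E) {f g : (E → Bool) → ℝ}
    (hf : ∀ ω ω', (∀ e ∈ J, ω e = ω' e) → f ω = f ω')
    (hg : ∀ ω ω', (∀ e ∉ J, ω e = ω' e) → g ω = g ω') :
    ex p (fun ω => f ω * g ω) = ex p f * ex p g := by
  have h := ex_splice (isStopping_const J) p (fun ω _ => f ω * g ω)
  simp only [ex_const] at h
  rw [← h]
  have : ∀ ω ω', f (splice J ω ω') * g (splice J ω ω') = f ω * g ω' := fun ω ω' => by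
    rw [hf (splice J ω ω') ω fun e he => splice_of_mem he _ _,
      hg (splice J ω ω') ω' fun e he => splice_of_notMem he _ _]
  simp only [this, ex_const_mul, ex_mul_const]

/-! ### Fourier analysis -/

/-- The centred and normalised coordinate. -/
noncomputable def phi (p : ℝ) (b : Bool) : ℝ := ((if b then 1 else 0) - p) / √(p * (1 - p))

/-- The Fourier–Walsh characters of the biased cube. -/
noncomputable def chi (p : ℝ) (S : Finset E) (ω : E → Bool) : ℝ := ∏ e ∈ S, phi p (ω e)

/-- The Fourier–Walsh coefficients. -/
noncomputable def coef (p : ℝ) (f : (E → Bool) → ℝ) (S : Finset E) : ℝ :=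
  ex p fun ω => f ω * chi p S ω

theorem sum_bern_phi (p : ℝ) : ∑ b, bern p b * phi p b = 0 := by
  simp [bern, phi]; ring

theorem one_add_phi {p : ℝ} (h0 : 0 < p) (h1 : p < 1) (b b' : Bool) :
    bern p b * (1 + phi p b * phi p b') = if b = b' then 1 else 0 := by
  have h : 0 < p * (1 - p) := mul_pos h0 (by linarith)
  have hs : √(p * (1 - p)) * √(p * (1 - p)) = p * (1 - p) := Real.mul_self_sqrt h.le
  have h1' : (1 - p) ≠ 0 := by linarith
  have h0' := h0.ne'
  unfold phi
  rw [div_mul_div_comm, hs]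
  cases b <;> cases b' <;> simp only [bern, reduceCtorEq, if_true, if_false] <;> field_simp <;> ring

theorem chi_eq_prod (p : ℝ) (S : Finset E) (ω : E → Bool) :
    chi p S ω = ∏ e, if e ∈ S then phi p (ω e) else 1 := by
  simp [chi, Finset.prod_ite_mem]

/-- Completeness of the characters. The sum over S factorises over the coordinates, and each factor
1 + φφ' is a point mass divided by its weight. -/
theorem sum_chi_mul_chi {p : ℝ} (h0 : 0 < p) (h1 : p < 1) (ω ω' : E → Bool) :
    wt p ω * ∑ S : Finset E, chi p S ω * chi p S ω' = if ω = ω' then 1 else 0 := by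
  have : ∑ S : Finset E, chi p S ω * chi p S ω' = ∏ e, (1 + phi p (ω e) * phi p (ω' e)) := by
    rw [Finset.prod_one_add, Finset.powerset_univ]
    simp [chi, Finset.prod_mul_distrib]
  rw [this, wt, ← Finset.prod_mul_distrib]
  simp only [one_add_phi h0 h1]
  rw [Finset.prod_ite_zero]
  simp [funext_iff]

theorem fourier_expansion {p : ℝ} (h0 : 0 < p) (h1 : p < 1) (f : (E → Bool) → ℝ) (ω : E → Bool) :
    f ω = ∑ S, coef p f S * chi p S ω := by
  simp only [coef, ex, Finset.sum_mul]
  rw [Finset.sum_comm]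
  have : ∀ ω' : E → Bool, ∑ S, wt p ω' * (f ω' * chi p S ω') * chi p S ω =
      if ω' = ω then f ω' else 0 := fun ω' => by
    have := sum_chi_mul_chi h0 h1 ω' ω
    calc _ = f ω' * (wt p ω' * ∑ S : Finset E, chi p S ω' * chi p S ω) := by
          simp only [Finset.mul_sum]; exact Finset.sum_congr rfl fun _ _ => by ring
      _ = _ := by rw [this]; split_ifs <;> simp
  simp [this]

theorem parseval {p : ℝ} (h0 : 0 < p) (h1 : p < 1) (f g : (E → Bool) → ℝ) :
    ex p (fun ω => f ω * g ω) = ∑ S, coef p f S * coef p g S := by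
  calc ex p (fun ω => f ω * g ω) = ex p (fun ω => ∑ S, coef p g S * (f ω * chi p S ω)) := by
        congr 1; funext ω
        conv_lhs => rw [fourier_expansion h0 h1 g ω, Finset.mul_sum]
        exact Finset.sum_congr rfl fun _ _ => by ring
    _ = _ := by
        rw [ex_sum]; exact Finset.sum_congr rfl fun _ _ => by rw [ex_const_mul, mul_comm]; rfl

theorem coef_empty (p : ℝ) (f : (E → Bool) → ℝ) : coef p f ∅ = ex p f := by
  simp [coef, chi]

/-- The transition weights of the noise that keeps a coordinate with probability `ρ`. -/
noncomputable def noise (p ρ : ℝ) (b b' : Bool) : ℝ :=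
  ρ * (if b = b' then 1 else 0) + (1 - ρ) * bern p b'

/-- Characters are eigenfunctions of the noise: a refreshed coordinate in S contributes the mean of
`phi`, which is zero, so each element of S yields a factor ρ. -/
theorem sum_noise_chi (p ρ : ℝ) (S : Finset E) (ω : E → Bool) :
    ∑ ω' : E → Bool, (∏ e, noise p ρ (ω e) (ω' e)) * chi p S ω' = ρ ^ #S * chi p S ω := by
  have h1 : ∀ b : Bool, ∑ b', noise p ρ b b' = 1 := fun b => by
    cases b <;> simp [noise, bern] <;> ring
  have h2 : ∀ b : Bool, ∑ b', noise p ρ b b' * phi p b' = ρ * phi p b := fun b => by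
    have := sum_bern_phi p
    simp only [Fintype.sum_bool] at this
    cases b <;> simp [noise] <;> linear_combination (1 - ρ) * this
  have h3 : ρ ^ #S = ∏ e, if e ∈ S then ρ else 1 := by simp [Finset.prod_ite_mem]
  simp only [chi_eq_prod, h3, ← Finset.prod_mul_distrib]
  rw [sum_bool_prod fun e b' => noise p ρ (ω e) b' * if e ∈ S then phi p b' else 1]
  refine Finset.prod_congr rfl fun e _ => ?_
  by_cases he : e ∈ S
  · simpa only [he, if_true] using h2 (ω e)
  · simpa only [he, if_false, mul_one] using h1 (ω e)

/-- The joint expectation of a configuration and its noised version. -/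
noncomputable def ex₂ (p ρ : ℝ) (F : (E → Bool) → (E → Bool) → ℝ) : ℝ :=
  ∑ ω, ∑ ω', (∏ e, bern p (ω e) * noise p ρ (ω e) (ω' e)) * F ω ω'

theorem ex₂_mul {p : ℝ} (h0 : 0 < p) (h1 : p < 1) (ρ : ℝ) (f g : (E → Bool) → ℝ) :
    ex₂ p ρ (fun ω ω' => f ω * g ω') = ∑ S, ρ ^ #S * (coef p f S * coef p g S) := by
  have h : ∀ ω, ∑ ω', (∏ e, noise p ρ (ω e) (ω' e)) * g ω' =
      ∑ S, coef p g S * (ρ ^ #S * chi p S ω) := fun ω => by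
    simp only [← sum_noise_chi, Finset.mul_sum]
    rw [Finset.sum_comm]
    refine Finset.sum_congr rfl fun ω' _ => ?_
    conv_lhs => rw [fourier_expansion h0 h1 g ω', Finset.mul_sum]
    exact Finset.sum_congr rfl fun _ _ => by ring
  calc ex₂ p ρ (fun ω ω' => f ω * g ω') =
      ex p (fun ω => f ω * ∑ ω', (∏ e, noise p ρ (ω e) (ω' e)) * g ω') := by
        simp only [ex₂, ex, wt, Finset.mul_sum, Finset.prod_mul_distrib]
        exact Finset.sum_congr rfl fun _ _ => Finset.sum_congr rfl fun _ _ => by ring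
    _ = ex p (fun ω => ∑ S, (ρ ^ #S * coef p g S) * (f ω * chi p S ω)) := by
        congr 1; funext ω; rw [h, Finset.mul_sum]
        exact Finset.sum_congr rfl fun _ _ => by ring
    _ = _ := by
        rw [ex_sum]
        exact Finset.sum_congr rfl fun _ _ => by rw [ex_const_mul]; simp only [coef]; ring

theorem parseval_sum {p : ℝ} (h0 : 0 < p) (h1 : p < 1) (f : (E → Bool) → ℝ) :
    ex p (fun ω => f ω ^ 2) = ∑ S, coef p f S ^ 2 := by
  simpa only [pow_two] using parseval h0 h1 f f

theorem ex_chi_mul_chi {p : ℝ} (h0 : 0 < p) (h1 : p < 1) (S T : Finset E) :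
    ex p (fun ω => chi p S ω * chi p T ω) = if S = T then 1 else 0 := by
  have hphi : ∀ b, bern p b * (phi p b * phi p b) = bern p (!b) := fun b => by
    have h := one_add_phi h0 h1 b b
    have h' := sum_bern p
    simp only [Fintype.sum_bool] at h'
    simp only [if_true] at h
    cases b <;> simp <;> linarith
  have hs := sum_bern_phi p
  have hs' := sum_bern p
  simp only [Fintype.sum_bool] at hs hs'
  simp only [ex, wt, chi_eq_prod, ← Finset.prod_mul_distrib]
  rw [sum_bool_prod fun e b => bern p b *
    ((if e ∈ S then phi p b else 1) * if e ∈ T then phi p b else 1)]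
  have : ∀ e, (∑ b, bern p b * ((if e ∈ S then phi p b else 1) * if e ∈ T then phi p b else 1)) =
      if (e ∈ S ↔ e ∈ T) then 1 else 0 := fun e => by
    have h2 := hphi true
    have h3 := hphi false
    simp only [Bool.not_true, Bool.not_false] at h2 h3
    by_cases hS : e ∈ S <;> by_cases hT : e ∈ T <;>
      simp only [hS, hT, if_true, if_false, Fintype.sum_bool, mul_one, one_mul, iff_true,
        iff_false, not_true, h2, h3] <;> linarith
  simp only [this]
  rw [Finset.prod_ite_zero]
  simp [Finset.ext_iff]

/-- The part of degree `m` of the Fourier–Walsh expansion. -/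
noncomputable def level (p : ℝ) (m : ℕ) (f : (E → Bool) → ℝ) (ω : E → Bool) : ℝ :=
  ∑ S with #S = m, coef p f S * chi p S ω

theorem coef_level {p : ℝ} (h0 : 0 < p) (h1 : p < 1) (m : ℕ) (f : (E → Bool) → ℝ) (S : Finset E) :
    coef p (level p m f) S = if #S = m then coef p f S else 0 := by
  have : coef p (level p m f) S =
      ∑ T with #T = m, coef p f T * ex p (fun ω => chi p T ω * chi p S ω) := by
    simp only [coef, level, Finset.sum_mul, ← ex_const_mul]
    rw [ex_sum]
    refine Finset.sum_congr rfl fun T _ => ?_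
    congr 1; funext ω; ring
  simp [this, ex_chi_mul_chi h0 h1]

theorem chi_splice (p : ℝ) (J T : Finset E) (ω ω' : E → Bool) :
    chi p T (splice J ω ω') = chi p (T ∩ J) ω * chi p (T \ J) ω' := by
  rw [chi, ← Finset.prod_inter_mul_prod_sdiff T J]
  congr 1
  · refine Finset.prod_congr rfl fun e he => ?_
    rw [splice_of_mem (Finset.mem_inter.1 he).2]
  · refine Finset.prod_congr rfl fun e he => ?_
    rw [splice_of_notMem (Finset.mem_sdiff.1 he).2]

/-- Once the coordinates in J are frozen, the character of T becomes a constant times that of T \ J.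
A set S of full size m then arises only from T with T \ J = S and #T = m, that is, from T = S. -/
theorem coef_level_splice {p : ℝ} (h0 : 0 < p) (h1 : p < 1) (m : ℕ) (f : (E → Bool) → ℝ)
    (J S : Finset E) (hS : #S = m) (ω : E → Bool) :
    coef p (fun ω' => level p m f (splice J ω ω')) S = if Disjoint S J then coef p f S else 0 := by
  have : coef p (fun ω' => level p m f (splice J ω ω')) S =
      ∑ T with #T = m, coef p f T * chi p (T ∩ J) ω *
        ex p (fun ω => chi p (T \ J) ω * chi p S ω) := by
    simp only [coef, level, Finset.sum_mul, ← ex_const_mul, chi_splice]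
    rw [ex_sum]
    refine Finset.sum_congr rfl fun T _ => ?_
    congr 1; funext ω; ring
  rw [this]
  simp only [ex_chi_mul_chi h0 h1]
  split_ifs with hd
  · rw [Finset.sum_eq_single S]
    · simp [Finset.disjoint_iff_inter_eq_empty.1 hd, Finset.sdiff_eq_self_of_disjoint hd, chi]
    · intro T hT hTS
      rw [if_neg, mul_zero]
      intro h
      have hsub : S ⊆ T := h ▸ Finset.sdiff_subset
      exact hTS (Finset.eq_of_subset_of_card_le hsub (by simp at hT; omega)).symm
    · simp [hS]
  · refine Finset.sum_eq_zero fun T hT => ?_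
    rw [if_neg, mul_zero]
    rintro rfl
    exact hd Finset.sdiff_disjoint

/-- The **Schramm–Steif inequality**: a function determined by a stopping set correlates with the
functions of degree `m` only through the coefficients that meet the stopping set. -/
theorem schramm_steif {p : ℝ} (h0 : 0 < p) (h1 : p < 1) {J : (E → Bool) → Finset E}
    (hJ : IsStopping J) {f : (E → Bool) → ℝ}
    (hf : ∀ ω ω', (∀ e ∈ J ω, ω e = ω' e) → f ω = f ω') (F : (E → Bool) → ℝ) {m : ℕ} (hm : m ≠ 0) :
    ex p (fun ω => f ω * level p m F ω) ^ 2 ≤ ex p (fun ω => f ω ^ 2) *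
      ∑ S with #S = m, coef p F S ^ 2 * ex p (fun ω => if Disjoint S (J ω) then 0 else 1) := by
  classical
  set g := level p m F with hg
  -- G is the conditional expectation of g given the revealed coordinates; f is determined by these,
  -- so f only correlates with G.
  set G : (E → Bool) → ℝ := fun ω => ex p fun ω' => g (splice (J ω) ω ω') with hG
  have e1 : ex p (fun ω => f ω * g ω) = ex p (fun ω => f ω * G ω) := by
    have h := ex_splice hJ p (fun ω _ => f ω * g ω)
    simp only [ex_const] at h
    rw [← h]
    congr 1; funext ω
    rw [hG, ← ex_const_mul]
    congr 1; funext ω'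
    rw [hf ω (splice (J ω) ω ω') fun e he => (splice_of_mem he _ _).symm]
  have e2 : ex p (fun ω => ex p fun ω' => g (splice (J ω) ω ω') ^ 2) = ex p fun ω => g ω ^ 2 := by
    have h := ex_splice hJ p (fun ω _ => g ω ^ 2)
    simpa only [ex_const] using h
  -- Parseval for g with the revealed coordinates frozen: G² is the term of the empty set, and the
  -- sets of size m that avoid J are other terms because m ≠ 0.
  have e3 : ∀ ω, G ω ^ 2 ≤ ex p (fun ω' => g (splice (J ω) ω ω') ^ 2) -
      ∑ S with #S = m, coef p F S ^ 2 * (if Disjoint S (J ω) then 1 else 0) := fun ω => by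
    rw [parseval_sum h0 h1, ← Finset.sum_filter_add_sum_filter_not _ (fun S => #S = m)]
    have : ∑ S with #S = m, coef p (fun ω' => g (splice (J ω) ω ω')) S ^ 2 =
        ∑ S with #S = m, coef p F S ^ 2 * (if Disjoint S (J ω) then 1 else 0) := by
      refine Finset.sum_congr rfl fun S hS => ?_
      rw [coef_level_splice h0 h1 m F (J ω) S (by simpa using hS)]
      split_ifs <;> simp
    rw [this, add_sub_cancel_left, hG]
    dsimp only
    rw [← coef_empty]
    exact Finset.single_le_sum
      (f := fun S => coef p (fun ω' => g (splice (J ω) ω ω')) S ^ 2)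
      (fun _ _ => sq_nonneg _) (by simp [hm.symm])
  have e4 : ex p (fun ω => g ω ^ 2) = ∑ S with #S = m, coef p F S ^ 2 := by
    rw [parseval_sum h0 h1, Finset.sum_filter]
    refine Finset.sum_congr rfl fun S _ => ?_
    rw [hg, coef_level h0 h1]; split_ifs <;> simp
  rw [e1]
  refine (ex_mul_sq_le h0.le h1.le f G).trans (mul_le_mul_of_nonneg_left ?_
    (ex_nonneg h0.le h1.le fun _ => sq_nonneg _))
  refine (ex_mono h0.le h1.le e3).trans (le_of_eq ?_)
  rw [ex_sub, e2, e4, ex_sum, ← Finset.sum_sub_distrib]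
  refine Finset.sum_congr rfl fun S _ => ?_
  have : ex p (fun ω => if Disjoint S (J ω) then (0 : ℝ) else 1) =
      1 - ex p (fun ω => if Disjoint S (J ω) then (1 : ℝ) else 0) := by
    rw [← ex_const (E := E) p 1, ← ex_sub]
    congr 1; funext ω
    rw [ex_const]; split_ifs <;> simp
  rw [this, ex_const_mul]; ring

/-- Let W be the weight of degree m of F = ∑ f_v, which is the sum over v of E[f_v · level m F]. The
Schramm–Steif inequality for each v and Cauchy–Schwarz over v give W² ≤ ∑ E f_v² · mD · W, since a
set of size m meets J_v only if one of its m elements lies in J_v. One factor W cancels. -/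
theorem sum_sq_coef_le {p : ℝ} (h0 : 0 < p) (h1 : p < 1) {V : Type*} [Fintype V]
    {J : V → (E → Bool) → Finset E} (hJ : ∀ v, IsStopping (J v)) {f : V → (E → Bool) → ℝ}
    (hf : ∀ v ω ω', (∀ e ∈ J v ω, ω e = ω' e) → f v ω = f v ω') {D : ℝ}
    (hD0 : 0 ≤ D) (hD : ∀ e, ∑ v, ex p (fun ω => if e ∈ J v ω then 1 else 0) ≤ D) {m : ℕ} (hm : m ≠ 0) :
    ∑ S with #S = m, coef p (fun ω => ∑ v, f v ω) S ^ 2 ≤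
      m * D * ∑ v, ex p (fun ω => f v ω ^ 2) := by
  classical
  set F : (E → Bool) → ℝ := fun ω => ∑ v, f v ω with hF
  set W := ∑ S with #S = m, coef p F S ^ 2 with hW
  set a : V → ℝ := fun v => ex p (fun ω => f v ω ^ 2) with ha
  set b : V → ℝ := fun v => ∑ S with #S = m, coef p F S ^ 2 *
    ex p (fun ω => if Disjoint S (J v ω) then 0 else 1) with hb
  have ha0 : ∀ v, 0 ≤ a v := fun v => ex_nonneg h0.le h1.le fun _ => sq_nonneg _
  have hb0 : ∀ v, 0 ≤ b v := fun v => Finset.sum_nonneg fun S _ => mul_nonneg (sq_nonneg _)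
    (ex_nonneg h0.le h1.le fun _ => by split_ifs <;> norm_num)
  have hW0 : 0 ≤ W := Finset.sum_nonneg fun _ _ => sq_nonneg _
  have e1 : W = ∑ v, ex p (fun ω => f v ω * level p m F ω) := by
    rw [← ex_sum]
    have : (fun ω => ∑ v, f v ω * level p m F ω) = fun ω => F ω * level p m F ω := by
      funext ω; rw [hF, Finset.sum_mul]
    rw [this, parseval h0 h1, hW, Finset.sum_filter]
    refine Finset.sum_congr rfl fun S _ => ?_
    rw [coef_level h0 h1]; split_ifs <;> simp [pow_two]
  have e2 : W ≤ ∑ v, √(a v) * √(b v) := by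
    rw [e1]
    refine Finset.sum_le_sum fun v _ => ?_
    rw [← Real.sqrt_mul (ha0 v)]
    exact Real.le_sqrt_of_sq_le (schramm_steif h0 h1 (hJ v) (hf v) F hm)
  have e3 : W ^ 2 ≤ (∑ v, a v) * ∑ v, b v := by
    calc W ^ 2 ≤ (∑ v, √(a v) * √(b v)) ^ 2 := pow_le_pow_left₀ hW0 e2 2
      _ ≤ (∑ v, √(a v) ^ 2) * ∑ v, √(b v) ^ 2 := Finset.sum_mul_sq_le_sq_mul_sq _ _ _
      _ = _ := by simp only [Real.sq_sqrt (ha0 _), Real.sq_sqrt (hb0 _)]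
  have e4 : ∑ v, b v ≤ W * (m * D) := by
    rw [hb, Finset.sum_comm, hW, Finset.sum_mul]
    refine Finset.sum_le_sum fun S hS => ?_
    rw [← Finset.mul_sum]
    refine mul_le_mul_of_nonneg_left ?_ (sq_nonneg _)
    calc ∑ v, ex p (fun ω => if Disjoint S (J v ω) then (0 : ℝ) else 1) ≤
        ∑ v, ∑ e ∈ S, ex p (fun ω => if e ∈ J v ω then (1 : ℝ) else 0) := by
          refine Finset.sum_le_sum fun v _ => ?_
          rw [← ex_sum]
          refine ex_mono h0.le h1.le fun ω => ?_
          split_ifs with hd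
          · exact Finset.sum_nonneg fun _ _ => by split_ifs <;> norm_num
          · obtain ⟨e, he, he'⟩ := Finset.not_disjoint_iff.1 hd
            have := Finset.single_le_sum (f := fun e => if e ∈ J v ω then (1 : ℝ) else 0)
              (fun _ _ => by split_ifs <;> norm_num) he
            simpa [he'] using this
      _ = ∑ e ∈ S, ∑ v, ex p (fun ω => if e ∈ J v ω then (1 : ℝ) else 0) := Finset.sum_comm
      _ ≤ ∑ e ∈ S, D := Finset.sum_le_sum fun e _ => hD e
      _ = m * D := by simp [(Finset.mem_filter.1 hS).2]
  have e5 : W * W ≤ (m * D * ∑ v, a v) * W := by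
    have := mul_le_mul_of_nonneg_left e4 (Finset.sum_nonneg fun v _ => ha0 v : 0 ≤ ∑ v, a v)
    nlinarith
  rcases hW0.eq_or_lt with h | h
  · rw [← h]
    exact mul_nonneg (mul_nonneg m.cast_nonneg hD0) (Finset.sum_nonneg fun v _ => ha0 v)
  · exact le_of_mul_le_mul_right e5 h

/-- Noise sensitivity: the correlation of a sum of functions that are determined by stopping sets
of small revealment. -/
theorem ex₂_mul_self_le {p : ℝ} (h0 : 0 < p) (h1 : p < 1) {V : Type*} [Fintype V]
    {J : V → (E → Bool) → Finset E} (hJ : ∀ v, IsStopping (J v)) {f : V → (E → Bool) → ℝ}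
    (hf : ∀ v ω ω', (∀ e ∈ J v ω, ω e = ω' e) → f v ω = f v ω') {D : ℝ} (hD0 : 0 ≤ D)
    (hD : ∀ e, ∑ v, ex p (fun ω => if e ∈ J v ω then 1 else 0) ≤ D) {ρ : ℝ} (hρ0 : 0 ≤ ρ)
    (hρ1 : ρ < 1) :
    ex₂ p ρ (fun ω ω' => (∑ v, f v ω) * ∑ v, f v ω') ≤
      ex p (fun ω => ∑ v, f v ω) ^ 2 + D * (∑ v, ex p (fun ω => f v ω ^ 2)) / (1 - ρ) ^ 2 := by
  classical
  rw [ex₂_mul h0 h1]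
  set F : (E → Bool) → ℝ := fun ω => ∑ v, f v ω with hF
  set A := ∑ v, ex p (fun ω => f v ω ^ 2)
  have hA : 0 ≤ A := Finset.sum_nonneg fun v _ => ex_nonneg h0.le h1.le fun _ => sq_nonneg _
  have e1 : ∑ S, ρ ^ #S * (coef p F S * coef p F S) =
      ∑ m ∈ Finset.range (Fintype.card E + 1), ∑ S with #S = m, ρ ^ #S * coef p F S ^ 2 := by
    rw [Finset.sum_fiberwise_of_maps_to]
    · simp only [pow_two]
    · intro S _; simpa [Nat.lt_succ_iff] using Finset.card_le_univ S
  rw [e1, Finset.sum_range_succ']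
  have e2 : ∑ S : Finset E with #S = 0, ρ ^ #S * coef p F S ^ 2 = ex p F ^ 2 := by
    simp [Finset.filter_eq', coef_empty, Finset.card_eq_zero]
  rw [e2, add_comm]
  gcongr
  have e3 : ∀ m : ℕ, ∑ S : Finset E with #S = m + 1, ρ ^ #S * coef p F S ^ 2 ≤
      D * A * (((m + 1 : ℕ) : ℝ) * ρ ^ (m + 1)) := fun m => by
    have h := sum_sq_coef_le h0 h1 hJ hf hD0 hD (Nat.succ_ne_zero m)
    calc ∑ S : Finset E with #S = m + 1, ρ ^ #S * coef p F S ^ 2 =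
        ρ ^ (m + 1) * ∑ S : Finset E with #S = m + 1, coef p F S ^ 2 := by
          rw [Finset.mul_sum]
          exact Finset.sum_congr rfl fun S hS => by rw [(Finset.mem_filter.1 hS).2]
      _ ≤ ρ ^ (m + 1) * (((m + 1 : ℕ) : ℝ) * D * A) :=
          mul_le_mul_of_nonneg_left h (pow_nonneg hρ0 _)
      _ = _ := by ring
  refine (Finset.sum_le_sum fun m _ => e3 m).trans ?_
  rw [← Finset.mul_sum, ← mul_one_div (D * A)]
  refine mul_le_mul_of_nonneg_left ?_ (mul_nonneg hD0 hA)
  -- Degree m contributes a multiple of m ρ^m, and these numbers sum to ρ/(1-ρ)².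
  have e4 := hasSum_coe_mul_geometric_of_norm_lt_one
    (show ‖ρ‖ < 1 by rwa [Real.norm_of_nonneg hρ0])
  have e5 := e4.summable.sum_le_tsum (Finset.range (Fintype.card E + 1))
    fun i _ => mul_nonneg i.cast_nonneg (pow_nonneg hρ0 i)
  rw [e4.tsum_eq, Finset.sum_range_succ'] at e5
  simp only [Nat.cast_zero, zero_mul, add_zero] at e5
  exact e5.trans (div_le_div_of_nonneg_right hρ1.le (sq_nonneg _))

end ProductSpace

/-! ### Exploration of components and its recursion. -/

section Exploration

open scoped Finset Classical

variable {V : Type*} [Fintype V]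

/-- The graph whose edges are the open (non-diagonal) pairs of a configuration. -/
def toGraph (ω : Sym2 V → Bool) : SimpleGraph V := SimpleGraph.fromEdgeSet {e | ω e = true}

theorem toGraph_adj (ω : Sym2 V → Bool) (x y : V) :
    (toGraph ω).Adj x y ↔ ω s(x, y) = true ∧ x ≠ y := by
  simp [toGraph]

/-- The vertices that can be reached from `A` along edges of `G` through vertices of `U`. -/
noncomputable def reach (G : SimpleGraph V) (A U : Finset V) : Finset V :=
  {y | ∃ a ∈ A, Relation.ReflTransGen (fun x y => G.Adj x y ∧ y ∈ U) a y}

theorem mem_reach {G : SimpleGraph V} {A U : Finset V} {y : V} :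
    y ∈ reach G A U ↔ ∃ a ∈ A, Relation.ReflTransGen (fun x y => G.Adj x y ∧ y ∈ U) a y := by
  simp [reach]

theorem subset_reach (G : SimpleGraph V) (A U : Finset V) : A ⊆ reach G A U := fun a ha =>
  mem_reach.2 ⟨a, ha, .refl⟩

theorem mem_reach_of_adj {G : SimpleGraph V} {A U : Finset V} {y z : V} (hy : y ∈ reach G A U)
    (h : G.Adj y z) (hz : z ∈ U) : z ∈ reach G A U := by
  obtain ⟨a, ha, h'⟩ := mem_reach.1 hy
  exact mem_reach.2 ⟨a, ha, h'.tail ⟨h, hz⟩⟩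

theorem reach_subset_of_closed {G : SimpleGraph V} {A U T : Finset V} (hA : A ⊆ T)
    (h : ∀ y ∈ T, y ∈ reach G A U → ∀ z ∈ U, G.Adj y z → z ∈ T) : reach G A U ⊆ T := by
  intro y hy
  obtain ⟨a, ha, h'⟩ := mem_reach.1 hy
  have : y ∈ T ∧ y ∈ reach G A U := by
    clear hy
    induction h' with
    | refl => exact ⟨hA ha, subset_reach G A U ha⟩
    | tail _ hbc ih => exact ⟨h _ ih.1 ih.2 _ hbc.2 hbc.1, mem_reach_of_adj ih.2 hbc.1 hbc.2⟩
  exact this.1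

theorem reach_subset_union (G : SimpleGraph V) (A U : Finset V) : reach G A U ⊆ A ∪ U :=
  reach_subset_of_closed Finset.subset_union_left
    fun _ _ _ _ hz _ => Finset.mem_union_right _ hz

theorem reach_empty (G : SimpleGraph V) (U : Finset V) : reach G ∅ U = ∅ := by
  ext; simp [mem_reach]

/-- One exploration step: the active vertex x is retired and its unexplored neighbours N become
active. -/
theorem reach_eq_insert {G : SimpleGraph V} {A U N : Finset V} {x : V} (hx : x ∈ A)
    (hN : ∀ y, y ∈ N ↔ y ∈ U ∧ G.Adj x y) :
    reach G A U = insert x (reach G (A.erase x ∪ N) (U \ N)) := by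
  apply Finset.Subset.antisymm
  · refine reach_subset_of_closed ?_ ?_
    · intro a ha
      by_cases h : a = x
      · exact h ▸ Finset.mem_insert_self _ _
      · exact Finset.mem_insert_of_mem (subset_reach _ _ _
          (Finset.mem_union_left _ (Finset.mem_erase.2 ⟨h, ha⟩)))
    · intro y hy _ z hz hyz
      refine Finset.mem_insert_of_mem ?_
      by_cases hzN : z ∈ N
      · exact subset_reach _ _ _ (Finset.mem_union_right _ hzN)
      · rcases Finset.mem_insert.1 hy with rfl | hy
        · exact absurd ((hN z).2 ⟨hz, hyz⟩) hzN
        · exact mem_reach_of_adj hy hyz (Finset.mem_sdiff.2 ⟨hz, hzN⟩)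
  · refine Finset.insert_subset (subset_reach _ _ _ hx) (reach_subset_of_closed ?_ ?_)
    · refine Finset.union_subset ((Finset.erase_subset _ _).trans (subset_reach _ _ _)) ?_
      intro y hy
      exact mem_reach_of_adj (subset_reach _ _ _ hx) ((hN y).1 hy).2 ((hN y).1 hy).1
    · intro y hy _ z hz hyz
      exact mem_reach_of_adj hy hyz (Finset.mem_sdiff.1 hz).1

theorem reach_congr {G G' : SimpleGraph V} {A U : Finset V}
    (h : ∀ y ∈ A ∪ U, ∀ z ∈ U, G.Adj y z ↔ G'.Adj y z) : reach G A U = reach G' A U := by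
  apply Finset.Subset.antisymm
  · exact reach_subset_of_closed (subset_reach _ _ _) fun y hy _ z hz hyz =>
      mem_reach_of_adj hy ((h y (reach_subset_union _ _ _ hy) z hz).1 hyz) hz
  · exact reach_subset_of_closed (subset_reach _ _ _) fun y hy _ z hz hyz =>
      mem_reach_of_adj hy ((h y (reach_subset_union _ _ _ hy) z hz).2 hyz) hz

/-- The probability that the exploration of a random graph with `a` active and `u` unexplored
vertices lasts for more than `s` steps. -/
noncomputable def survival (p : ℝ) : ℕ → ℕ → ℕ → ℝ
  | 0, a, _ => if a = 0 then 0 else 1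
  | s + 1, a, u => if a = 0 then 0 else
      ∑ b ∈ Finset.range (u + 1), (u.choose b) * (p ^ b * (1 - p) ^ (u - b)) *
        survival p s (a - 1 + b) (u - b)

theorem ex_neighbors (p : ℝ) {U N : Finset V} (hN : N ⊆ U) (x : V) :
    ex p (fun ω : Sym2 V → Bool => if {u ∈ U | ω s(x, u) = true} = N then (1 : ℝ) else 0) =
      p ^ #N * (1 - p) ^ (#U - #N) := by
  set D := U.image fun u => s(x, u) with hD
  have hinj : Function.Injective fun u : V => s(x, u) := fun a b h => Sym2.congr_right.1 h
  set g : Sym2 V → Bool → ℝ := fun e b =>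
    if e ∈ D then (if (b = true ↔ e ∈ N.image fun u => s(x, u)) then 1 else 0) else 1 with hg
  have e1 : ∀ ω : Sym2 V → Bool, (if {u ∈ U | ω s(x, u) = true} = N then (1 : ℝ) else 0) =
      ∏ e, g e (ω e) := fun ω => by
    simp only [hg]
    rw [Finset.prod_ite_mem, Finset.univ_inter, hD, Finset.prod_image hinj.injOn]
    simp only [hinj.mem_finset_image]
    have hiff : {u ∈ U | ω s(x, u) = true} = N ↔ ∀ u ∈ U, (ω s(x, u) = true ↔ u ∈ N) := ?_
    · by_cases hall : ∀ u ∈ U, (ω s(x, u) = true ↔ u ∈ N)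
      · rw [if_pos (hiff.2 hall)]
        exact (Finset.prod_eq_one fun u hu => if_pos (hall u hu)).symm
      · rw [if_neg (mt hiff.1 hall)]
        push Not at hall
        obtain ⟨u, hu, hu'⟩ := hall
        refine (Finset.prod_eq_zero hu (if_neg ?_)).symm
        tauto
    constructor
    · rintro rfl u hu; simp [hu]
    · intro h; ext u; simp only [Finset.mem_filter]
      exact ⟨fun hu => (h u hu.1).1 hu.2, fun hu => ⟨hN hu, (h u (hN hu)).2 hu⟩⟩
  simp only [ex, e1, wt, ← Finset.prod_mul_distrib]
  rw [sum_bool_prod fun e b => bern p b * g e b]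
  have e2 : ∀ e, ∑ b, bern p b * g e b =
      if e ∈ D then (if e ∈ N.image fun u => s(x, u) then p else 1 - p) else 1 := fun e => by
    simp only [hg]
    by_cases h1 : e ∈ D <;> by_cases h2 : e ∈ N.image fun u => s(x, u) <;>
      simp only [h1, h2, if_true, if_false, Fintype.sum_bool, bern] <;> simp
  simp only [e2]
  rw [Finset.prod_ite_mem, Finset.univ_inter, hD, Finset.prod_image hinj.injOn]
  simp only [hinj.mem_finset_image]
  rw [Finset.prod_ite, Finset.prod_const, Finset.prod_const, ← Finset.card_sdiff_of_subset hN]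
  congr 3
  · ext u; simpa using fun h => hN h
  · ext u; simp

/-- The first step reads only pairs that contain the retired vertex x, and the remaining exploration
reads none of them. Hence the two are independent, the number of new active vertices is binomial,
and only cardinalities matter. -/
theorem ex_reach (p : ℝ) (s : ℕ) (A U : Finset V) (h : Disjoint A U) :
    ex p (fun ω : Sym2 V → Bool => if s + 1 ≤ #(reach (toGraph ω) A U) then (1 : ℝ) else 0) =
      survival p s #A #U := by
  induction s generalizing A U with
  | zero =>
    rcases A.eq_empty_or_nonempty with rfl | hA
    · simp [reach_empty, survival, ex_const]
    · have : ∀ ω : Sym2 V → Bool, 0 + 1 ≤ #(reach (toGraph ω) A U) := fun ω =>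
        (Finset.card_pos.2 hA).trans_le (Finset.card_le_card (subset_reach _ _ _))
      simp only [this, if_true, ex_const, survival, Finset.card_eq_zero, hA.ne_empty, if_false]
  | succ s ih =>
    rcases A.eq_empty_or_nonempty with rfl | ⟨x, hx⟩
    · simp [reach_empty, survival, ex_const]
    have hA0 : #A ≠ 0 := Finset.card_ne_zero_of_mem hx
    have hxU : x ∉ U := Finset.disjoint_left.1 h hx
    have e1 : ∀ ω : Sym2 V → Bool,
        (if s + 1 + 1 ≤ #(reach (toGraph ω) A U) then (1 : ℝ) else 0) =
        ∑ N ∈ U.powerset, (if {u ∈ U | ω s(x, u) = true} = N then (1 : ℝ) else 0) *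
          (if s + 1 ≤ #(reach (toGraph ω) (A.erase x ∪ N) (U \ N)) then (1 : ℝ) else 0) := by
      intro ω
      set N := {u ∈ U | ω s(x, u) = true} with hN
      rw [Finset.sum_eq_single_of_mem N (Finset.mem_powerset.2 (Finset.filter_subset _ _))
        fun N' _ hN' => by rw [if_neg hN'.symm, zero_mul], if_pos rfl, one_mul]
      rw [reach_eq_insert (N := N) hx fun y => by
        simp only [hN, Finset.mem_filter, toGraph_adj, and_congr_right_iff]
        intro hy
        exact ⟨fun h' => ⟨h', fun hxy => hxU (hxy ▸ hy)⟩, fun h' => h'.1⟩]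
      have hxr : x ∉ reach (toGraph ω) (A.erase x ∪ N) (U \ N) := fun hxr => by
        have := reach_subset_union _ _ _ hxr
        simp only [Finset.mem_union, Finset.mem_erase, ne_eq, not_true, false_and, false_or,
          Finset.mem_sdiff] at this
        rcases this with h' | h'
        · exact hxU (Finset.mem_filter.1 h').1
        · exact hxU h'.1
      simp only [Finset.card_insert_of_notMem hxr, Nat.add_le_add_iff_right]
    simp only [e1]
    rw [ex_sum]
    have e2 : ∀ N ∈ U.powerset, ex p (fun ω : Sym2 V → Bool =>
        (if {u ∈ U | ω s(x, u) = true} = N then (1 : ℝ) else 0) *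
          (if s + 1 ≤ #(reach (toGraph ω) (A.erase x ∪ N) (U \ N)) then (1 : ℝ) else 0)) =
        p ^ #N * (1 - p) ^ (#U - #N) * survival p s (#A - 1 + #N) (#U - #N) := by
      intro N hN
      have hNU := Finset.mem_powerset.1 hN
      have hdA : Disjoint (A.erase x) N :=
        (h.mono_left (Finset.erase_subset _ _)).mono_right hNU
      have hd : Disjoint (A.erase x ∪ N) (U \ N) := by
        rw [Finset.disjoint_union_left]
        exact ⟨(h.mono_left (Finset.erase_subset _ _)).mono_right Finset.sdiff_subset,
          Finset.disjoint_sdiff⟩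
      rw [ex_mul_of_disjoint p (U.image fun u => s(x, u)), ex_neighbors p hNU, ih _ _ hd,
        Finset.card_union_of_disjoint hdA, Finset.card_erase_of_mem hx,
        Finset.card_sdiff_of_subset hNU]
      · intro ω ω' hω
        have : {u ∈ U | ω s(x, u) = true} = {u ∈ U | ω' s(x, u) = true} :=
          Finset.filter_congr fun u hu => by rw [hω _ (Finset.mem_image_of_mem _ hu)]
        rw [this]
      · intro ω ω' hω
        rw [reach_congr (G' := toGraph ω')]
        intro y hy z hz
        have hne : ∀ w, w ∈ A.erase x ∪ N ∪ U \ N → w ≠ x := by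
          rintro w hw rfl
          simp only [Finset.mem_union, Finset.mem_erase, ne_eq, not_true, false_and, false_or,
            Finset.mem_sdiff] at hw
          rcases hw with hw | hw
          · exact hxU (hNU hw)
          · exact hxU hw.1
        rw [toGraph_adj, toGraph_adj, hω]
        intro hmem
        obtain ⟨u, -, hu⟩ := Finset.mem_image.1 hmem
        rcases Sym2.eq_iff.1 hu with ⟨h1, -⟩ | ⟨h1, -⟩
        · exact hne y hy h1.symm
        · exact hne z (Finset.mem_union_right _ hz) h1.symm
    rw [Finset.sum_congr rfl e2]
    rw [Finset.sum_powerset_apply_card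
      (fun k => p ^ k * (1 - p) ^ (#U - k) * survival p s (#A - 1 + k) (#U - k))]
    simp only [survival, if_neg hA0, nsmul_eq_mul, mul_assoc]

/-! ### Components -/

/-- The connected component of a vertex. -/
noncomputable def comp (G : SimpleGraph V) (v : V) : Finset V := {w | G.Reachable v w}

theorem mem_comp {G : SimpleGraph V} {v w : V} : w ∈ comp G v ↔ G.Reachable v w := by simp [comp]

theorem comp_eq_reach (G : SimpleGraph V) (v : V) : comp G v = reach G {v} (Finset.univ.erase v) := by
  ext w
  rw [mem_comp, SimpleGraph.reachable_iff_reflTransGen]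
  constructor
  · intro h
    induction h with
    | refl => exact subset_reach _ _ _ (Finset.mem_singleton_self v)
    | @tail b c _ hbc ih =>
      by_cases hc : c = v
      · rw [hc]; exact subset_reach _ _ _ (Finset.mem_singleton_self v)
      · exact mem_reach_of_adj ih hbc (by simpa using hc)
  · intro h
    obtain ⟨a, ha, h'⟩ := mem_reach.1 h
    rw [Finset.mem_singleton.1 ha] at h'
    exact Relation.ReflTransGen.mono (fun _ _ h => h.1) _ _ h'

theorem ex_comp (p : ℝ) (s : ℕ) (v : V) :
    ex p (fun ω : Sym2 V → Bool => if s + 1 ≤ #(comp (toGraph ω) v) then (1 : ℝ) else 0) =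
      survival p s 1 (Fintype.card V - 1) := by
  simp only [comp_eq_reach]
  rw [ex_reach p s {v} _ (by simp)]
  simp [Finset.card_erase_of_mem]

/-- The pairs that touch the component of `v`. -/
noncomputable def touching (v : V) (ω : Sym2 V → Bool) : Finset (Sym2 V) :=
  {e | ∃ x ∈ comp (toGraph ω) v, x ∈ e}

theorem comp_congr {v : V} {ω ω' : Sym2 V → Bool} (h : ∀ e ∈ touching v ω, ω e = ω' e) :
    comp (toGraph ω) v = comp (toGraph ω') v := by
  have key : ∀ x ∈ comp (toGraph ω) v, ∀ y, (toGraph ω).Adj x y ↔ (toGraph ω').Adj x y :=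
    fun x hx y => by
      rw [toGraph_adj, toGraph_adj, h]
      simp only [touching, Finset.mem_filter, Finset.mem_univ, true_and]
      exact ⟨x, hx, Sym2.mem_mk_left x y⟩
  ext w
  constructor
  · intro hw
    have hw' := mem_comp.1 hw
    rw [SimpleGraph.reachable_iff_reflTransGen] at hw'
    clear hw
    induction hw' with
    | refl => exact mem_comp.2 (.refl _)
    | @tail b c hb hbc ih =>
      have hb' : b ∈ comp (toGraph ω) v :=
        mem_comp.2 ((SimpleGraph.reachable_iff_reflTransGen _ _).2 hb)
      exact mem_comp.2 ((mem_comp.1 ih).trans ((key b hb' c).1 hbc).reachable)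
  · intro hw
    have hw' := mem_comp.1 hw
    rw [SimpleGraph.reachable_iff_reflTransGen] at hw'
    clear hw
    induction hw' with
    | refl => exact mem_comp.2 (.refl _)
    | @tail b c hb hbc ih =>
      exact mem_comp.2 ((mem_comp.1 ih).trans ((key b ih c).2 hbc).reachable)

theorem isStopping_touching (v : V) : IsStopping (touching v) := by
  intro ω ω' h
  simp only [touching, comp_congr h]

/-- Exchange the roles: the component of v touches {x, y} exactly if v lies in the component of x or
of y, so the total revealment of a pair is at most a sum of two expected component sizes. -/
theorem ex_touching_le {p : ℝ} (h0 : 0 ≤ p) (h1 : p ≤ 1) (e : Sym2 V) {D : ℝ}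
    (hD : ∀ v, ex p (fun ω : Sym2 V → Bool => (#(comp (toGraph ω) v) : ℝ)) ≤ D) :
    ∑ v, ex p (fun ω => if e ∈ touching v ω then 1 else 0) ≤ 2 * D := by
  induction e with
  | _ x y =>
  rw [← ex_sum]
  have : ∀ ω : Sym2 V → Bool, ∑ v, (if s(x, y) ∈ touching v ω then (1 : ℝ) else 0) ≤
      #(comp (toGraph ω) x) + #(comp (toGraph ω) y) := fun ω => by
    rw [Finset.sum_boole]
    norm_cast
    refine (Finset.card_le_card ?_).trans (Finset.card_union_le _ _)
    intro v
    simp only [touching, Finset.mem_filter, Finset.mem_univ, true_and, Sym2.mem_iff,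
      Finset.mem_union, mem_comp]
    rintro ⟨w, hw, rfl | rfl⟩
    · exact Or.inl hw.symm
    · exact Or.inr hw.symm
  refine (ex_mono h0 h1 this).trans ?_
  rw [ex_add]
  linarith [hD x, hD y]

/-- Two distinct large components are negatively correlated. -/
theorem ex_two_comps_le {p : ℝ} (h0 : 0 ≤ p) (h1 : p ≤ 1) (k : ℕ) (v w : V) :
    ex p (fun ω : Sym2 V → Bool => (if k ≤ #(comp (toGraph ω) v) then (1 : ℝ) else 0) *
        (if w ∉ comp (toGraph ω) v ∧ k ≤ #(comp (toGraph ω) w) then 1 else 0)) ≤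
      ex p (fun ω : Sym2 V → Bool => if k ≤ #(comp (toGraph ω) v) then 1 else 0) *
        ex p (fun ω : Sym2 V → Bool => if k ≤ #(comp (toGraph ω) w) then 1 else 0) := by
  have h := ex_splice (isStopping_touching v) p
    (fun ω _ => (if k ≤ #(comp (toGraph ω) v) then (1 : ℝ) else 0) *
        (if w ∉ comp (toGraph ω) v ∧ k ≤ #(comp (toGraph ω) w) then 1 else 0))
  simp only [ex_const] at h
  rw [← h, ← ex_mul_const]
  refine ex_mono h0 h1 fun ω => ?_
  rw [← ex_const_mul]
  refine ex_mono h0 h1 fun ω' => ?_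
  set ω'' := splice (touching v ω) ω ω'
  have hc : comp (toGraph ω) v = comp (toGraph ω'') v :=
    comp_congr fun e he => (splice_of_mem he _ _).symm
  rw [← hc]
  refine mul_le_mul_of_nonneg_left ?_ (by split_ifs <;> norm_num)
  by_cases hw : w ∉ comp (toGraph ω) v ∧ k ≤ #(comp (toGraph ω'') w)
  · rw [if_pos hw, if_pos]
    refine hw.2.trans (Finset.card_le_card ?_)
    -- A path from w in the spliced configuration never enters the component of v, so it uses only
    -- unrevealed pairs, and these carry the independent configuration ω'.
    have key : ∀ z, (toGraph ω'').Reachable w z →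
        z ∉ comp (toGraph ω'') v ∧ (toGraph ω').Reachable w z := by
      intro z hz
      rw [SimpleGraph.reachable_iff_reflTransGen] at hz
      induction hz with
      | refl => exact ⟨hc ▸ hw.1, .refl _⟩
      | @tail b c hb hbc ih =>
        have hcn : c ∉ comp (toGraph ω'') v := fun hcv =>
          ih.1 (mem_comp.2 ((mem_comp.1 hcv).trans hbc.symm.reachable))
        refine ⟨hcn, ih.2.trans (SimpleGraph.Adj.reachable ?_)⟩
        rw [toGraph_adj] at hbc ⊢
        refine ⟨?_, hbc.2⟩
        rw [← hbc.1]
        refine (splice_of_notMem ?_ _ _).symm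
        simp only [touching, Finset.mem_filter, Finset.mem_univ, true_and, Sym2.mem_iff, hc]
        rintro ⟨u, hu, rfl | rfl⟩
        · exact ih.1 hu
        · exact hcn hu
    intro z hz
    exact mem_comp.2 (key z (mem_comp.1 hz)).2
  · rw [if_neg hw]; split_ifs <;> norm_num

end Exploration

/-! ### Upper bounds for the survival probability from exponential martingales. -/

section SurvivalUpper

theorem sum_binomial (p x y : ℝ) (u : ℕ) :
    ∑ b ∈ Finset.range (u + 1), (u.choose b) * (p ^ b * (1 - p) ^ (u - b)) *
      (x ^ b * y ^ (u - b)) = (p * x + (1 - p) * y) ^ u := by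
  rw [add_pow]
  exact Finset.sum_congr rfl fun b _ => by rw [mul_pow, mul_pow]; ring

theorem sum_binomial_one (p : ℝ) (u : ℕ) :
    ∑ b ∈ Finset.range (u + 1), (u.choose b) * (p ^ b * (1 - p) ^ (u - b)) = 1 := by
  simpa using sum_binomial p 1 1 u

variable {p : ℝ}

theorem binomial_nonneg (h0 : 0 ≤ p) (h1 : p ≤ 1) (u b : ℕ) :
    0 ≤ (u.choose b) * (p ^ b * (1 - p) ^ (u - b)) :=
  mul_nonneg (Nat.cast_nonneg _) (mul_nonneg (pow_nonneg h0 _) (pow_nonneg (by linarith) _))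

theorem sum_binomial_le (h0 : 0 ≤ p) (h1 : p ≤ 1) (u : ℕ) {f g : ℕ → ℝ}
    (h : ∀ b ≤ u, f b ≤ g b) :
    ∑ b ∈ Finset.range (u + 1), (u.choose b) * (p ^ b * (1 - p) ^ (u - b)) * f b ≤
      ∑ b ∈ Finset.range (u + 1), (u.choose b) * (p ^ b * (1 - p) ^ (u - b)) * g b :=
  Finset.sum_le_sum fun b hb => mul_le_mul_of_nonneg_left
    (h b (Nat.lt_succ_iff.1 (Finset.mem_range.1 hb))) (binomial_nonneg h0 h1 u b)

theorem survival_zero_left (p : ℝ) (s u : ℕ) : survival p s 0 u = 0 := by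
  cases s <;> simp [survival]

theorem survival_succ (p : ℝ) (s u : ℕ) {a : ℕ} (ha : a ≠ 0) : survival p (s + 1) a u =
    ∑ b ∈ Finset.range (u + 1), (u.choose b) * (p ^ b * (1 - p) ^ (u - b)) *
      survival p s (a - 1 + b) (u - b) := by
  simp [survival, ha]

theorem survival_nonneg (h0 : 0 ≤ p) (h1 : p ≤ 1) (s a u : ℕ) : 0 ≤ survival p s a u := by
  induction s generalizing a u with
  | zero => unfold survival; split_ifs <;> norm_num
  | succ s ih =>
    unfold survival; split_ifs
    · exact le_rfl
    · exact Finset.sum_nonneg fun b _ => mul_nonneg (binomial_nonneg h0 h1 u b) (ih _ _)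

theorem survival_le_one (h0 : 0 ≤ p) (h1 : p ≤ 1) (s a u : ℕ) : survival p s a u ≤ 1 := by
  induction s generalizing a u with
  | zero => unfold survival; split_ifs <;> norm_num
  | succ s ih =>
    rcases eq_or_ne a 0 with rfl | ha
    · simp [survival]
    rw [survival_succ p s u ha]
    refine (sum_binomial_le h0 h1 u (g := fun _ => 1) fun b _ => ih _ _).trans ?_
    simp [sum_binomial_one]

theorem survival_succ_le (h0 : 0 ≤ p) (h1 : p ≤ 1) (s a u : ℕ) :
    survival p (s + 1) a u ≤ survival p s a u := by
  induction s generalizing a u with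
  | zero =>
    rcases eq_or_ne a 0 with rfl | ha
    · simp [survival]
    · simpa [survival, ha] using survival_le_one h0 h1 1 a u
  | succ s ih =>
    rcases eq_or_ne a 0 with rfl | ha
    · simp [survival]
    rw [survival_succ p (s + 1) u ha, survival_succ p s u ha]
    exact sum_binomial_le h0 h1 u fun b _ => ih _ _

theorem survival_anti (h0 : 0 ≤ p) (h1 : p ≤ 1) (a u : ℕ) :
    Antitone fun s => survival p s a u :=
  antitone_nat_of_succ_le fun s => survival_succ_le h0 h1 s a u

/-- Let T be the number of steps of the exploration. The condition on y makes y^a a lower bound for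
E[z^T], whence 1 - y^a ≥ E[1 - z^T] ≥ P(T > s)(1 - z^(s+1)). -/
theorem survival_mul_le (h0 : 0 ≤ p) (h1 : p ≤ 1) {y z : ℝ} (hy0 : 0 ≤ y) (hy1 : y ≤ 1)
    (hz0 : 0 ≤ z) (hz1 : z ≤ 1) {n : ℕ} (h : y ≤ z * (1 - p + p * y) ^ n) (s a u : ℕ)
    (hu : u ≤ n) : survival p s a u * (1 - z ^ (s + 1)) ≤ 1 - y ^ a := by
  have hq0 : 0 ≤ 1 - p + p * y := add_nonneg (by linarith) (mul_nonneg h0 hy0)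
  have hq1 : 1 - p + p * y ≤ 1 := by nlinarith
  induction s generalizing a u with
  | zero =>
    rcases eq_or_ne a 0 with rfl | ha
    · simp [survival]
    have h2 : y ^ a ≤ y := pow_le_of_le_one hy0 hy1 ha
    have h3 : y ≤ z := h.trans (mul_le_of_le_one_right hz0 (pow_le_one₀ hq0 hq1))
    simp [survival, ha]; linarith
  | succ s ih =>
    rcases eq_or_ne a 0 with rfl | ha
    · simp [survival]
    set P := survival p (s + 1) a u with hP
    have hP1 : P ≤ 1 := survival_le_one h0 h1 _ _ _
    have e1 : P * (1 - z ^ (s + 1)) ≤ 1 - y ^ (a - 1) * (1 - p + p * y) ^ u := by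
      rw [hP, survival_succ p s u ha, Finset.sum_mul]
      calc _ = ∑ b ∈ Finset.range (u + 1), (u.choose b) * (p ^ b * (1 - p) ^ (u - b)) *
            (survival p s (a - 1 + b) (u - b) * (1 - z ^ (s + 1))) :=
              Finset.sum_congr rfl fun _ _ => by ring
        _ ≤ ∑ b ∈ Finset.range (u + 1), (u.choose b) * (p ^ b * (1 - p) ^ (u - b)) *
            (1 - y ^ (a - 1) * (y ^ b * 1 ^ (u - b))) :=
            sum_binomial_le h0 h1 u fun b _ => by
              have := ih (a - 1 + b) (u - b) (by omega)
              rw [one_pow, mul_one, ← pow_add]; exact this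
        _ = 1 - y ^ (a - 1) * (p * y + (1 - p) * 1) ^ u := by
            rw [← sum_binomial, Finset.mul_sum]
            simp only [mul_sub, mul_one, Finset.sum_sub_distrib, sum_binomial_one]
            congr 1
            exact Finset.sum_congr rfl fun _ _ => by ring
        _ = _ := by ring
    have e2 : y ^ a ≤ z * (y ^ (a - 1) * (1 - p + p * y) ^ u) := by
      obtain ⟨a, rfl⟩ := Nat.exists_eq_succ_of_ne_zero ha
      rw [Nat.succ_sub_one, pow_succ]
      have := pow_le_pow_of_le_one hq0 hq1 hu
      have h5 : y ≤ z * (1 - p + p * y) ^ u := h.trans (mul_le_mul_of_nonneg_left this hz0)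
      have := mul_le_mul_of_nonneg_left h5 (pow_nonneg hy0 a)
      linarith
    have e3 := mul_le_mul_of_nonneg_left e1 hz0
    have : z ^ (s + 1 + 1) = z * z ^ (s + 1) := by ring
    rw [this]
    nlinarith

/-- Without killing, the number of unexplored vertices after s steps is binomial with parameters u
and (1-p)^s. An exploration that is still alive has at most a + u - s - 1 of them, and Chernoff's
bound with base z applies. -/
theorem survival_chernoff (h0 : 0 ≤ p) (h1 : p ≤ 1) {z : ℝ} (hz0 : 0 ≤ z) (hz1 : z ≤ 1)
    (s a u : ℕ) :
    survival p s a u * z ^ (a + u) ≤ z ^ (s + 1) * (1 - (1 - p) ^ s * (1 - z)) ^ u := by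
  have hb : ∀ s : ℕ, 0 ≤ 1 - (1 - p) ^ s * (1 - z) := fun s => by
    have := pow_le_one₀ (n := s) (by linarith : 0 ≤ 1 - p) (by linarith)
    have h2 := pow_nonneg (by linarith : 0 ≤ 1 - p) s
    nlinarith
  induction s generalizing a u with
  | zero =>
    rcases eq_or_ne a 0 with rfl | ha
    · simpa [survival] using mul_nonneg hz0 (pow_nonneg hz0 _)
    · simp only [survival, ha, if_false, one_mul, pow_zero, sub_sub_cancel, zero_add, pow_one,
        pow_add]
      exact mul_le_mul_of_nonneg_right (pow_le_of_le_one hz0 hz1 ha) (pow_nonneg hz0 _)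
  | succ s ih =>
    rcases eq_or_ne a 0 with rfl | ha
    · simpa [survival] using mul_nonneg (pow_nonneg hz0 _) (pow_nonneg (hb (s + 1)) u)
    rw [survival_succ p s u ha, Finset.sum_mul]
    obtain ⟨a, rfl⟩ := Nat.exists_eq_succ_of_ne_zero ha
    simp only [Nat.succ_sub_one]
    calc _ = ∑ b ∈ Finset.range (u + 1), (u.choose b) * (p ^ b * (1 - p) ^ (u - b)) *
            (survival p s (a + b) (u - b) * z ^ (a.succ + u)) :=
              Finset.sum_congr rfl fun _ _ => by ring
      _ ≤ ∑ b ∈ Finset.range (u + 1), (u.choose b) * (p ^ b * (1 - p) ^ (u - b)) *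
            (z ^ (s + 2) * (1 ^ b * (1 - (1 - p) ^ s * (1 - z)) ^ (u - b))) :=
            sum_binomial_le h0 h1 u fun b hbu => by
              have := mul_le_mul_of_nonneg_left (ih (a + b) (u - b)) hz0
              have h3 : a.succ + u = a + b + (u - b) + 1 := by omega
              rw [h3, pow_succ z (a + b + (u - b)), one_pow, one_mul]
              calc _ = z * (survival p s (a + b) (u - b) * z ^ (a + b + (u - b))) := by ring
                _ ≤ _ := this
                _ = _ := by ring
      _ = z ^ (s + 2) * (p * 1 + (1 - p) * (1 - (1 - p) ^ s * (1 - z))) ^ u := by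
            rw [← sum_binomial, Finset.mul_sum]
            exact Finset.sum_congr rfl fun _ _ => by ring
      _ = _ := by congr 2; ring

/-- The Chernoff bound alone forgets that an exploration from one vertex usually dies early. The
function Z^a - W^a vanishes at a = 0, hence respects the killing, and grows by at most a factor c
per step. Together with the probability of surviving the first s₀ steps it dominates Z^a, so a bound
D Z^a for the last s₁ steps acquires a small prefactor. -/
theorem survival_two_phase (h0 : 0 ≤ p) (h1 : p ≤ 1) {Z W D : ℝ} (hZ : 1 ≤ Z) (hW0 : 0 < W)
    (hW1 : W ≤ 1) (hD : 0 ≤ D) {n s₁ : ℕ} (hbase : ∀ a u, u ≤ n → survival p s₁ a u ≤ D * Z ^ a)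
    {c : ℝ} (hc0 : 0 ≤ c) (hcZ : (1 - p + p * Z) ^ n ≤ c * Z) (hcW : c * W ≤ (1 - p + p * W) ^ n)
    (s₀ a u : ℕ) (hu : u ≤ n) :
    survival p (s₀ + s₁) a u ≤ D * (2 * c ^ s₀ * (Z ^ a - W ^ a) + 2 * survival p s₀ a u) := by
  have hWZ : ∀ a : ℕ, W ^ a ≤ Z ^ a := fun a => pow_le_pow_left₀ hW0.le (hW1.trans hZ) a
  induction s₀ generalizing a u with
  | zero =>
    rcases eq_or_ne a 0 with rfl | ha
    · simp [survival_zero_left]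
    · rw [zero_add]
      refine (hbase a u hu).trans (mul_le_mul_of_nonneg_left ?_ hD)
      simp only [survival, ha, if_false, pow_zero]
      have h2 : W ^ a ≤ 1 := pow_le_one₀ hW0.le hW1
      have h3 : 1 ≤ Z ^ a := one_le_pow₀ hZ
      linarith
  | succ s ih =>
    rcases eq_or_ne a 0 with rfl | ha
    · simp [survival_zero_left]
    rw [show s + 1 + s₁ = s + s₁ + 1 by ring, survival_succ p _ u ha, survival_succ p s u ha]
    obtain ⟨a, rfl⟩ := Nat.exists_eq_succ_of_ne_zero ha
    simp only [Nat.succ_sub_one]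
    have e : ∀ T : ℝ, ∑ b ∈ Finset.range (u + 1), (u.choose b) * (p ^ b * (1 - p) ^ (u - b)) *
        T ^ (a + b) = T ^ a * (1 - p + p * T) ^ u := fun T => by
      have := sum_binomial p T 1 u
      rw [show 1 - p + p * T = p * T + (1 - p) * 1 by ring, ← this, Finset.mul_sum]
      exact Finset.sum_congr rfl fun _ _ => by rw [one_pow]; ring
    have eZ : Z ^ a * (1 - p + p * Z) ^ u ≤ c * Z ^ (a + 1) := by
      have h2 : (1 - p + p * Z) ^ u ≤ (1 - p + p * Z) ^ n :=
        pow_le_pow_right₀ (by nlinarith) hu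
      have := mul_le_mul_of_nonneg_left (h2.trans hcZ) (pow_nonneg (by linarith : 0 ≤ Z) a)
      rw [pow_succ]; linarith
    have eW : c * W ^ (a + 1) ≤ W ^ a * (1 - p + p * W) ^ u := by
      have h2 : (1 - p + p * W) ^ n ≤ (1 - p + p * W) ^ u :=
        pow_le_pow_of_le_one (by nlinarith) (by nlinarith) hu
      have := mul_le_mul_of_nonneg_left (hcW.trans h2) (pow_nonneg hW0.le a)
      rw [pow_succ]; linarith
    calc _ ≤ ∑ b ∈ Finset.range (u + 1), (u.choose b) * (p ^ b * (1 - p) ^ (u - b)) *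
            (D * (2 * c ^ s * (Z ^ (a + b) - W ^ (a + b)) + 2 * survival p s (a + b) (u - b))) :=
            sum_binomial_le h0 h1 u fun b _ => ih _ _ (by omega)
      _ = D * (2 * c ^ s * (Z ^ a * (1 - p + p * Z) ^ u - W ^ a * (1 - p + p * W) ^ u) +
            2 * ∑ b ∈ Finset.range (u + 1), (u.choose b) * (p ^ b * (1 - p) ^ (u - b)) *
              survival p s (a + b) (u - b)) := by
            rw [← e Z, ← e W, ← Finset.sum_sub_distrib, Finset.mul_sum, Finset.mul_sum,
              ← Finset.sum_add_distrib, Finset.mul_sum]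
            exact Finset.sum_congr rfl fun _ _ => by ring
      _ ≤ _ := by
            refine mul_le_mul_of_nonneg_left (add_le_add_left ?_ _) hD
            rw [pow_succ c]
            have : 2 * c ^ s * (Z ^ a * (1 - p + p * Z) ^ u - W ^ a * (1 - p + p * W) ^ u) ≤
              2 * c ^ s * (c * Z ^ (a + 1) - c * W ^ (a + 1)) :=
              mul_le_mul_of_nonneg_left (by linarith) (by positivity)
            refine this.trans (le_of_eq ?_)
            simp only [Nat.succ_eq_add_one]; ring

theorem one_sub_pow_ge (h0 : 0 ≤ p) (h1 : p ≤ 1) (s : ℕ) :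
    1 - s * p + s * (s - 1) / 2 * p ^ 2 - s ^ 3 / 6 * p ^ 3 ≤ (1 - p) ^ s := by
  have key : 1 - s * p + s * (s - 1) / 2 * p ^ 2 - s * (s - 1) * (s - 2) / 6 * p ^ 3 ≤
      (1 - p) ^ s := by
    induction s with
    | zero => simp
    | succ s ih =>
      have h2 := mul_le_mul_of_nonneg_right ih (by linarith : 0 ≤ 1 - p)
      have h3 : (0 : ℝ) ≤ s * (s - 1) * (s - 2) := by
        rcases Nat.lt_or_ge s 2 with h | h
        · interval_cases s <;> simp
        · have : (2 : ℝ) ≤ s := by exact_mod_cast h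
          exact mul_nonneg (mul_nonneg (by linarith) (by linarith)) (by linarith)
      have h4 := mul_nonneg h3 (pow_nonneg h0 4)
      rw [pow_succ (1 - p) s]
      push_cast
      linarith
  refine le_trans ?_ key
  have h5 : (s : ℝ) * (s - 1) * (s - 2) ≤ s ^ 3 := by
    have hs : (0 : ℝ) ≤ s := s.cast_nonneg
    rcases Nat.eq_zero_or_pos s with rfl | h
    · simp
    · have : (1 : ℝ) ≤ s := by exact_mod_cast h
      nlinarith
  have := mul_le_mul_of_nonneg_right h5 (pow_nonneg h0 3)
  linarith

theorem log_one_sub_le {x : ℝ} (hx0 : 0 ≤ x) (hx1 : x < 1) :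
    Real.log (1 - x) ≤ -x - x ^ 2 / 2 := by
  have h := Real.hasSum_pow_div_log_of_abs_lt_one (x := x) (by rwa [abs_of_nonneg hx0])
  have h2 := h.summable.sum_le_tsum (Finset.range 2) fun i _ => by positivity
  rw [h.tsum_eq] at h2
  simp [Finset.sum_range_succ] at h2
  norm_num at h2
  linarith

theorem inv_one_sub_le {x : ℝ} (hx1 : x ≤ 1 / 2) :
    1 / (1 - x) ≤ 1 + x + 2 * x ^ 2 := by
  rw [div_le_iff₀ (by linarith)]; nlinarith [mul_nonneg (sq_nonneg x) (by linarith : 0 ≤ 1 - 2 * x)]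

end SurvivalUpper

/-! ### Explicit upper bounds near criticality. -/

section SurvivalExp

variable {p : ℝ}

theorem exp_neg_le_one_sub {x : ℝ} (hx0 : 0 ≤ x) (hx1 : x ≤ 1 / 2) :
    Real.exp (-(x + x ^ 2)) ≤ 1 - x := by
  have h := Real.quadratic_le_exp_of_nonneg (add_nonneg hx0 (sq_nonneg x))
  rw [Real.exp_neg, inv_le_comm₀ (Real.exp_pos _) (by linarith)]
  refine le_trans ?_ h
  rw [inv_le_iff_one_le_mul₀ (by linarith)]
  have h2 : 0 ≤ x ^ 2 * (1 / 2 - x) := mul_nonneg (sq_nonneg x) (by linarith)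
  have h3 : 0 ≤ x ^ 3 * (1 / 2 - x) := mul_nonneg (pow_nonneg hx0 3) (by linarith)
  have h4 : 0 ≤ x ^ 4 * (1 / 2 - x) := mul_nonneg (pow_nonneg hx0 4) (by linarith)
  nlinarith [pow_nonneg hx0 2, pow_nonneg hx0 3, pow_nonneg hx0 4]

theorem one_sub_le_exp_neg {x : ℝ} (hx0 : 0 ≤ x) (hx1 : x < 1) :
    1 - x ≤ Real.exp (-x - x ^ 2 / 2) := by
  rw [← Real.log_le_iff_le_exp (by linarith)]
  exact log_one_sub_le hx0 hx1

/-- Use `survival_mul_le` with z = 1 - 1/(s+1) and y = 1 - η. To second order its condition asks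
that η²/2 - lη exceed 1/(s+1), so η can be taken of order s^(-1/2) + l. -/
theorem survival_le_sqrt (h0 : 0 ≤ p) (h1 : p ≤ 1) {n : ℕ} (hn : 64 ≤ n) {l : ℝ} (hl0 : 0 ≤ l)
    (hl1 : l ≤ 1) (hp : p ≤ (1 + l) / n) (s u : ℕ) (hu : u ≤ n) :
    survival p s 1 u ≤ 8 / √(s + 1) + 8 * l := by
  have hn' : (64 : ℝ) ≤ n := by exact_mod_cast hn
  set m : ℝ := s + 1 with hm
  have hm0 : 0 < m := by positivity
  have hsm : 0 < √m := Real.sqrt_pos.2 hm0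
  set η : ℝ := 4 / √m + 4 * l with hη
  have hη0 : 0 < η := by positivity
  have hgoal : 8 / √m + 8 * l = 2 * η := by rw [hη]; ring
  rw [hgoal]
  -- For η ≥ 1/2 the claimed bound is at least 1 and there is nothing to prove.
  rcases le_or_gt (1 / 2) η with h | h
  · linarith [survival_le_one h0 h1 s 1 u]
  have hm1 : 1 / m ≤ η ^ 2 / 16 := by
    have h4 : 4 / √m ≤ η := by rw [hη]; linarith
    have h5 := pow_le_pow_left₀ (by positivity) h4 2
    rw [div_pow, Real.sq_sqrt hm0.le] at h5
    have : (4 : ℝ) ^ 2 / m = 16 * (1 / m) := by ring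
    linarith
  have hη2 : η ^ 2 ≤ 1 / 4 := (pow_le_pow_left₀ hη0.le h.le 2).trans (by norm_num)
  have hm2 : 1 / m ≤ 1 / 2 := by linarith
  have hm3 : 0 < 1 / m := by positivity
  have hl : l * η ≤ η ^ 2 / 4 := by
    have : 4 * l ≤ η := by rw [hη]; linarith [div_pos (by norm_num : (0 : ℝ) < 4) hsm]
    have := mul_le_mul_of_nonneg_right this hη0.le
    rw [pow_two]; linarith
  have hnp : n * p ≤ 1 + l := by
    rw [le_div_iff₀ (by linarith)] at hp; linarith
  have hp2 : p ≤ 2 / 64 := hp.trans (div_le_div₀ (by norm_num) (by linarith) (by norm_num) hn')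
  have hpη0 : 0 ≤ p * η := mul_nonneg h0 hη0.le
  have hpη : p * η ≤ 1 / 2 := (mul_le_of_le_one_left hη0.le h1).trans h.le
  have key : 1 - η ≤ (1 - 1 / m) * (1 - p + p * (1 - η)) ^ n := by
    have e1 : Real.exp (-(1 / m + (1 / m) ^ 2)) ≤ 1 - 1 / m := exp_neg_le_one_sub hm3.le hm2
    have e2 : Real.exp (-(p * η + (p * η) ^ 2)) ≤ 1 - p * η := exp_neg_le_one_sub hpη0 hpη
    have e3 := pow_le_pow_left₀ (Real.exp_pos _).le e2 n
    rw [← Real.exp_nat_mul] at e3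
    rw [show 1 - p + p * (1 - η) = 1 - p * η by ring]
    refine le_trans (one_sub_le_exp_neg hη0.le (by linarith)) (le_trans ?_
      (mul_le_mul e1 e3 (Real.exp_pos _).le (by linarith)))
    rw [← Real.exp_add, Real.exp_le_exp]
    have e4 : n * (p * η) ≤ η + l * η := by
      have := mul_le_mul_of_nonneg_right hnp hη0.le
      linarith
    have e5 : n * (p * η) ^ 2 ≤ η ^ 2 / 16 := by
      have : n * (p * η) ^ 2 = (n * p) * p * η ^ 2 := by ring
      rw [this]
      have h7 : (n * p) * p ≤ 2 * (2 / 64) :=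
        mul_le_mul (by linarith) hp2 h0 (by norm_num)
      have := mul_le_mul_of_nonneg_right h7 (sq_nonneg η)
      linarith
    have e6 : (1 / m) ^ 2 ≤ 1 / m := pow_le_of_le_one hm3.le (by linarith) two_ne_zero
    linarith
  have h2 := survival_mul_le h0 h1 (by linarith) (by linarith) (by linarith)
    (by linarith : 1 - 1 / m ≤ 1) key s 1 u hu
  have h3 : (1 - 1 / m) ^ (s + 1) ≤ 1 / 2 := by
    have := pow_le_pow_left₀ (by linarith) (Real.one_sub_le_exp_neg (1 / m)) (s + 1)
    refine this.trans ?_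
    rw [← Real.exp_nat_mul]
    push_cast
    rw [← hm, mul_neg, mul_one_div_cancel hm0.ne']
    linarith [Real.exp_neg_one_lt_half]
  have h4 := survival_nonneg h0 h1 s 1 u
  rw [pow_one] at h2
  have h5 := mul_le_mul_of_nonneg_left (by linarith : 1 / 2 ≤ 1 - (1 - 1 / m) ^ (s + 1)) h4
  linarith

theorem one_sub_pow_le_of_le {l : ℝ} (hl0 : 0 ≤ l) (hl1 : l ≤ 1 / 4) {n s : ℕ}
    (hp : p ≤ (1 + l) / n) (hn : n ≤ s ^ 2) (hs : 8 * s ≤ n) (hs0 : 0 < s) :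
    1 - (1 - p) ^ s ≤
      s / n + l * (s / n) - (s / n : ℝ) ^ 2 / 2 + 2 * (s / n : ℝ) ^ 3 := by
  have hs' : (1 : ℝ) ≤ s := by exact_mod_cast hs0
  have hn1 : (8 : ℝ) * s ≤ n := by exact_mod_cast hs
  have hn0 : (0 : ℝ) < n := by linarith
  have hn2 : (n : ℝ) ≤ s ^ 2 := by exact_mod_cast hn
  have hP1 : (1 + l) / n ≤ 1 := by rw [div_le_one hn0]; linarith
  have h := one_sub_pow_ge (p := (1 + l) / n) (by positivity) hP1 s
  have h2 : (1 - (1 + l) / n) ^ s ≤ (1 - p) ^ s :=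
    pow_le_pow_left₀ (by linarith) (by linarith) s
  set t : ℝ := s / n with ht
  set v : ℝ := 1 / n with hv
  have hv0 : 0 < v := by positivity
  have ht0 : 0 ≤ t := by positivity
  have hvt : v ≤ t ^ 2 := by
    rw [hv, ht, div_pow, div_le_div_iff₀ hn0 (by positivity)]
    nlinarith
  have e1 : (s : ℝ) * ((1 + l) / n) = (1 + l) * t := by rw [ht]; ring
  have e2 : (s : ℝ) * (s - 1) / 2 * ((1 + l) / n) ^ 2 = (1 + l) ^ 2 * (t ^ 2 - t * v) / 2 := by
    rw [ht, hv]; field_simp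
  have e3 : (s : ℝ) ^ 3 / 6 * ((1 + l) / n) ^ 3 = (1 + l) ^ 3 * t ^ 3 / 6 := by
    rw [ht]; field_simp
  rw [e1, e2, e3] at h
  have c1 : (1 + l) ^ 3 ≤ 3 := by
    have := pow_le_pow_left₀ (by linarith) (by linarith : 1 + l ≤ 5 / 4) 3
    linarith
  have c2 : 1 ≤ (1 + l) ^ 2 := by nlinarith
  have c3 : (1 + l) ^ 2 ≤ 2 := by nlinarith
  have c4 : (1 + l) ^ 3 * t ^ 3 ≤ 3 * t ^ 3 := mul_le_mul_of_nonneg_right c1 (by positivity)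
  have c5 : t ^ 2 ≤ (1 + l) ^ 2 * t ^ 2 := le_mul_of_one_le_left (by positivity) c2
  have c6 : t * v ≤ t ^ 3 := by
    have := mul_le_mul_of_nonneg_left hvt ht0; linarith
  have c7 : (1 + l) ^ 2 * (t * v) ≤ 2 * t ^ 3 := by
    have := mul_le_mul c3 c6 (by positivity) (by norm_num)
    exact this
  have := pow_nonneg ht0 3
  linarith

theorem chernoff_poly {l t : ℝ} (hl0 : 0 ≤ l) (ht0 : 0 ≤ t) (ht1 : t ≤ 1 / 8) :
    t * (-(t / 2) - (t / 2) ^ 2 / 2) +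
      (t + l * t - t ^ 2 / 2 + 2 * t ^ 3) * ((t / 2) * (1 + t / 2 + 2 * (t / 2) ^ 2)) ≤
      -(t ^ 3 / 8) + l * t ^ 2 + 4 * t ^ 4 := by
  have h2 : t ^ 2 ≤ 1 / 64 := (pow_le_pow_left₀ ht0 ht1 2).trans (by norm_num)
  have e1 : 0 ≤ l * t ^ 2 * (1 / 2 - t / 4 - t ^ 2 / 4) :=
    mul_nonneg (by positivity) (by linarith)
  have e2 : 0 ≤ t ^ 4 * (23 / 8 - 3 / 8 * t - t ^ 2 / 2) :=
    mul_nonneg (by positivity) (by linarith)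
  linarith

/-- With t = s/n and z = 1 - x, the exponent of the Chernoff bound at p = 1/n is n(x²t/2 - xt²/2) to
leading order. It is minimal at x = t/2, with value -nt³/8; the other two terms account for l and
for the Taylor error. -/
theorem chernoff_exponent_le {l : ℝ} (hl0 : 0 ≤ l) (hl1 : l ≤ 1 / 4) (h0 : 0 ≤ p) {n s : ℕ}
    (hp : p ≤ (1 + l) / n) (hn : n ≤ s ^ 2) (hs : 8 * s ≤ n) (hs0 : 0 < s) :
    (1 - (s : ℝ) / (2 * n)) ^ s *
      ((1 - (1 - p) ^ s * (s / (2 * n))) / (1 - (s : ℝ) / (2 * n))) ^ n ≤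
      Real.exp (-(s ^ 3 / (8 * n ^ 2)) + l * s ^ 2 / n + 4 * s ^ 4 / n ^ 3) := by
  have hs' : (1 : ℝ) ≤ s := by exact_mod_cast hs0
  have hn1 : (8 : ℝ) * s ≤ n := by exact_mod_cast hs
  have hn0 : (0 : ℝ) < n := by linarith
  have hd := one_sub_pow_le_of_le hl0 hl1 hp hn hs hs0
  have hp1 : p ≤ 1 := hp.trans (by rw [div_le_one hn0]; linarith)
  set t : ℝ := s / n with ht
  have ht0 : 0 < t := by positivity
  have ht1 : t ≤ 1 / 8 := by rw [ht, div_le_iff₀ hn0]; linarith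
  have hx : (s : ℝ) / (2 * n) = t / 2 := by rw [ht]; field_simp
  rw [hx]
  set d := 1 - (1 - p) ^ s with hdd
  have hd0 : 0 ≤ d := by
    have := pow_le_one₀ (n := s) (by linarith : 0 ≤ 1 - p) (by linarith)
    linarith
  have e1 : 1 - t / 2 ≤ Real.exp (-(t / 2) - (t / 2) ^ 2 / 2) :=
    one_sub_le_exp_neg (by linarith) (by linarith)
  have hden : 0 < 1 - t / 2 := by linarith
  have e2 : (1 - (1 - p) ^ s * (t / 2)) / (1 - t / 2) ≤
      Real.exp (d * (t / 2) * (1 + t / 2 + 2 * (t / 2) ^ 2)) := by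
    have : (1 - (1 - p) ^ s * (t / 2)) / (1 - t / 2) = d * (t / 2) * (1 / (1 - t / 2)) + 1 := by
      rw [hdd, div_eq_iff hden.ne', add_mul, mul_assoc _ (1 / _), one_div_mul_cancel hden.ne']
      ring
    rw [this]
    refine le_trans ?_ (Real.add_one_le_exp _)
    have := mul_le_mul_of_nonneg_left (inv_one_sub_le (by linarith : t / 2 ≤ 1 / 2))
      (by positivity : 0 ≤ d * (t / 2))
    linarith
  have hnum : 0 ≤ (1 - (1 - p) ^ s * (t / 2)) / (1 - t / 2) := by
    refine div_nonneg ?_ hden.le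
    have := mul_le_one₀ (pow_le_one₀ (n := s) (by linarith : 0 ≤ 1 - p) (by linarith))
      (by positivity : 0 ≤ t / 2) (by linarith)
    linarith
  refine (mul_le_mul (pow_le_pow_left₀ hden.le e1 s) (pow_le_pow_left₀ hnum e2 n)
    (pow_nonneg hnum n) (by positivity)).trans ?_
  rw [← Real.exp_nat_mul, ← Real.exp_nat_mul, ← Real.exp_add, Real.exp_le_exp]
  have hst : (s : ℝ) = n * t := by rw [ht]; field_simp
  have eR : -((s : ℝ) ^ 3 / (8 * n ^ 2)) + l * s ^ 2 / n + 4 * s ^ 4 / n ^ 3 =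
      n * (-(t ^ 3 / 8) + l * t ^ 2 + 4 * t ^ 4) := by
    rw [hst]; field_simp
  rw [eR, hst, mul_assoc (n : ℝ) t, ← mul_add]
  refine mul_le_mul_of_nonneg_left ?_ hn0.le
  have hb : d * (t / 2) * (1 + t / 2 + 2 * (t / 2) ^ 2) ≤
      (t + l * t - t ^ 2 / 2 + 2 * t ^ 3) * ((t / 2) * (1 + t / 2 + 2 * (t / 2) ^ 2)) := by
    rw [mul_assoc]
    exact mul_le_mul_of_nonneg_right hd (by positivity)
  refine (add_le_add_right hb _).trans ?_
  exact chernoff_poly hl0 ht0.le ht1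

/-- The Chernoff bound in the form D Z^a with Z = 1/(1-x) that `survival_two_phase` takes as input.
D no longer depends on u, because the base raised to the power u is at least 1. -/
theorem survival_base (h0 : 0 ≤ p) (h1 : p ≤ 1) {x : ℝ} (hx0 : 0 ≤ x) (hx1 : x < 1) (n s a u : ℕ)
    (hu : u ≤ n) : survival p s a u ≤
      (1 - x) ^ s * ((1 - (1 - p) ^ s * x) / (1 - x)) ^ n * (1 / (1 - x)) ^ a := by
  have hz : 0 < 1 - x := by linarith
  have h := survival_chernoff h0 h1 hz.le (by linarith) s a u
  rw [sub_sub_cancel] at h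
  have hr : 1 ≤ (1 - (1 - p) ^ s * x) / (1 - x) := by
    rw [le_div_iff₀ hz]
    have := mul_le_of_le_one_left hx0
      (pow_le_one₀ (n := s) (by linarith : 0 ≤ 1 - p) (by linarith))
    linarith
  rw [← le_div_iff₀ (pow_pos hz _)] at h
  refine h.trans ?_
  rw [pow_add (1 - x) a u, pow_succ, one_div, inv_pow]
  have e : (1 - x) ^ s * (1 - x) * (1 - (1 - p) ^ s * x) ^ u / ((1 - x) ^ a * (1 - x) ^ u) =
      (1 - x) * ((1 - x) ^ s * ((1 - (1 - p) ^ s * x) / (1 - x)) ^ u * ((1 - x) ^ a)⁻¹) := by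
    rw [div_pow]; field_simp
  rw [e]
  have h5 : (1 - x) ^ s * ((1 - (1 - p) ^ s * x) / (1 - x)) ^ u * ((1 - x) ^ a)⁻¹ ≤
      (1 - x) ^ s * ((1 - (1 - p) ^ s * x) / (1 - x)) ^ n * ((1 - x) ^ a)⁻¹ :=
    mul_le_mul_of_nonneg_right (mul_le_mul_of_nonneg_left (pow_le_pow_right₀ hr hu)
      (by positivity)) (by positivity)
  refine le_trans ?_ h5
  refine mul_le_of_le_one_left ?_ (by linarith)
  exact mul_nonneg (mul_nonneg (by positivity) (pow_nonneg (by linarith) u)) (by positivity)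

theorem survival_le_exp {l : ℝ} (hl0 : 0 ≤ l) (hl1 : l ≤ 1 / 4) (h0 : 0 ≤ p) {n s : ℕ}
    (hp : p ≤ (1 + l) / n) (hn : n ≤ s ^ 2) (hs : 8 * s ≤ n) (hs0 : 0 < s) :
    survival p s 1 (n - 1) ≤
      2 * Real.exp (-(s ^ 3 / (8 * n ^ 2)) + l * s ^ 2 / n + 4 * s ^ 4 / n ^ 3) := by
  have hs' : (1 : ℝ) ≤ s := by exact_mod_cast hs0
  have hn1 : (8 : ℝ) * s ≤ n := by exact_mod_cast hs
  have hn0 : (0 : ℝ) < n := by linarith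
  have hp1 : p ≤ 1 := hp.trans (by rw [div_le_one hn0]; linarith)
  have hx : (s : ℝ) / (2 * n) ≤ 1 / 16 := by rw [div_le_iff₀ (by linarith)]; linarith
  have h := survival_base h0 hp1 (x := s / (2 * n)) (by positivity) (by linarith) n s 1 (n - 1)
    (by omega)
  refine h.trans ?_
  rw [mul_comm]
  refine mul_le_mul ?_ (chernoff_exponent_le hl0 hl1 h0 hp hn hs hs0) ?_ (by norm_num)
  · rw [pow_one, div_le_iff₀ (by linarith)]; linarith
  · refine mul_nonneg (pow_nonneg (by linarith) _) (pow_nonneg (div_nonneg ?_ (by linarith)) _)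
    have := mul_le_one₀ (pow_le_one₀ (n := s) (by linarith : 0 ≤ 1 - p) (by linarith))
      (by positivity : 0 ≤ (s : ℝ) / (2 * n)) (by linarith)
    linarith

/-- Two phases with x = s₁/(2n), Z = 1/(1-x) and W = 1 - 2x. To second order, at np = 1 + l and with
n unexplored vertices, a step multiplies Z^a by exp(lx + x²/2) and W^a by exp(2x² - 2lx). The rate c
= exp(2lx + x²) lies between the two as soon as l is small against x, which `hls` ensures. -/
theorem survival_two_phase_exp {l : ℝ} (hl0 : 0 ≤ l) (hl1 : l ≤ 1 / 4) (h0 : 0 ≤ p) {n s₁ : ℕ}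
    (hp : p ≤ (1 + l) / n) (hn : n ≤ s₁ ^ 2) (hs : 8 * s₁ ≤ n) (hs0 : 0 < s₁) (hn64 : 64 ≤ n)
    (hls : 16 * l * n ≤ s₁) (s₀ : ℕ) :
    survival p (s₀ + s₁) 1 (n - 1) ≤
      2 * Real.exp (-(s₁ ^ 3 / (8 * n ^ 2)) + l * s₁ ^ 2 / n + 4 * s₁ ^ 4 / n ^ 3) *
        (Real.exp (s₀ * (l * s₁ / n + (s₁ / n) ^ 2 / 4)) * (2 * (s₁ / n)) +
          8 / √(s₀ + 1) + 8 * l) := by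
  have hs' : (1 : ℝ) ≤ s₁ := by exact_mod_cast hs0
  have hn1 : (8 : ℝ) * s₁ ≤ n := by exact_mod_cast hs
  have hn0 : (0 : ℝ) < n := by linarith
  have hn64' : (64 : ℝ) ≤ n := by exact_mod_cast hn64
  have hp1 : p ≤ 1 := hp.trans (by rw [div_le_one hn0]; linarith)
  have hnp : n * p ≤ 1 + l := by
    rw [le_div_iff₀ hn0] at hp; linarith
  have hp2 : p ≤ 2 / 64 := hp.trans (div_le_div₀ (by norm_num) (by linarith) (by norm_num) hn64')
  set x : ℝ := s₁ / (2 * n) with hx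
  have hx0 : 0 < x := by positivity
  have hx1 : x ≤ 1 / 16 := by rw [hx, div_le_iff₀ (by linarith)]; linarith
  have hlx : 8 * l ≤ x := by rw [hx, le_div_iff₀ (by linarith)]; linarith
  have hz : 0 < 1 - x := by linarith
  set D := (1 - x) ^ s₁ * ((1 - (1 - p) ^ s₁ * x) / (1 - x)) ^ n with hD
  have hDle := chernoff_exponent_le hl0 hl1 h0 hp hn hs hs0
  have hD0 : 0 ≤ D := by
    refine mul_nonneg (pow_nonneg (by linarith) _) (pow_nonneg (div_nonneg ?_ (by linarith)) _)
    have := mul_le_one₀ (pow_le_one₀ (n := s₁) (by linarith : 0 ≤ 1 - p) (by linarith)) hx0.le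
      (by linarith : x ≤ 1)
    linarith
  have hinv := inv_one_sub_le (by linarith : x ≤ 1 / 2)
  have hcZ : (1 - p + p * (1 / (1 - x))) ^ n ≤ Real.exp (2 * l * x + x ^ 2) * (1 / (1 - x)) := by
    have e1 : 1 - p + p * (1 / (1 - x)) ≤ Real.exp (p * (x + x ^ 2 + 2 * x ^ 3)) := by
      have e : 1 / (1 - x) - 1 ≤ x + x ^ 2 + 2 * x ^ 3 := by
        have : 1 / (1 - x) - 1 = x * (1 / (1 - x)) := by field_simp; ring
        rw [this]; have := mul_le_mul_of_nonneg_left hinv hx0.le; linarith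
      have := mul_le_mul_of_nonneg_left e h0
      linarith [Real.add_one_le_exp (p * (x + x ^ 2 + 2 * x ^ 3))]
    have e0 : 0 ≤ 1 - p + p * (1 / (1 - x)) := add_nonneg (by linarith) (by positivity)
    have e2 : (1 - x) ≤ Real.exp (-x - x ^ 2 / 2) := one_sub_le_exp_neg hx0.le (by linarith)
    rw [mul_one_div (Real.exp (2 * l * x + x ^ 2)), le_div_iff₀ hz]
    refine (mul_le_mul (pow_le_pow_left₀ e0 e1 n) e2 hz.le (by positivity)).trans ?_
    rw [← Real.exp_nat_mul, ← Real.exp_add, Real.exp_le_exp]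
    have e3 : n * (p * (x + x ^ 2 + 2 * x ^ 3)) ≤ (1 + l) * (x + x ^ 2 + 2 * x ^ 3) := by
      rw [← mul_assoc]; exact mul_le_mul_of_nonneg_right hnp (by positivity)
    have h2 : x ^ 2 ≤ 1 / 16 := (pow_le_of_le_one hx0.le (by linarith) two_ne_zero).trans hx1
    have e5 : 0 ≤ l * x * (1 - x - 2 * x ^ 2) := mul_nonneg (by positivity) (by linarith)
    have e6 : 0 ≤ x ^ 2 * (1 / 2 - 2 * x) := mul_nonneg (by positivity) (by linarith)
    linarith
  have hcW : Real.exp (2 * l * x + x ^ 2) * (1 - 2 * x) ≤ (1 - p + p * (1 - 2 * x)) ^ n := by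
    have e1 : Real.exp (-(p * (2 * x) + (p * (2 * x)) ^ 2)) ≤ 1 - p * (2 * x) :=
      exp_neg_le_one_sub (by positivity)
        ((mul_le_of_le_one_left (by positivity) hp1).trans (by linarith))
    have e2 : 1 - 2 * x ≤ Real.exp (-(2 * x) - (2 * x) ^ 2 / 2) :=
      one_sub_le_exp_neg (by positivity) (by linarith)
    rw [show 1 - p + p * (1 - 2 * x) = 1 - p * (2 * x) by ring]
    refine le_trans (mul_le_mul_of_nonneg_left e2 (Real.exp_pos _).le) (le_trans ?_
      (pow_le_pow_left₀ (Real.exp_pos _).le e1 n))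
    rw [← Real.exp_nat_mul, ← Real.exp_add, Real.exp_le_exp]
    have e3 : n * (p * (2 * x)) ≤ (1 + l) * (2 * x) := by
      rw [← mul_assoc]; exact mul_le_mul_of_nonneg_right hnp (by positivity)
    have e4 : n * (p * (2 * x)) ^ 2 ≤ x ^ 2 / 4 := by
      have : n * (p * (2 * x)) ^ 2 = (n * p) * p * (4 * x ^ 2) := by ring
      rw [this]
      have h7 : (n * p) * p ≤ 2 * (2 / 64) :=
        mul_le_mul (by linarith) hp2 h0 (by norm_num)
      have := mul_le_mul_of_nonneg_right h7 (by positivity : 0 ≤ 4 * x ^ 2)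
      linarith
    have e5 : 8 * l * x ≤ x ^ 2 := by
      have := mul_le_mul_of_nonneg_right hlx hx0.le
      rw [pow_two]; exact this
    have := sq_nonneg x
    linarith
  have h := survival_two_phase h0 hp1 (Z := 1 / (1 - x)) (W := 1 - 2 * x) (D := D)
    (by rw [le_div_iff₀ hz]; linarith) (by linarith) (by linarith) hD0
    (fun a u hu => survival_base h0 hp1 hx0.le (by linarith) n s₁ a u hu)
    (Real.exp_pos (2 * l * x + x ^ 2)).le hcZ hcW s₀ 1 (n - 1) (by omega)
  refine h.trans ?_
  have hq := survival_le_sqrt h0 hp1 hn64 hl0 (by linarith) hp s₀ (n - 1) (by omega)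
  have hZW : (1 / (1 - x)) ^ 1 - (1 - 2 * x) ^ 1 ≤ 4 * x := by
    have : x ^ 2 ≤ x * (1 / 16) := by
      rw [pow_two]; exact mul_le_mul_of_nonneg_left hx1 hx0.le
    rw [pow_one, pow_one]; linarith
  have hxe : 2 * (s₁ / n : ℝ) = 4 * x := by rw [hx]; field_simp; norm_num
  have hxe2 : s₀ * (l * s₁ / n + (s₁ / n : ℝ) ^ 2 / 4) = s₀ * (2 * l * x + x ^ 2) := by
    rw [hx]; field_simp; ring
  rw [hxe, hxe2, Real.exp_nat_mul]
  have h3 := mul_le_mul_of_nonneg_left hZW (by positivity : 0 ≤ Real.exp (2 * l * x + x ^ 2) ^ s₀)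
  have h4 : 2 * Real.exp (2 * l * x + x ^ 2) ^ s₀ * ((1 / (1 - x)) ^ 1 - (1 - 2 * x) ^ 1) +
      2 * survival p s₀ 1 (n - 1) ≤ 2 * (Real.exp (2 * l * x + x ^ 2) ^ s₀ * (4 * x) +
          8 / √(s₀ + 1) + 8 * l) := by linarith
  refine (mul_le_mul_of_nonneg_left h4 hD0).trans ?_
  have := mul_le_mul_of_nonneg_right hDle (by positivity : 0 ≤ 2 *
    (Real.exp (2 * l * x + x ^ 2) ^ s₀ * (4 * x) + 8 / √(s₀ + 1) + 8 * l))
  refine this.trans (le_of_eq (by ring))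

end SurvivalExp

/-! ### The upper bound at the scale n^(2/3) (log n)^(1/3). -/

section Asymptotics

/-- The cube root of `n`. -/
noncomputable def cbrt (n : ℕ) : ℝ := (n : ℝ) ^ (1 / 3 : ℝ)

/-- The cube root of `log n`. -/
noncomputable def cbrtLog (n : ℕ) : ℝ := Real.log n ^ (1 / 3 : ℝ)

theorem cbrt_pow_three (n : ℕ) : cbrt n ^ 3 = n := by
  rw [cbrt, ← Real.rpow_natCast, ← Real.rpow_mul n.cast_nonneg]; norm_num

theorem cbrt_sq (n : ℕ) : cbrt n ^ 2 = (n : ℝ) ^ (2 / 3 : ℝ) := by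
  rw [cbrt, ← Real.rpow_natCast, ← Real.rpow_mul n.cast_nonneg]; norm_num

theorem cbrt_pos {n : ℕ} (hn : n ≠ 0) : 0 < cbrt n :=
  Real.rpow_pos_of_pos (by exact_mod_cast Nat.pos_of_ne_zero hn) _

theorem cbrtLog_pow_three (n : ℕ) : cbrtLog n ^ 3 = Real.log n := by
  rw [cbrtLog, ← Real.rpow_natCast, ← Real.rpow_mul (Real.log_natCast_nonneg n)]; norm_num

theorem cbrt_eq_exp {n : ℕ} (hn : n ≠ 0) : cbrt n = Real.exp (cbrtLog n ^ 3 / 3) := by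
  rw [cbrtLog_pow_three, cbrt, Real.rpow_def_of_pos (by exact_mod_cast Nat.pos_of_ne_zero hn)]
  congr 1; ring

theorem tendsto_cbrtLog : Tendsto cbrtLog atTop atTop :=
  (tendsto_rpow_atTop (by norm_num)).comp (Real.tendsto_log_atTop.comp tendsto_natCast_atTop_atTop)

theorem eventually_mul_pow_le_exp {a : ℝ} (ha : 0 < a) (c : ℝ) (k : ℕ) :
    ∀ᶠ L : ℝ in atTop, c * L ^ k ≤ Real.exp (a * L ^ 3) := by
  have h := (isLittleO_pow_exp_pos_mul_atTop (k := k) ha).bound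
    (show 0 < 1 / (|c| + 1) by positivity)
  filter_upwards [h, eventually_ge_atTop 1] with L hL hL1
  rw [Real.norm_of_nonneg (by positivity), Real.norm_of_nonneg (Real.exp_pos _).le] at hL
  have h2 : Real.exp (a * L) ≤ Real.exp (a * L ^ 3) := by
    rw [Real.exp_le_exp]
    exact mul_le_mul_of_nonneg_left (le_self_pow₀ hL1 three_ne_zero) ha.le
  have h3 : (|c| + 1) * L ^ k ≤ Real.exp (a * L) := by
    rw [one_div_mul_eq_div, le_div_iff₀ (by positivity)] at hL; linarith
  have h4 : c * L ^ k ≤ (|c| + 1) * L ^ k :=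
    mul_le_mul_of_nonneg_right (by linarith [le_abs_self c]) (by positivity)
  linarith

theorem eventually_exp_cubic_le {c : ℝ} (hc : 0 < c) (C D : ℝ) {ε : ℝ} (hε : 0 < ε) :
    ∀ᶠ L : ℝ in atTop, Real.exp (-c * L ^ 3 + C * L ^ 2) * (D * L + D) ≤ ε := by
  filter_upwards [eventually_mul_pow_le_exp (half_pos hc) (2 * |D| / ε) 1, eventually_ge_atTop 1,
    eventually_ge_atTop (2 * |C| / c)] with L h1 hL1 hL
  have h2 : -c * L ^ 3 + C * L ^ 2 ≤ -(c / 2 * L ^ 3) := by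
    rw [div_le_iff₀ hc] at hL
    have h5 := mul_le_mul_of_nonneg_right hL (sq_nonneg L)
    have h6 := mul_le_mul_of_nonneg_right (le_abs_self C) (sq_nonneg L)
    linarith
  have h3 : D * L + D ≤ 2 * |D| * L := by
    have h5 := mul_le_mul_of_nonneg_right (le_abs_self D) (by linarith : 0 ≤ L)
    have h6 := mul_le_mul_of_nonneg_left hL1 (abs_nonneg D)
    linarith [le_abs_self D]
  refine (mul_le_mul_of_nonneg_left h3 (Real.exp_pos _).le).trans ((mul_le_mul_of_nonneg_right
    (Real.exp_le_exp.2 h2) (by positivity)).trans ?_)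
  rw [Real.exp_neg, inv_mul_le_iff₀ (Real.exp_pos _)]
  rw [pow_one, div_mul_eq_mul_div, div_le_iff₀ hε] at h1
  exact h1

/-- A short first phase of length t r²L supplies one factor 1/r, up to a power of L and the growth
exp(tβ²L³/4). The second phase has to supply the other factor 1/r = exp(-L³/3) from exp(-β³L³/8),
which is where β³ > 8/3 enters. -/
theorem survival_eventually_le {β : ℝ} (hβ0 : 0 < β) (hβ : 8 / 3 < β ^ 3) {ε : ℝ} (hε : 0 < ε) :
    ∀ᶠ n : ℕ in atTop, ∀ p : ℝ, 0 ≤ p → p ≤ (1 + 2 / cbrt n) / n →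
      survival p ⌊β * (cbrt n ^ 2 * cbrtLog n)⌋₊ 1 (n - 1) ≤ ε / cbrt n ^ 2 := by
  obtain ⟨t, ht0, htβ, hκ⟩ : ∃ t : ℝ, 0 < t ∧ 4 * t < β ∧
      1 / 3 < (β - 2 * t) ^ 3 / 8 - t * β ^ 2 / 4 := by
    have hcont : ContinuousAt (fun t : ℝ => (β - 2 * t) ^ 3 / 8 - t * β ^ 2 / 4) 0 := by fun_prop
    have h1 : ∀ᶠ t in 𝓝[>] (0 : ℝ), 1 / 3 < (β - 2 * t) ^ 3 / 8 - t * β ^ 2 / 4 :=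
      (hcont.eventually (lt_mem_nhds (by norm_num; linarith))).filter_mono nhdsWithin_le_nhds
    have h2 : ∀ᶠ t in 𝓝[>] (0 : ℝ), 4 * t < β := by
      have : ContinuousAt (fun t : ℝ => 4 * t) 0 := by fun_prop
      exact (this.eventually (gt_mem_nhds (by simpa))).filter_mono nhdsWithin_le_nhds
    obtain ⟨t, h3, h4, h5⟩ := (h1.and (h2.and self_mem_nhdsWithin)).exists
    exact ⟨t, h5, h4, h3⟩
  set κ := (β - 2 * t) ^ 3 / 8 - t * β ^ 2 / 4 with hκdef
  set α := β - t with hα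
  -- The second phase has length about α r²L; passing from α to α' absorbs the loss from rounding
  -- down.
  set α' := β - 2 * t with hα'
  have hα'0 : 0 < α' := by rw [hα']; linarith
  have hαα' : α' < α := by rw [hα, hα']; linarith
  have hα0 : 0 < α := hα'0.trans hαα'
  have hev := ((((eventually_exp_cubic_le (sub_pos.2 hκ) (2 * α ^ 2 + 2 * t * α)
    (2 * Real.exp 1 * (2 * α + 24)) hε).and
    (eventually_mul_pow_le_exp (by norm_num : (0 : ℝ) < 1 / 3) (4 * α ^ 4) 4)).and
    (eventually_mul_pow_le_exp (by norm_num : (0 : ℝ) < 1 / 3) (8 * α) 1)).and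
    (eventually_mul_pow_le_exp (by norm_num : (0 : ℝ) < 1 / 3) (1 / t + 1 / α' ^ 2 + 8) 0)).and
    ((eventually_ge_atTop (1 + 1 / t + 32 / α')))
  filter_upwards [tendsto_cbrtLog.eventually hev, eventually_ge_atTop 64] with n hn hn64 p hp0 hp
  obtain ⟨⟨⟨⟨hE, hr4⟩, hr1⟩, hr0⟩, hL⟩ := hn
  have hn0 : n ≠ 0 := by omega
  have hr := cbrt_eq_exp hn0
  have hr3 := cbrt_pow_three n
  have hrpos := cbrt_pos hn0
  set r := cbrt n with hrdef
  set L := cbrtLog n with hLdef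
  rw [show 1 / 3 * L ^ 3 = L ^ 3 / 3 by ring, ← hr] at hr4 hr1 hr0
  rw [pow_zero, mul_one] at hr0
  rw [pow_one] at hr1
  have i1 : 0 < 1 / t := by positivity
  have i2 : 0 < 32 / α' := by positivity
  have i3 : 0 < 1 / α' ^ 2 := by positivity
  have hL1 : 1 ≤ L := by linarith
  have htL : 1 ≤ t * L := by
    have : 1 / t ≤ L := by linarith
    rwa [div_le_iff₀ ht0, mul_comm] at this
  have hαL : 32 ≤ α' * L := by
    have : 32 / α' ≤ L := by linarith
    rwa [div_le_iff₀ hα'0, mul_comm] at this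
  have hr8 : 8 ≤ r := by linarith
  have hr2 : 64 ≤ r ^ 2 := (pow_le_pow_left₀ (by norm_num) hr8 2).trans' (by norm_num)
  have hrt : 1 / t ≤ r := by linarith
  have hT : 1 ≤ t * (r ^ 2 * L) := by
    have : 1 * 1 ≤ r ^ 2 * (t * L) := mul_le_mul (by linarith) htL (by norm_num) (by positivity)
    linarith
  have hA0 : 0 ≤ r ^ 2 * L := by positivity
  set s₁ := ⌊α * (r ^ 2 * L)⌋₊ with hs₁
  set s₀ := ⌊t * (r ^ 2 * L)⌋₊ with hs₀
  have hs₁u : (s₁ : ℝ) ≤ α * (r ^ 2 * L) := Nat.floor_le (by positivity)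
  have hs₀u : (s₀ : ℝ) ≤ t * (r ^ 2 * L) := Nat.floor_le (by positivity)
  have hs₁l : α' * (r ^ 2 * L) ≤ s₁ := by
    have := Nat.lt_floor_add_one (α * (r ^ 2 * L))
    have e : α * (r ^ 2 * L) = α' * (r ^ 2 * L) + t * (r ^ 2 * L) := by rw [hα, hα']; ring
    linarith
  have hs₀l : t * (r ^ 2 * L) ≤ s₀ + 1 := (Nat.lt_floor_add_one _).le
  have hsum : s₀ + s₁ ≤ ⌊β * (r ^ 2 * L)⌋₊ := by
    refine Nat.le_floor ?_
    push_cast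
    have e : β * (r ^ 2 * L) = α * (r ^ 2 * L) + t * (r ^ 2 * L) := by rw [hα]; ring
    linarith
  have hl1 : 2 / r ≤ 1 / 4 := by rw [div_le_iff₀ hrpos]; linarith
  have hnpos : (0 : ℝ) < n := by positivity
  have hs1r : r ^ 2 * 32 ≤ s₁ := by
    refine le_trans ?_ hs₁l
    have := mul_le_mul_of_nonneg_left hαL (sq_nonneg r)
    linarith
  have hs₁1 : (1 : ℝ) ≤ s₁ := by linarith
  have hs₁0 : 0 < s₁ := by exact_mod_cast (by linarith : (0 : ℝ) < s₁)
  have c1 : n ≤ s₁ ^ 2 := by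
    have : (n : ℝ) ≤ s₁ ^ 2 := by
      rw [← hr3]
      calc r ^ 3 ≤ (r ^ 2) ^ 2 := by
            rw [← pow_mul]; exact pow_le_pow_right₀ (by linarith) (by norm_num)
        _ ≤ _ := pow_le_pow_left₀ (by positivity) (by linarith [sq_nonneg r]) 2
    exact_mod_cast this
  have c2 : 8 * s₁ ≤ n := by
    have : (8 : ℝ) * s₁ ≤ n := by
      rw [← hr3]
      have := mul_le_mul_of_nonneg_left hr1 (sq_nonneg r)
      have e : r ^ 3 = r ^ 2 * r := by ring
      linarith
    exact_mod_cast this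
  have c3 : 16 * (2 / r) * n ≤ s₁ := by
    have : 16 * (2 / r) * n = r ^ 2 * 32 := by rw [← hr3]; field_simp; norm_num
    linarith
  have hp1 : p ≤ 1 := by
    refine hp.trans ?_
    rw [div_le_one hnpos]
    have : (64 : ℝ) ≤ n := by exact_mod_cast hn64
    linarith
  refine (survival_anti hp0 hp1 1 (n - 1) hsum).trans ((survival_two_phase_exp (by positivity) hl1
    hp0 hp c1 c2 hs₁0 hn64 c3 s₀).trans ?_)
  have hsn : (s₁ : ℝ) / n ≤ α * L / r := by
    rw [← hr3, div_le_div_iff₀ (by positivity) hrpos]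
    have := mul_le_mul_of_nonneg_right hs₁u hrpos.le
    linarith
  have hsn0 : 0 ≤ (s₁ : ℝ) / n := by positivity
  have d1 : α' ^ 3 * L ^ 3 / 8 ≤ (s₁ : ℝ) ^ 3 / (8 * n ^ 2) := by
    rw [div_le_div_iff₀ (by norm_num) (by positivity), ← hr3]
    have := pow_le_pow_left₀ (by positivity) hs₁l 3
    have e : (α' * (r ^ 2 * L)) ^ 3 = α' ^ 3 * L ^ 3 * (r ^ 3) ^ 2 := by ring
    linarith
  have d2 : 2 / r * (s₁ : ℝ) ^ 2 / n ≤ 2 * α ^ 2 * L ^ 2 := by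
    rw [div_le_iff₀ hnpos, div_mul_eq_mul_div, div_le_iff₀ hrpos, ← hr3]
    have := pow_le_pow_left₀ (by positivity) hs₁u 2
    have e : (α * (r ^ 2 * L)) ^ 2 * 2 = 2 * α ^ 2 * L ^ 2 * r ^ 3 * r := by ring
    linarith
  have d3 : 4 * (s₁ : ℝ) ^ 4 / n ^ 3 ≤ 1 := by
    rw [div_le_one (by positivity), ← hr3]
    have := pow_le_pow_left₀ (by positivity) hs₁u 4
    have e : (α * (r ^ 2 * L)) ^ 4 * 4 = r ^ 8 * (4 * α ^ 4 * L ^ 4) := by ring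
    have h5 := mul_le_mul_of_nonneg_left hr4 (by positivity : 0 ≤ r ^ 8)
    have e2 : (r ^ 3) ^ 3 = r ^ 8 * r := by ring
    linarith
  have d4 : s₀ * (2 / r * s₁ / n + (s₁ / n : ℝ) ^ 2 / 4) ≤
      2 * t * α * L ^ 2 + t * β ^ 2 / 4 * L ^ 3 := by
    have e1 : 2 / r * s₁ / n + (s₁ / n : ℝ) ^ 2 / 4 ≤
        2 / r * (α * L / r) + (α * L / r) ^ 2 / 4 := by
      rw [mul_div_assoc]
      gcongr
    refine (mul_le_mul hs₀u e1 (by positivity) (by positivity)).trans ?_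
    have e2 : t * (r ^ 2 * L) * (2 / r * (α * L / r) + (α * L / r) ^ 2 / 4) =
        2 * t * α * L ^ 2 + t * α ^ 2 / 4 * L ^ 3 := by field_simp
    rw [e2]
    have : α ^ 2 ≤ β ^ 2 := pow_le_pow_left₀ hα0.le (by rw [hα]; linarith) 2
    gcongr
  have d5 : 8 / √(s₀ + 1 : ℝ) ≤ 8 / r := by
    refine div_le_div_of_nonneg_left (by norm_num) hrpos (Real.le_sqrt_of_sq_le ?_)
    have := mul_le_mul_of_nonneg_left htL (sq_nonneg r)
    linarith
  have hX : 0 ≤ 2 * t * α * L ^ 2 + t * β ^ 2 / 4 * L ^ 3 := by positivity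
  have d6 : Real.exp (s₀ * (2 / r * s₁ / n + (s₁ / n : ℝ) ^ 2 / 4)) * (2 * (s₁ / n)) +
      8 / √(s₀ + 1) + 8 * (2 / r) ≤ Real.exp (2 * t * α * L ^ 2 + t * β ^ 2 / 4 * L ^ 3) *
        ((2 * α * L + 24) / r) := by
    have e1 : Real.exp (s₀ * (2 / r * s₁ / n + (s₁ / n : ℝ) ^ 2 / 4)) * (2 * (s₁ / n)) ≤
        Real.exp (2 * t * α * L ^ 2 + t * β ^ 2 / 4 * L ^ 3) * (2 * (α * L / r)) := by gcongr
    have e2 : 8 / √(s₀ + 1 : ℝ) + 8 * (2 / r) ≤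
        Real.exp (2 * t * α * L ^ 2 + t * β ^ 2 / 4 * L ^ 3) * (24 / r) := by
      have : 24 / r ≤ Real.exp (2 * t * α * L ^ 2 + t * β ^ 2 / 4 * L ^ 3) * (24 / r) :=
        le_mul_of_one_le_left (by positivity) (Real.one_le_exp hX)
      refine le_trans ?_ this
      calc 8 / √(s₀ + 1 : ℝ) + 8 * (2 / r) ≤ 8 / r + 8 * (2 / r) := by gcongr
        _ = 24 / r := by ring
    calc _ ≤ Real.exp (2 * t * α * L ^ 2 + t * β ^ 2 / 4 * L ^ 3) * (2 * (α * L / r)) +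
          Real.exp (2 * t * α * L ^ 2 + t * β ^ 2 / 4 * L ^ 3) * (24 / r) := by linarith
      _ = _ := by ring
  have d7 : -((s₁ : ℝ) ^ 3 / (8 * n ^ 2)) + 2 / r * s₁ ^ 2 / n + 4 * s₁ ^ 4 / n ^ 3 ≤
      -(α' ^ 3 * L ^ 3 / 8) + 2 * α ^ 2 * L ^ 2 + 1 := by linarith
  calc _ ≤ 2 * Real.exp (-(α' ^ 3 * L ^ 3 / 8) + 2 * α ^ 2 * L ^ 2 + 1) *
        (Real.exp (2 * t * α * L ^ 2 + t * β ^ 2 / 4 * L ^ 3) * ((2 * α * L + 24) / r)) := by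
        gcongr
    _ = Real.exp (-(κ - 1 / 3) * L ^ 3 + (2 * α ^ 2 + 2 * t * α) * L ^ 2) *
        (2 * Real.exp 1 * (2 * α * L + 24)) / r ^ 2 := by
        have e : 2 * Real.exp (-(α' ^ 3 * L ^ 3 / 8) + 2 * α ^ 2 * L ^ 2 + 1) *
            Real.exp (2 * t * α * L ^ 2 + t * β ^ 2 / 4 * L ^ 3) * r =
            Real.exp (-(κ - 1 / 3) * L ^ 3 + (2 * α ^ 2 + 2 * t * α) * L ^ 2) *
              (2 * Real.exp 1) := by
          rw [hr, mul_assoc 2, mul_assoc 2, mul_left_comm _ (2 : ℝ), ← Real.exp_add,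
            ← Real.exp_add, ← Real.exp_add]
          congr 2
          rw [hκdef]; ring
        rw [eq_div_iff (by positivity)]
        calc _ = 2 * Real.exp (-(α' ^ 3 * L ^ 3 / 8) + 2 * α ^ 2 * L ^ 2 + 1) *
            Real.exp (2 * t * α * L ^ 2 + t * β ^ 2 / 4 * L ^ 3) * r * (2 * α * L + 24) := by
              field_simp
          _ = _ := by rw [e]; ring
    _ ≤ ε / r ^ 2 := by
        refine div_le_div_of_nonneg_right (le_trans ?_ hE) (by positivity)
        refine mul_le_mul_of_nonneg_left ?_ (Real.exp_pos _).le
        have : 2 * α * L + 24 ≤ (2 * α + 24) * L + (2 * α + 24) := by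
          linarith
        have := mul_le_mul_of_nonneg_left this (by positivity : 0 ≤ 2 * Real.exp 1)
        linarith

end Asymptotics

/-! ### Harmonic functions for the lower bound. -/

section SurvivalLower

/-- A maximum principle. Each step lowers a + u by one, so with s steps left a + u = n - S + s. A
function that is harmonic for the exploration, nonpositive where it has died and at most C at the
end is dominated by C times the survival probability. -/
theorem survival_ge {p C : ℝ} (h0 : 0 ≤ p) (h1 : p ≤ 1) {n S : ℕ} {h : ℕ → ℕ → ℝ}
    (hharm : ∀ s u, h (s + 1) u = ∑ b ∈ Finset.range (u + 1),
      (u.choose b) * (p ^ b * (1 - p) ^ (u - b)) * h s (u - b))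
    (hbd : ∀ s ≤ S, h s (n - S + s) ≤ 0)
    (hterm : ∀ a u, a ≠ 0 → a + u = n - S → h 0 u ≤ C)
    (s a u : ℕ) (hs : s ≤ S) (hau : a + u = n - S + s) : h s u ≤ C * survival p s a u := by
  induction s generalizing a u with
  | zero =>
    rcases eq_or_ne a 0 with rfl | ha
    · rw [zero_add] at hau
      rw [survival_zero_left, mul_zero, hau]
      exact hbd 0 hs
    · simpa [survival, ha] using hterm a u ha hau
  | succ s ih =>
    rcases eq_or_ne a 0 with rfl | ha
    · rw [zero_add] at hau
      rw [survival_zero_left, mul_zero, hau]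
      exact hbd _ hs
    · rw [survival_succ p s u ha, hharm, Finset.mul_sum]
      calc _ ≤ ∑ b ∈ Finset.range (u + 1), (u.choose b) * (p ^ b * (1 - p) ^ (u - b)) *
            (C * survival p s (a - 1 + b) (u - b)) :=
            sum_binomial_le h0 h1 u fun b hb => ih _ _ (by omega) (by omega)
        _ = _ := Finset.sum_congr rfl fun _ _ => by ring

/-- Each unexplored vertex stays unexplored with probability 1 - p, so exponentials in u are
propagated exactly. These are the building blocks for `survival_ge`; x may be negative. -/
theorem harmonic_pow (p x : ℝ) (s u : ℕ) : (1 - x * (1 - p) ^ (s + 1)) ^ u =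
    ∑ b ∈ Finset.range (u + 1), (u.choose b) * (p ^ b * (1 - p) ^ (u - b)) *
      (1 - x * (1 - p) ^ s) ^ (u - b) := by
  have := sum_binomial p 1 (1 - x * (1 - p) ^ s) u
  simp only [one_pow, one_mul] at this
  rw [this]
  congr 1; ring

theorem one_sub_pow_le {p : ℝ} (h0 : 0 ≤ p) (h1 : p ≤ 1) (d : ℕ) :
    (1 - p) ^ d ≤ 1 - d * p + (d * p) ^ 2 / 2 := by
  have key : (1 - p) ^ d ≤ 1 - d * p + d * (d - 1) / 2 * p ^ 2 := by
    induction d with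
    | zero => simp
    | succ d ih =>
      have h2 := mul_le_mul_of_nonneg_right ih (by linarith : 0 ≤ 1 - p)
      have h3 : (0 : ℝ) ≤ d * (d - 1) := by
        rcases Nat.eq_zero_or_pos d with rfl | h
        · simp
        · have : (1 : ℝ) ≤ d := by exact_mod_cast h
          exact mul_nonneg d.cast_nonneg (by linarith)
      have h4 := mul_nonneg h3 (pow_nonneg h0 3)
      rw [pow_succ (1 - p) d]
      push_cast
      linarith
  have : 0 ≤ (d : ℝ) * p ^ 2 := by positivity
  linarith

/-- The logarithm of the ratio of the values at the boundary of two harmonic functions. -/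
noncomputable def boundaryLog (n d Q y : ℝ) : ℝ :=
  (n - d) * Real.log (1 - y) - n * Real.log (1 - y * Q)

theorem hasDerivAt_boundaryLog {n d Q y : ℝ} (hy : y < 1) (hyQ : y * Q < 1) :
    HasDerivAt (boundaryLog n d Q)
      ((n * Q - (n - d) - d * y * Q) / ((1 - y) * (1 - y * Q))) y := by
  have h1 : 1 - y ≠ 0 := by linarith
  have h2 : 1 - y * Q ≠ 0 := by linarith
  have e1 : HasDerivAt (fun y : ℝ => 1 - y) (-1) y := by
    simpa using (hasDerivAt_id y).const_sub 1
  have e2 : HasDerivAt (fun y : ℝ => 1 - y * Q) (-Q) y := by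
    simpa using ((hasDerivAt_id y).mul_const Q).const_sub 1
  have := ((e1.log h1).const_mul (n - d)).sub ((e2.log h2).const_mul n)
  refine this.congr_deriv ?_
  field_simp
  ring

/-- The numerator of the derivative decreases in y, and the last hypothesis places y₂ beyond the
maximum. -/
theorem boundaryLog_anti {n d Q y₂ y : ℝ} (hd : 0 ≤ d) (hQ0 : 0 ≤ Q) (hQ1 : Q ≤ 1) (hy0 : 0 ≤ y₂)
    (hy : y₂ ≤ y) (hy1 : y < 1) (h : n * Q - (n - d) ≤ d * y₂ * Q) :
    boundaryLog n d Q y ≤ boundaryLog n d Q y₂ := by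
  have hlt : ∀ z ∈ Set.Icc y₂ y, z < 1 ∧ z * Q < 1 := fun z hz =>
    ⟨by linarith [hz.2], by nlinarith [hz.1, hz.2]⟩
  refine antitoneOn_of_deriv_nonpos (convex_Icc y₂ y) ?_ ?_ ?_ (Set.left_mem_Icc.2 hy)
    (Set.right_mem_Icc.2 hy) hy
  · exact fun z hz => (hasDerivAt_boundaryLog (hlt z hz).1 (hlt z hz).2).continuousAt.continuousWithinAt
  · intro z hz
    have hz' := interior_subset hz
    exact (hasDerivAt_boundaryLog (hlt z hz').1 (hlt z hz').2).differentiableAt.differentiableWithinAt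
  · intro z hz
    have hz' := interior_subset hz
    obtain ⟨h1, h2⟩ := hlt z hz'
    rw [(hasDerivAt_boundaryLog h1 h2).deriv]
    refine div_nonpos_of_nonpos_of_nonneg ?_ (mul_nonneg (by linarith) (by linarith))
    have := mul_le_mul_of_nonneg_right (mul_le_mul_of_nonneg_left hz'.1 hd) hQ0
    linarith

/-- Near 0 the slope is about G - dQy with G = nQ - (n-d) ≥ 0. Going to -2y loses on the linear term
and, thanks to the factor 2, also on the quadratic one. -/
theorem boundaryLog_neg_le {n d Q y : ℝ} (hd : 0 ≤ d) (hQ0 : 0 ≤ Q) (hQ1 : Q ≤ 1) (hy0 : 0 ≤ y)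
    (hy1 : y ≤ 1 / 4) (h : 0 ≤ n * Q - (n - d)) :
    boundaryLog n d Q (-2 * y) ≤ boundaryLog n d Q y := by
  have hder : ∀ z ∈ Set.Icc 0 y, HasDerivAt
      (fun z => boundaryLog n d Q z - boundaryLog n d Q (-2 * z))
      ((n * Q - (n - d) - d * z * Q) / ((1 - z) * (1 - z * Q)) -
        (n * Q - (n - d) - d * (-2 * z) * Q) / ((1 - (-2 * z)) * (1 - (-2 * z) * Q)) * -2) z := by
    intro z hz
    have hzQ : 0 ≤ z * Q := mul_nonneg hz.1 hQ0
    have hzQ1 : z * Q ≤ z := mul_le_of_le_one_right hz.1 hQ1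
    have e1 := hasDerivAt_boundaryLog (n := n) (d := d) (Q := Q) (y := z) (by linarith [hz.2])
      (by linarith [hz.2])
    have e2 := hasDerivAt_boundaryLog (n := n) (d := d) (Q := Q) (y := -2 * z) (by linarith [hz.1])
      (by linarith)
    have e3 : HasDerivAt (fun z : ℝ => -2 * z) (-2) z := by
      simpa using (hasDerivAt_id z).const_mul (-2)
    exact e1.sub (e2.comp z e3)
  have hmono : MonotoneOn (fun z => boundaryLog n d Q z - boundaryLog n d Q (-2 * z))
      (Set.Icc 0 y) := by
    refine monotoneOn_of_deriv_nonneg (convex_Icc 0 y)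
      (fun z hz => (hder z hz).continuousAt.continuousWithinAt)
      (fun z hz => (hder z (interior_subset hz)).differentiableAt.differentiableWithinAt) ?_
    intro z hz
    have hz' := interior_subset hz
    rw [(hder z hz').deriv]
    have hz0 := hz'.1
    have hz1 : z ≤ 1 / 4 := hz'.2.trans hy1
    have hzQ : 0 ≤ z * Q := mul_nonneg hz0 hQ0
    have hzQ1 : z * Q ≤ 1 / 4 := (mul_le_of_le_one_right hz0 hQ1).trans hz1
    set G := n * Q - (n - d)
    have hA : 9 / 16 ≤ (1 - z) * (1 - z * Q) := by
      have := mul_le_mul (by linarith : 3 / 4 ≤ 1 - z) (by linarith : 3 / 4 ≤ 1 - z * Q)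
        (by norm_num) (by linarith)
      linarith
    have hB : (1 - -2 * z) * (1 - -2 * z * Q) ≤ 9 / 4 := by
      have := mul_le_mul (by linarith : 1 - -2 * z ≤ 3 / 2) (by linarith : 1 - -2 * z * Q ≤ 3 / 2)
        (by linarith) (by norm_num)
      linarith
    have hB0 : 0 < (1 - -2 * z) * (1 - -2 * z * Q) := mul_pos (by linarith) (by linarith)
    have hw : 0 ≤ d * z * Q := mul_nonneg (mul_nonneg hd hz0) hQ0
    have e1 : -(d * z * Q * (16 / 9)) ≤ (G - d * z * Q) / ((1 - z) * (1 - z * Q)) := by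
      rw [le_div_iff₀ (by linarith)]
      have := mul_le_mul_of_nonneg_left hA (by positivity : 0 ≤ d * z * Q * (16 / 9))
      linarith
    have e2 : 2 * (d * z * Q) * (4 / 9) ≤
        (G - d * (-2 * z) * Q) / ((1 - -2 * z) * (1 - -2 * z * Q)) := by
      rw [le_div_iff₀ hB0]
      have := mul_le_mul_of_nonneg_left hB (by positivity : 0 ≤ 2 * (d * z * Q) * (4 / 9))
      linarith
    linarith
  have := hmono (Set.left_mem_Icc.2 hy0) (Set.right_mem_Icc.2 hy0) hy0
  simp only [mul_zero, sub_self] at this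
  linarith

theorem pow_le_of_boundaryLog_le {m d : ℕ} {Q y y' : ℝ} (hy : y < 1) (hy' : y' < 1)
    (hyQ : y * Q < 1) (hyQ' : y' * Q < 1)
    (h : boundaryLog (m + d : ℕ) d Q y ≤ boundaryLog (m + d : ℕ) d Q y') :
    (1 - y) ^ m ≤ ((1 - y * Q) / (1 - y' * Q)) ^ (m + d) * (1 - y') ^ m := by
  have h1 : 0 < 1 - y := by linarith
  have h2 : 0 < 1 - y' := by linarith
  have h3 : 0 < 1 - y * Q := by linarith
  have h4 : 0 < 1 - y' * Q := by linarith
  rw [← Real.log_le_log_iff (by positivity) (by positivity), Real.log_mul (by positivity)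
    (by positivity), Real.log_pow, Real.log_pow, Real.log_pow, Real.log_div h3.ne' h4.ne']
  simp only [boundaryLog] at h
  push_cast at h ⊢
  linarith

/-- The exponential rate of a harmonic function over the whole exploration. -/
noncomputable def rate (n S : ℕ) (x : ℝ) : ℝ :=
  n * Real.log (1 - x * (1 - 1 / n : ℝ) ^ S) - (n - S) * Real.log (1 - x)

/-- The same cubic polynomial as in the Chernoff exponent, now with a two-sided error. -/
theorem rate_bounds {n S : ℕ} (hn : n ≤ S ^ 2) (hS : 8 * S ≤ n) (hS0 : 0 < S) {x : ℝ}
    (hx0 : 0 ≤ x) (hx1 : x ≤ S / n) :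
    |rate n S x - (n * (-(x * (S / n : ℝ) ^ 2 / 2) + x ^ 2 * (S / n) / 2))| ≤
      8 * n * (S / n : ℝ) ^ 4 := by
  have hs' : (1 : ℝ) ≤ S := by exact_mod_cast hS0
  have hn1 : (8 : ℝ) * S ≤ n := by exact_mod_cast hS
  have hn0 : (0 : ℝ) < n := by linarith
  have hp0 : (0 : ℝ) ≤ 1 / n := by positivity
  have hp1 : (1 : ℝ) / n ≤ 1 := by rw [div_le_one hn0]; linarith
  have hd := one_sub_pow_le_of_le (l := 0) (p := 1 / n) le_rfl (by norm_num) (by simp) hn hS hS0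
  have hd' := one_sub_pow_le hp0 hp1 S
  have hdB := one_add_mul_le_pow (a := -(1 / n : ℝ)) (by linarith) S
  set q := (1 - 1 / n : ℝ) ^ S with hq
  rw [← sub_eq_add_neg, ← hq] at hdB
  set t : ℝ := S / n with ht
  have hSt : (S : ℝ) * (1 / n) = t := by rw [ht]; ring
  rw [hSt] at hd'
  rw [mul_neg, hSt] at hdB
  have ht0 : 0 < t := by positivity
  have ht1 : t ≤ 1 / 8 := by rw [ht, div_le_iff₀ hn0]; linarith
  have hStn : (S : ℝ) = n * t := by rw [ht]; field_simp
  set δ := 1 - q with hδ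
  have hx8 : x ≤ 1 / 8 := hx1.trans ht1
  have h1x : 0 < 1 - x := by linarith
  have hδ0 : 0 ≤ δ := by
    have : t ^ 2 ≤ t := pow_le_of_le_one ht0.le (by linarith) two_ne_zero
    linarith
  have hδt : δ ≤ t := by linarith
  have hδu : δ ≤ t - t ^ 2 / 2 + 2 * t ^ 3 := by linarith
  have hδl : t - t ^ 2 / 2 ≤ δ := by linarith
  set ρ := x * δ / (1 - x) with hρ
  have hρ0 : 0 ≤ ρ := by positivity
  have hrate : rate n S x = n * (Real.log (1 + ρ) + t * Real.log (1 - x)) := by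
    have : 1 - x * q = (1 + ρ) * (1 - x) := by rw [hρ, hδ]; field_simp; ring
    rw [rate, this, Real.log_mul (by positivity) h1x.ne', hStn]; ring
  have hinv := inv_one_sub_le (by linarith : x ≤ 1 / 2)
  have hinv' : 1 + x ≤ 1 / (1 - x) := by rw [le_div_iff₀ h1x]; nlinarith
  have hρe : ρ = x * δ * (1 / (1 - x)) := by rw [hρ]; ring
  have hxδ : 0 ≤ x * δ := by positivity
  have hρu : ρ ≤ x * δ * (1 + x + 2 * x ^ 2) := by
    rw [hρe]; exact mul_le_mul_of_nonneg_left hinv hxδ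
  have hρl : x * δ * (1 + x) ≤ ρ := by
    rw [hρe]; exact mul_le_mul_of_nonneg_left hinv' hxδ
  have hlog1u : Real.log (1 + ρ) ≤ ρ := by
    have := Real.log_le_sub_one_of_pos (by positivity : 0 < 1 + ρ); linarith
  have hlog1l : ρ - ρ ^ 2 ≤ Real.log (1 + ρ) := by
    have h := Real.one_sub_inv_le_log_of_pos (by positivity : 0 < 1 + ρ)
    have : ρ - ρ ^ 2 ≤ 1 - (1 + ρ)⁻¹ := by
      rw [le_sub_comm, inv_le_iff_one_le_mul₀ (by positivity)]
      have := pow_nonneg hρ0 3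
      linarith
    linarith
  have hlogu := log_one_sub_le hx0 (by linarith : x < 1)
  have hlogl : -x - x ^ 2 / 2 - 2 * x ^ 3 ≤ Real.log (1 - x) := by
    have h := Real.abs_log_sub_add_sum_range_le (x := x) (by rw [abs_of_nonneg hx0]; linarith) 2
    rw [abs_of_nonneg hx0] at h
    have h2 := (abs_le.1 h).1
    have h3 : x ^ (2 + 1) / (1 - x) ≤ 2 * x ^ 3 := by
      rw [div_le_iff₀ h1x, show x ^ (2 + 1) = x ^ 3 from rfl]
      have := mul_nonneg (pow_nonneg hx0 3) (by linarith : 0 ≤ 1 - 2 * x)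
      linarith
    simp [Finset.sum_range_succ] at h2
    norm_num at h2
    linarith
  have b1 : x * t ^ 3 ≤ t ^ 4 := by
    have := mul_le_mul_of_nonneg_right hx1 (pow_nonneg ht0.le 3); linarith
  have hxx : x ^ 2 ≤ t ^ 2 := pow_le_pow_left₀ hx0 hx1 2
  have hxxx : x ^ 3 ≤ t ^ 3 := pow_le_pow_left₀ hx0 hx1 3
  have b2 : x ^ 2 * t ^ 2 ≤ t ^ 4 := by
    have := mul_le_mul_of_nonneg_right hxx (pow_nonneg ht0.le 2); linarith
  have b3 : x ^ 3 * t ≤ t ^ 4 := by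
    have := mul_le_mul_of_nonneg_right hxxx ht0.le; linarith
  have b4 : ρ ^ 2 ≤ 4 * t ^ 4 := by
    have hb : ρ ≤ 2 * t ^ 2 := by
      have h4 : 1 + x + 2 * x ^ 2 ≤ 2 := by
        have := pow_le_of_le_one hx0 (by linarith) two_ne_zero
        linarith
      have h5 : x * δ ≤ t * t := mul_le_mul hx1 hδt hδ0 ht0.le
      refine hρu.trans ((mul_le_mul h5 h4 (by positivity) (by positivity)).trans (by
        rw [pow_two]; linarith))
    have := pow_le_pow_left₀ hρ0 hb 2
    linarith
  have upper : Real.log (1 + ρ) + t * Real.log (1 - x) ≤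
      -(x * t ^ 2 / 2) + x ^ 2 * t / 2 + 8 * t ^ 4 := by
    have h1 := mul_le_mul_of_nonneg_left hlogu ht0.le
    have h2 : x * δ * (1 + x + 2 * x ^ 2) ≤
        x * (t - t ^ 2 / 2 + 2 * t ^ 3) + x ^ 2 * (t - t ^ 2 / 2 + 2 * t ^ 3) + 2 * x ^ 3 * t := by
      have c1 := mul_le_mul_of_nonneg_left hδu hx0
      have c2 := mul_le_mul_of_nonneg_left hδu (sq_nonneg x)
      have c3 := mul_le_mul_of_nonneg_left hδt (by positivity : 0 ≤ 2 * x ^ 3)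
      linarith
    have h3 : x ^ 2 * t ^ 3 ≤ t ^ 4 := by
      have h5 := mul_le_mul_of_nonneg_left (ht1.trans (by norm_num : (1 : ℝ) / 8 ≤ 1))
        (by positivity : 0 ≤ x ^ 2 * t ^ 2)
      linarith
    have h4 : 0 ≤ x ^ 2 * t ^ 2 := by positivity
    linarith
  have lower : -(x * t ^ 2 / 2) + x ^ 2 * t / 2 - 8 * t ^ 4 ≤
      Real.log (1 + ρ) + t * Real.log (1 - x) := by
    have h1 := mul_le_mul_of_nonneg_left hlogl ht0.le
    have h2 : x * (t - t ^ 2 / 2) + x ^ 2 * (t - t ^ 2 / 2) ≤ x * δ * (1 + x) := by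
      have c1 := mul_le_mul_of_nonneg_left hδl hx0
      have c2 := mul_le_mul_of_nonneg_left hδl (sq_nonneg x)
      linarith
    linarith
  rw [hrate, ← mul_sub, abs_mul, abs_of_pos hn0, mul_comm (8 : ℝ), mul_assoc]
  refine mul_le_mul_of_nonneg_left (abs_le.2 ⟨by linarith, by linarith⟩) hn0.le

end SurvivalLower

/-! ### The explicit lower bound for the survival probability. -/

section SurvivalLower

/-- For an exploration that dies with s steps left, u = n - S + s. As a function of the parameter,
the value there, relative to the value at the start with u = n, peaks near (S-s)/(2n) up to small
corrections. Parameters above 101/200 · S/n are therefore past the peak for every s, and the smaller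
parameter wins on the whole boundary. -/
theorem boundary_pow_le {n S s : ℕ} (hS : 200 * S ≤ n) (hs : s ≤ S) {x₂ x : ℝ}
    (hS0 : 0 < S) (hx2 : 101 / 200 * (S / n : ℝ) ≤ x₂) (hx : x₂ ≤ x) (hx1 : x ≤ 1 / 4) :
    (1 - x * (1 - 1 / n : ℝ) ^ s) ^ (n - S + s) ≤
      ((1 - x * (1 - 1 / n : ℝ) ^ S) / (1 - x₂ * (1 - 1 / n : ℝ) ^ S)) ^ n *
        (1 - x₂ * (1 - 1 / n : ℝ) ^ s) ^ (n - S + s) := by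
  have hs' : (1 : ℝ) ≤ S := by exact_mod_cast hS0
  have hn1 : (200 : ℝ) * S ≤ n := by exact_mod_cast hS
  have hn0 : (0 : ℝ) < n := by linarith
  have hp0 : (0 : ℝ) ≤ 1 / n := by positivity
  have hp1 : (1 : ℝ) / n ≤ 1 := by rw [div_le_one hn0]; linarith
  set q : ℝ := 1 - 1 / n with hq
  have hq0 : 0 ≤ q := by linarith
  have hq1 : q ≤ 1 := by linarith
  obtain ⟨d, rfl⟩ := Nat.exists_eq_add_of_le hs
  -- The constant is chosen because 101/200 · 100/101 = 1/2.
  have hqS : 100 / 101 ≤ q ^ (s + d) := by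
    have := one_add_mul_le_pow (a := -(1 / n : ℝ)) (by linarith) (s + d)
    rw [← sub_eq_add_neg, ← hq] at this
    have h2 : ((s + d : ℕ) : ℝ) * (1 / n) ≤ 1 / 200 := by
      rw [mul_one_div, div_le_iff₀ hn0]; linarith
    linarith
  have hQ := one_sub_pow_le hp0 hp1 d
  rw [← hq] at hQ
  have hx20 : 0 ≤ x₂ := le_trans (by positivity) hx2
  have hqs0 : 0 ≤ q ^ s := pow_nonneg hq0 s
  have hqs1 : q ^ s ≤ 1 := pow_le_one₀ hq0 hq1
  have hqd0 : 0 ≤ q ^ d := pow_nonneg hq0 d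
  have hqd1 : q ^ d ≤ 1 := pow_le_one₀ hq0 hq1
  have hbound : ∀ z, 0 ≤ z → z ≤ 1 / 4 → z * q ^ s < 1 ∧ z * q ^ s * q ^ d < 1 := by
    intro z hz0 hz1
    have h1 : z * q ^ s ≤ z := mul_le_of_le_one_right hz0 hqs1
    have h2 : z * q ^ s * q ^ d ≤ z * q ^ s := mul_le_of_le_one_right (by positivity) hqd1
    exact ⟨by linarith, by linarith⟩
  have hn : n - (s + d) + s + d = n := by omega
  have key := pow_le_of_boundaryLog_le (m := n - (s + d) + s) (d := d) (Q := q ^ d)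
    (y := x * q ^ s) (y' := x₂ * q ^ s) (hbound x (by linarith) hx1).1
    (hbound x₂ hx20 (by linarith)).1 (hbound x (by linarith) hx1).2
    (hbound x₂ hx20 (by linarith)).2 ?_
  · rw [hn, mul_assoc x, mul_assoc x₂, ← pow_add] at key
    exact key
  · rw [hn]
    refine boundaryLog_anti d.cast_nonneg hqd0 hqd1 (by positivity)
      (mul_le_mul_of_nonneg_right hx hqs0) (hbound x (by linarith) hx1).1 ?_
    rw [mul_assoc (d : ℝ), mul_assoc x₂, ← pow_add]
    have h1 : (n : ℝ) * q ^ d ≤ n - d + d ^ 2 / (2 * n) := by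
      have := mul_le_mul_of_nonneg_left hQ hn0.le
      refine this.trans (le_of_eq ?_)
      field_simp
    have h2 : ((s + d : ℕ) : ℝ) / (2 * n) ≤ x₂ * q ^ (s + d) := by
      have := mul_le_mul hx2 hqS (by norm_num) hx20
      refine le_trans (le_of_eq ?_) this
      field_simp; norm_num
    have h3 : (d : ℝ) / (2 * n) ≤ ((s + d : ℕ) : ℝ) / (2 * n) := by
      gcongr; omega
    have h4 := mul_le_mul_of_nonneg_left (h3.trans h2) d.cast_nonneg
    have h5 : (d : ℝ) * (d / (2 * n)) = d ^ 2 / (2 * n) := by ring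
    linarith

theorem boundary_pow_neg_le {n S s : ℕ} (hS : 200 * S ≤ n) (hs : s ≤ S) {x : ℝ}
    (hS0 : 0 < S) (hx0 : 0 ≤ x) (hx1 : x ≤ 1 / 4) :
    ((1 - x * (1 - 1 / n : ℝ) ^ S) / (1 - -2 * x * (1 - 1 / n : ℝ) ^ S)) ^ n *
      (1 - -2 * x * (1 - 1 / n : ℝ) ^ s) ^ (n - S + s) ≤
        (1 - x * (1 - 1 / n : ℝ) ^ s) ^ (n - S + s) := by
  have hs' : (1 : ℝ) ≤ S := by exact_mod_cast hS0
  have hn1 : (200 : ℝ) * S ≤ n := by exact_mod_cast hS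
  have hn0 : (0 : ℝ) < n := by linarith
  have hp0 : (0 : ℝ) ≤ 1 / n := by positivity
  have hp1 : (1 : ℝ) / n ≤ 1 := by rw [div_le_one hn0]; linarith
  set q : ℝ := 1 - 1 / n with hq
  have hq0 : 0 ≤ q := by linarith
  have hq1 : q ≤ 1 := by linarith
  obtain ⟨d, rfl⟩ := Nat.exists_eq_add_of_le hs
  have hQ := one_add_mul_le_pow (a := -(1 / n : ℝ)) (by linarith) d
  rw [← sub_eq_add_neg, ← hq] at hQ
  have hqs0 : 0 ≤ q ^ s := pow_nonneg hq0 s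
  have hqs1 : q ^ s ≤ 1 := pow_le_one₀ hq0 hq1
  have hqd0 : 0 ≤ q ^ d := pow_nonneg hq0 d
  have hqd1 : q ^ d ≤ 1 := pow_le_one₀ hq0 hq1
  have h1 : x * q ^ s ≤ 1 / 4 := (mul_le_of_le_one_right hx0 hqs1).trans hx1
  have h10 : 0 ≤ x * q ^ s := by positivity
  have h2 : x * q ^ s * q ^ d ≤ 1 / 4 := (mul_le_of_le_one_right h10 hqd1).trans h1
  have h20 : 0 ≤ x * q ^ s * q ^ d := by positivity
  have hn : n - (s + d) + s + d = n := by omega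
  have hneg : -2 * (x * q ^ s) = -2 * x * q ^ s := by ring
  have key := pow_le_of_boundaryLog_le (m := n - (s + d) + s) (d := d) (Q := q ^ d)
    (y := -2 * x * q ^ s) (y' := x * q ^ s) (by linarith) (by linarith) (by linarith)
    (by linarith) ?_
  · rw [hn, mul_assoc x, mul_assoc (-2 * x), ← pow_add] at key
    have hpos : 0 < 1 - x * q ^ (s + d) := by rw [pow_add]; linarith
    have hpos' : 0 < 1 - -2 * x * q ^ (s + d) := by rw [pow_add]; linarith
    refine (mul_le_mul_of_nonneg_left key (pow_nonneg (div_pos hpos hpos').le n)).trans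
      (le_of_eq ?_)
    rw [← mul_assoc, ← mul_pow, div_mul_div_comm, mul_comm (1 - x * q ^ (s + d)),
      div_self (mul_pos hpos' hpos).ne', one_pow, one_mul]
  · rw [hn, ← hneg]
    refine boundaryLog_neg_le d.cast_nonneg hqd0 hqd1 h10 h1 ?_
    have := mul_le_mul_of_nonneg_left hQ hn0.le
    have e : (n : ℝ) * (1 + d * -(1 / n)) = n - d := by field_simp; ring
    linarith

/-- Bernoulli's inequality twice: Q = (1 - 1/n)^S satisfies nQ ≥ n - S, and (1+c)^Q ≤ 1 + cQ. It
controls the terminal value of the exponential with negative parameter. -/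
theorem one_add_pow_le_one_add_mul_pow {c : ℝ} (hc : 0 ≤ c) {n S : ℕ} (hS : S ≤ n) (hn : 0 < n) :
    (1 + c) ^ (n - S) ≤ (1 + c * (1 - 1 / n : ℝ) ^ S) ^ n := by
  have hn0 : (0 : ℝ) < n := by exact_mod_cast hn
  have hn1 : (1 : ℝ) ≤ n := by exact_mod_cast hn
  have hp1 : (1 : ℝ) / n ≤ 1 := by rw [div_le_one hn0]; linarith
  have hp0 : (0 : ℝ) < 1 / n := by positivity
  have hQ := one_add_mul_le_pow (a := -(1 / n : ℝ)) (by linarith) S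
  rw [← sub_eq_add_neg] at hQ
  set Q := (1 - 1 / n : ℝ) ^ S
  have hQ0 : 0 ≤ Q := pow_nonneg (by linarith) S
  have hQ1 : Q ≤ 1 := pow_le_one₀ (by linarith) (by linarith)
  have h1 : (1 + c) ^ Q ≤ 1 + Q * c :=
    rpow_one_add_le_one_add_mul_self (by linarith) hQ0 hQ1
  have h2 : ((n - S : ℕ) : ℝ) ≤ Q * n := by
    rw [Nat.cast_sub hS]
    have := mul_le_mul_of_nonneg_right hQ hn0.le
    have e : (1 + S * -(1 / n : ℝ)) * n = n - S := by field_simp; ring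
    linarith
  calc (1 + c) ^ (n - S) = (1 + c) ^ ((n - S : ℕ) : ℝ) := (Real.rpow_natCast _ _).symm
    _ ≤ (1 + c) ^ (Q * n) := Real.rpow_le_rpow_of_exponent_le (by linarith) h2
    _ = ((1 + c) ^ Q) ^ n := by rw [Real.rpow_mul (by linarith), Real.rpow_natCast]
    _ ≤ _ := pow_le_pow_left₀ (by positivity) (by linarith) n

-- Let h_x be the harmonic exponential with parameter x. Taken with x near t/2 it has the right
-- growth, but it is positive on the boundary; subtracting κ h_(x₂) with x₂ < x repairs this and
-- leaves a value of order t at the start. It is also too large at the end if many vertices are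
-- active, so κ₃ h_(x₃) with x₃ > x is subtracted. That alone would cost a constant at the start, so
-- κ' h_(-2x₃) is first removed from h_(x₃): the difference is nonnegative on the boundary and of
-- order t at the start.
set_option maxHeartbeats 2000000 in
theorem survival_lower {n S : ℕ} (hn : n ≤ S ^ 2) (hS : 200 * S ≤ n) (hS0 : 0 < S)
    (herr : 8 * n * (S / n : ℝ) ^ 4 ≤ 1) (hT : 40000 ≤ n * (S / n : ℝ) ^ 3 / 8) :
    (S / n : ℝ) / 1000 * Real.exp (-(1.0825 * (n * (S / n : ℝ) ^ 3 / 8) + 2)) ≤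
      survival (1 / n) S 1 (n - 1) := by
  have hs' : (1 : ℝ) ≤ S := by exact_mod_cast hS0
  have hn1 : (200 : ℝ) * S ≤ n := by exact_mod_cast hS
  have hn0 : (0 : ℝ) < n := by linarith
  have hnN : 0 < n := by omega
  have hp0 : (0 : ℝ) ≤ 1 / n := by positivity
  have hp1 : (1 : ℝ) / n ≤ 1 := by rw [div_le_one hn0]; linarith
  set t : ℝ := S / n with ht
  have ht0 : 0 < t := by positivity
  have ht1 : t ≤ 1 / 200 := by rw [ht, div_le_iff₀ hn0]; linarith
  set T := n * t ^ 3 / 8 with hTdef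
  set x₂ := 101 / 200 * t with hx₂
  set x := 102 / 200 * t with hx
  set x₃ := 103 / 200 * t with hx₃
  have hb₁ := fun s (hs : s ≤ S) => boundary_pow_le hS hs hS0 (x₂ := x₂) (x := x) le_rfl
    (by rw [hx₂, hx]; linarith) (by rw [hx]; linarith)
  have hb₂ := fun s (hs : s ≤ S) => boundary_pow_neg_le hS hs hS0 (x := x₃) (by positivity)
    (by rw [hx₃]; linarith)
  have hr₁ := rate_bounds hn (by omega) hS0 (x := x) (by positivity) (by rw [hx]; linarith)
  have hr₃ := rate_bounds hn (by omega) hS0 (x := x₃) (by positivity) (by rw [hx₃]; linarith)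
  have hneg := one_add_pow_le_one_add_mul_pow (c := 2 * x₃) (by positivity) (by omega : S ≤ n) hnN
  rw [← ht] at hr₁ hr₃
  have hQ := one_add_mul_le_pow (a := -(1 / n : ℝ)) (by linarith) S
  rw [← sub_eq_add_neg, mul_neg, mul_one_div, ← ht] at hQ
  have hQ1 : (1 - 1 / n : ℝ) ^ S ≤ 1 := pow_le_one₀ (by linarith) (by linarith)
  have hharm := harmonic_pow (1 / n : ℝ)
  unfold rate at hr₁ hr₃
  set q : ℝ := 1 - 1 / n with hq
  set Q := q ^ S with hQdef
  have hQ0 : 199 / 200 ≤ Q := by linarith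
  set X₂ := x₂ * Q with hX₂
  set X := x * Q with hX
  set X₃ := x₃ * Q with hX₃
  have hX0 : 0 < X := by positivity
  have hX20 : 0 < X₂ := by positivity
  have hX30 : 0 < X₃ := by positivity
  have hXx : X ≤ x := mul_le_of_le_one_right (by positivity) hQ1
  have hX31 : X₃ ≤ x₃ := mul_le_of_le_one_right (by positivity) hQ1
  have hx1 : x ≤ 1 / 200 := by rw [hx]; linarith
  have hx31 : x₃ ≤ 1 / 200 := by rw [hx₃]; linarith
  have hX2X : X₂ ≤ X := mul_le_mul_of_nonneg_right (by rw [hx₂, hx]; linarith) (by linarith)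
  have hXX3 : X ≤ X₃ := mul_le_mul_of_nonneg_right (by rw [hx, hx₃]; linarith) (by linarith)
  -- κ and κ' equalise the two members of a pair at the fictitious dead start u = n, so at the true
  -- start u = n - 1 the pairs differ by a relative amount of order t. The factor 1/1000 in κ₃ keeps
  -- the cost of the second pair below the gain of about t/200 from the first.
  set κ := ((1 - X) / (1 - X₂)) ^ n with hκ
  set κ' := ((1 - X₃) / (1 - -2 * x₃ * Q)) ^ n with hκ'
  set κ₃ := (1 / 1000) * ((1 - X) / (1 - X₃)) ^ (n - 1) with hκ₃
  have hκ0 : 0 ≤ κ := pow_nonneg (div_nonneg (by linarith) (by linarith)) n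
  have hden4 : 1 - -2 * x₃ * Q = 1 + 2 * X₃ := by rw [hX₃]; ring
  have hκ'0 : 0 ≤ κ' := by
    rw [hκ', hden4]; exact pow_nonneg (div_nonneg (by linarith) (by linarith)) n
  have hκ₃0 : 0 < κ₃ := mul_pos (by norm_num) (pow_pos (div_pos (by linarith) (by linarith)) _)
  set h : ℕ → ℕ → ℝ := fun s u => (1 - x * q ^ s) ^ u - κ * (1 - x₂ * q ^ s) ^ u -
    κ₃ * ((1 - x₃ * q ^ s) ^ u - κ' * (1 - -2 * x₃ * q ^ s) ^ u) with hh
  have hh_harm : ∀ s u, h (s + 1) u = ∑ b ∈ Finset.range (u + 1),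
      (u.choose b) * ((1 / n : ℝ) ^ b * (1 - 1 / n : ℝ) ^ (u - b)) * h s (u - b) := by
    intro s u
    simp only [hh, hharm, Finset.mul_sum, ← Finset.sum_sub_distrib]
    exact Finset.sum_congr rfl fun _ _ => by ring
  have hh_bd : ∀ s ≤ S, h s (n - S + s) ≤ 0 := by
    intro s hs
    have e1 := hb₁ s hs
    have e2 := mul_nonneg hκ₃0.le (sub_nonneg.2 (hb₂ s hs))
    simp only [hh]
    linarith
  -- the terminal values
  set a₀ := ⌈n * t ^ 2 / 50⌉₊ with ha₀
  have ha₀l : n * t ^ 2 / 50 ≤ a₀ := Nat.le_ceil _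
  have ha₀u : (a₀ : ℝ) ≤ n * t ^ 2 / 50 + 1 := (Nat.ceil_lt_add_one (by positivity)).le
  set B := Real.exp (1.0825 * T + 2) with hB
  have hB1 : 1 ≤ B := Real.one_le_exp (by linarith)
  have h1x : 0 < 1 - x := by linarith
  have h1x3 : 0 < 1 - x₃ := by linarith
  have h1X : 0 < 1 - X := by linarith
  have h1X3 : 0 < 1 - X₃ := by linarith
  have hlx : -(x + x ^ 2) ≤ Real.log (1 - x) := by
    rw [Real.le_log_iff_exp_le h1x]
    exact exp_neg_le_one_sub (by positivity) (by linarith)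
  have hm₁ : n * (-(x * t ^ 2 / 2) + x ^ 2 * t / 2) = -0.9996 * T := by
    rw [hTdef, hx]; ring
  have hm₃ : n * (-(x₃ * t ^ 2 / 2) + x₃ ^ 2 * t / 2) = -0.9991 * T := by
    rw [hTdef, hx₃]; ring
  rw [hm₁] at hr₁
  rw [hm₃] at hr₃
  have hr₁' := abs_le.1 (hr₁.trans herr)
  have hr₃' := abs_le.1 (hr₃.trans herr)
  have hSn : ((n - S : ℕ) : ℝ) = n - S := Nat.cast_sub (by omega)
  have hlXX : Real.log (1 - X) ≤ 0 := Real.log_nonpos (by linarith) (by linarith)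
  have hh_term : ∀ a u, a ≠ 0 → a + u = n - S → h 0 u ≤ (1 - X) ^ (n - 1) * (2 * B) := by
    intro a u ha hau
    simp only [hh, pow_zero, mul_one]
    have e1 : 0 ≤ κ * (1 - x₂) ^ u :=
      mul_nonneg hκ0 (pow_nonneg (by rw [hx₂]; linarith) u)
    have e2 : κ₃ * (κ' * (1 - -2 * x₃) ^ u) ≤ (1 - X) ^ (n - 1) * B := by
      have e3 : (1 - -2 * x₃) ^ u ≤ (1 + 2 * X₃) ^ n := by
        rw [show 1 - -2 * x₃ = 1 + 2 * x₃ by ring]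
        refine (pow_le_pow_right₀ (by linarith) (by omega : u ≤ n - S)).trans (hneg.trans
          (le_of_eq ?_))
        rw [hX₃]; ring
      have e4 : κ' * (1 - -2 * x₃) ^ u ≤ (1 - X₃) ^ n := by
        refine (mul_le_mul_of_nonneg_left e3 hκ'0).trans (le_of_eq ?_)
        rw [hκ', hden4, ← mul_pow, div_mul_cancel₀ _ (by linarith)]
      have e5 : (1 - X₃) ^ n ≤ (1 - X₃) ^ (n - 1) :=
        pow_le_pow_of_le_one h1X3.le (by linarith) (by omega)
      refine (mul_le_mul_of_nonneg_left (e4.trans e5) hκ₃0.le).trans ?_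
      rw [hκ₃, mul_assoc, ← mul_pow, div_mul_cancel₀ _ h1X3.ne']
      have h6 := pow_nonneg h1X.le (n - 1)
      have h7 := mul_le_mul_of_nonneg_left hB1 h6
      linarith only [h6, h7]
    have e6 : (1 - x) ^ u - κ₃ * (1 - x₃) ^ u ≤ (1 - X) ^ (n - 1) * B := by
      have hau' : (u : ℝ) = n - S - a := by
        rw [← hSn, ← hau]; push_cast; ring
      rcases le_or_gt a a₀ with haa | haa
      · have e7 : (1 - x) ^ u ≤ (1 - X) ^ (n - 1) * B := by
          have e8 : (1 - x) ^ u ≤ (1 - X) ^ n * B := by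
            rw [← Real.log_le_log_iff (by positivity) (by positivity),
              Real.log_mul (by positivity) (by positivity), Real.log_pow, Real.log_pow, hB,
              Real.log_exp, hau']
            have haa' : (a : ℝ) ≤ n * t ^ 2 / 50 + 1 := le_trans (by exact_mod_cast haa) ha₀u
            have e9 : a * -Real.log (1 - x) ≤ (n * t ^ 2 / 50 + 1) * (x + x ^ 2) :=
              mul_le_mul haa' (by linarith)
                (neg_nonneg.2 (Real.log_nonpos h1x.le (by linarith [hX0]))) (by positivity)
            have e10 : (n * t ^ 2 / 50 + 1) * (x + x ^ 2) ≤ 0.0825 * T + 1 := by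
              have e11 : x + x ^ 2 ≤ 0.515 * t := by
                have := mul_le_mul_of_nonneg_left hx1 (by positivity : 0 ≤ x)
                rw [hx] at this ⊢
                linarith
              refine (mul_le_mul_of_nonneg_left e11 (by positivity)).trans ?_
              have : 0 ≤ n * t ^ 3 := by positivity
              rw [hTdef]
              linarith
            linarith
          refine e8.trans (mul_le_mul_of_nonneg_right ?_ (by positivity))
          exact pow_le_pow_of_le_one h1X.le (by linarith) (by omega)
        have h7 := mul_nonneg hκ₃0.le (pow_nonneg h1x3.le u)
        linarith only [h7, e7]
      -- The gain a(x₃ - x) ≥ 0.0008 T beats the loss 0.0005 T between the two rates plus bounded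
      -- terms; the difference of 0.0003 T covers these because T ≥ 40000.
      · have e7 : (1 - x) ^ u ≤ κ₃ * (1 - x₃) ^ u := by
          rw [← Real.log_le_log_iff (by positivity) (by positivity),
            Real.log_mul hκ₃0.ne' (by positivity), hκ₃, Real.log_mul (by norm_num)
            (by positivity), Real.log_pow, Real.log_pow, Real.log_pow,
            Real.log_div h1X.ne' h1X3.ne', Nat.cast_sub (by omega : 1 ≤ n), hau', Nat.cast_one]
          have haa' : n * t ^ 2 / 50 ≤ a := ha₀l.trans (by exact_mod_cast haa.le)
          have e8 : x₃ - x ≤ Real.log (1 - x) - Real.log (1 - x₃) := by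
            rw [← Real.log_div h1x.ne' h1x3.ne']
            have h5 := Real.one_sub_inv_le_log_of_pos (div_pos h1x h1x3)
            rw [inv_div] at h5
            refine le_trans ?_ h5
            rw [le_sub_comm, div_le_iff₀ h1x]
            have : 0 ≤ (x₃ - x) * x := mul_nonneg (by rw [hx, hx₃]; linarith) (by positivity)
            linarith
          have e9 : n * t ^ 2 / 50 * (x₃ - x) ≤ a * (Real.log (1 - x) - Real.log (1 - x₃)) :=
            mul_le_mul haa' e8 (by rw [hx, hx₃]; linarith) (by positivity)
          have e10 : n * t ^ 2 / 50 * (x₃ - x) = 0.0008 * T := by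
            rw [hTdef, hx, hx₃]; ring
          have e11 : -7 ≤ Real.log (1 / 1000) := by
            rw [Real.le_log_iff_exp_le (by norm_num), Real.exp_neg, inv_le_comm₀
              (Real.exp_pos _) (by norm_num), one_div, inv_inv]
            have h2 : (2.7 : ℝ) ≤ Real.exp 1 := by linarith only [Real.exp_one_gt_d9]
            have h3 := pow_le_pow_left₀ (by norm_num) h2 7
            rw [← Real.exp_nat_mul] at h3
            norm_num at h3 ⊢
            linarith
          have e12 : -1 ≤ Real.log (1 - X₃) := by
            rw [Real.le_log_iff_exp_le h1X3]
            linarith only [Real.exp_neg_one_lt_half, hX31, hx31]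
          linarith
        have h7 : 0 ≤ (1 - X) ^ (n - 1) * B := by positivity
        linarith only [h7, e7]
    have e13 : (1 - x) ^ u - κ * (1 - x₂) ^ u - κ₃ * ((1 - x₃) ^ u - κ' * (1 - -2 * x₃) ^ u) =
      ((1 - x) ^ u - κ₃ * (1 - x₃) ^ u) + κ₃ * (κ' * (1 - -2 * x₃) ^ u) - κ * (1 - x₂) ^ u := by
      ring
    rw [e13]
    linarith only [e1, e2, e6]
  have key := survival_ge hp0 hp1 hh_harm hh_bd hh_term S 1 (n - 1) le_rfl (by omega)
  have hpow : 0 < (1 - X) ^ (n - 1) := pow_pos h1X _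
  have hval : (1 - X) ^ (n - 1) * (t / 500) ≤ h S (n - 1) := by
    have hsucc : n - 1 + 1 = n := by omega
    have f1 : κ * (1 - X₂) ^ (n - 1) = (1 - X) ^ (n - 1) * ((1 - X) / (1 - X₂)) := by
      have h2 : (1 - X₂) ≠ 0 := by linarith
      rw [hκ, ← hsucc, pow_succ, Nat.add_sub_cancel, mul_right_comm, ← mul_pow,
        div_mul_cancel₀ _ h2]
    have f2 : κ₃ * (1 - X₃) ^ (n - 1) = (1 - X) ^ (n - 1) * (1 / 1000) := by
      rw [hκ₃, mul_assoc, ← mul_pow, div_mul_cancel₀ _ h1X3.ne', mul_comm]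
    have f3 : κ' * (1 - -2 * x₃ * Q) ^ (n - 1) =
        (1 - X₃) ^ (n - 1) * ((1 - X₃) / (1 + 2 * X₃)) := by
      have h2 : (1 + 2 * X₃) ≠ 0 := by linarith
      rw [hκ', hden4, ← hsucc, pow_succ, Nat.add_sub_cancel, mul_right_comm, ← mul_pow,
        div_mul_cancel₀ _ h2]
    have f4 : h S (n - 1) = (1 - X) ^ (n - 1) *
        ((1 - (1 - X) / (1 - X₂)) - 1 / 1000 * (1 - (1 - X₃) / (1 + 2 * X₃))) := by
      simp only [hh]
      rw [← hQdef, ← hX, ← hX₂, ← hX₃, f3, f1, mul_sub, f2, ← mul_assoc, f2]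
      ring
    rw [f4]
    refine mul_le_mul_of_nonneg_left ?_ hpow.le
    have g1 : X - X₂ ≤ 1 - (1 - X) / (1 - X₂) := by
      rw [le_sub_comm, div_le_iff₀ (by linarith)]
      have g0 := mul_nonneg (sub_nonneg.2 hX2X) hX20.le
      linarith only [g0]
    have g2 : 1 - (1 - X₃) / (1 + 2 * X₃) ≤ 3 * X₃ := by
      rw [sub_le_comm, le_div_iff₀ (by linarith)]
      have g0 := mul_pos hX30 hX30
      linarith only [g0]
    have g3 : X - X₂ = t / 200 * Q := by rw [hX, hX₂, hx, hx₂]; ring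
    have g4 : X₃ = 103 / 200 * (t * Q) := by rw [hX₃, hx₃]; ring
    have g5 := mul_le_mul_of_nonneg_left hQ0 ht0.le
    linarith
  have hfin := hval.trans key
  rw [mul_assoc] at hfin
  have hfin2 := le_of_mul_le_mul_left hfin hpow
  rw [Real.exp_neg, ← hB, ← div_eq_mul_inv, div_le_iff₀ (by positivity)]
  linarith

end SurvivalLower

/-! ### Asymptotic lower bound, far tail and mean component size. -/

section Asymptotics

theorem exp_neg_seven_le : Real.exp (-7) ≤ 1 / 1000 := by
  rw [Real.exp_neg, inv_le_comm₀ (Real.exp_pos _) (by norm_num), one_div, inv_inv]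
  have h2 : (2.7 : ℝ) ≤ Real.exp 1 := by linarith [Real.exp_one_gt_d9]
  have h3 := pow_le_pow_left₀ (by norm_num) h2 7
  rw [← Real.exp_nat_mul] at h3
  norm_num at h3 ⊢
  linarith

/-- Here T = nt³/8 with t = S/n is close to L³/9, and t is at least 1/r = exp(-L³/3). The exponent
is admissible because 1/3 + 1.0825 · 1.0091/9 < 11/24; the factor 1.0091 pays for rounding S up. -/
theorem survival_eventually_ge {b : ℝ} (hb0 : 0 < b) (hb : b ^ 3 = 8 / 9) :
    ∀ᶠ n : ℕ in atTop, Real.exp (-(11 / 24) * cbrtLog n ^ 3) ≤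
      survival (1 / n) ⌈b * (cbrt n ^ 2 * cbrtLog n)⌉₊ 1 (n - 1) := by
  have hb1 : b ≤ 1 := by
    by_contra hcon
    have := pow_lt_pow_left₀ (not_le.1 hcon) (by norm_num) three_ne_zero
    norm_num [hb] at this
  have hb2 : 1 / 2 ≤ b := by
    by_contra hcon
    have := pow_lt_pow_left₀ (not_le.1 hcon) hb0.le three_ne_zero
    norm_num [hb] at this
  have hev := (((eventually_mul_pow_le_exp (by norm_num : (0 : ℝ) < 1 / 3) 9 4).and
    (eventually_mul_pow_le_exp (by norm_num : (0 : ℝ) < 1 / 3) 201 1)).and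
    (eventually_mul_pow_le_exp (by norm_num : (0 : ℝ) < 1 / 3) 1000 0)).and
    (eventually_ge_atTop 100)
  filter_upwards [tendsto_cbrtLog.eventually hev, eventually_ge_atTop 64] with n hn hn64
  obtain ⟨⟨⟨hr4, hr1⟩, hr0⟩, hL⟩ := hn
  have hn0 : n ≠ 0 := by omega
  have hr := cbrt_eq_exp hn0
  have hr3 := cbrt_pow_three n
  have hrpos := cbrt_pos hn0
  set r := cbrt n with hrdef
  set L := cbrtLog n with hLdef
  rw [show 1 / 3 * L ^ 3 = L ^ 3 / 3 by ring, ← hr] at hr4 hr1 hr0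
  rw [pow_zero, mul_one] at hr0
  rw [pow_one] at hr1
  have hA0 : 0 ≤ r ^ 2 * L := by positivity
  set S := ⌈b * (r ^ 2 * L)⌉₊ with hS
  have hSl : b * (r ^ 2 * L) ≤ S := Nat.le_ceil _
  have hr2 : 1000 ^ 2 ≤ r ^ 2 := pow_le_pow_left₀ (by norm_num) hr0 2
  have hbL : 50 ≤ b * L := by
    have := mul_le_mul hb2 hL (by norm_num) hb0.le
    linarith
  have hrL : r ^ 2 * 50 ≤ b * (r ^ 2 * L) := by
    have := mul_le_mul_of_nonneg_left hbL (sq_nonneg r)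
    linarith
  have hSu : (S : ℝ) ≤ 1.003 * (b * (r ^ 2 * L)) := by
    have := (Nat.ceil_lt_add_one (by positivity : 0 ≤ b * (r ^ 2 * L))).le
    linarith
  have hnpos : (0 : ℝ) < n := by positivity
  have htl : b * L / r ≤ (S : ℝ) / n := by
    rw [← hr3, div_le_div_iff₀ hrpos (by positivity)]
    have := mul_le_mul_of_nonneg_right hSl hrpos.le
    linarith
  have htu : (S : ℝ) / n ≤ 1.003 * b * L / r := by
    rw [← hr3, div_le_div_iff₀ (by positivity) hrpos]
    have := mul_le_mul_of_nonneg_right hSu hrpos.le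
    linarith
  have hbLu : 1.003 * b * L ≤ 1.003 * L := by
    have := mul_le_mul_of_nonneg_right hb1 (by linarith : 0 ≤ L)
    linarith
  have c1 : n ≤ S ^ 2 := by
    have : (n : ℝ) ≤ S ^ 2 := by
      rw [← hr3]
      calc r ^ 3 ≤ (r ^ 2) ^ 2 := by
            rw [← pow_mul]; exact pow_le_pow_right₀ (by linarith) (by norm_num)
        _ ≤ _ := pow_le_pow_left₀ (by positivity) (by linarith [sq_nonneg r]) 2
    exact_mod_cast this
  have c2 : 200 * S ≤ n := by
    have : (200 : ℝ) * S ≤ n := by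
      rw [← hr3]
      have h1 := mul_le_mul_of_nonneg_left hr1 (sq_nonneg r)
      have h2 := mul_le_mul_of_nonneg_left hbLu (sq_nonneg r)
      have e : r ^ 3 = r ^ 2 * r := by ring
      linarith
    exact_mod_cast this
  have c0 : 0 < S := by
    have : (0 : ℝ) < S := by linarith [sq_nonneg r]
    exact_mod_cast this
  have htl0 : 0 ≤ b * L / r := by positivity
  have hTu : n * (S / n : ℝ) ^ 3 / 8 ≤ 1.0091 * L ^ 3 / 9 := by
    have h1 := pow_le_pow_left₀ (by positivity) htu 3
    have h2 := mul_le_mul_of_nonneg_left h1 hnpos.le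
    have e : (n : ℝ) * (1.003 * b * L / r) ^ 3 = 1.003 ^ 3 * b ^ 3 * L ^ 3 := by
      rw [← hr3]; field_simp
    rw [e, hb] at h2
    have : 0 ≤ L ^ 3 := by positivity
    norm_num at h2
    linarith
  have hTl : L ^ 3 / 9 ≤ n * (S / n : ℝ) ^ 3 / 8 := by
    have h1 := pow_le_pow_left₀ htl0 htl 3
    have h2 := mul_le_mul_of_nonneg_left h1 hnpos.le
    have e : (n : ℝ) * (b * L / r) ^ 3 = b ^ 3 * L ^ 3 := by
      rw [← hr3]; field_simp
    rw [e, hb] at h2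
    linarith
  have hL3 : 100 ^ 3 ≤ L ^ 3 := pow_le_pow_left₀ (by norm_num) hL 3
  have herr : 8 * n * (S / n : ℝ) ^ 4 ≤ 1 := by
    have h1 : (S / n : ℝ) ^ 4 ≤ (1.003 * L / r) ^ 4 := by
      refine pow_le_pow_left₀ (by positivity) (htu.trans ?_) 4
      exact div_le_div_of_nonneg_right hbLu hrpos.le
    have h2 := mul_le_mul_of_nonneg_left h1 (by positivity : (0 : ℝ) ≤ 8 * n)
    refine h2.trans ?_
    have e : 8 * (n : ℝ) * (1.003 * L / r) ^ 4 = 8 * 1.003 ^ 4 * L ^ 4 / r := by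
      rw [← hr3]; field_simp
    rw [e, div_le_one hrpos]
    have : 0 ≤ L ^ 4 := by positivity
    norm_num
    linarith
  refine le_trans ?_ (survival_lower c1 c2 c0 herr (by linarith))
  set T := n * (S / n : ℝ) ^ 3 / 8
  have ht : Real.exp (-(L ^ 3 / 3)) ≤ S / n := by
    rw [Real.exp_neg, ← hr]
    refine le_trans ?_ htl
    rw [inv_eq_one_div]
    exact div_le_div_of_nonneg_right (by linarith) hrpos.le
  calc Real.exp (-(11 / 24) * L ^ 3) ≤
        Real.exp (-(L ^ 3 / 3)) * Real.exp (-7) * Real.exp (-(1.0825 * T + 2)) := by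
        rw [← Real.exp_add, ← Real.exp_add, Real.exp_le_exp]
        linarith
    _ ≤ S / n * (1 / 1000) * Real.exp (-(1.0825 * T + 2)) := by
        gcongr
        exact exp_neg_seven_le
    _ = _ := by ring

/-- At size r²L³ the cubic exponent is of order L⁹, far more than the 2L³ required. This truncation
bounds the mean component size and the second moment at a single time. -/
theorem survival_eventually_tail :
    ∀ᶠ n : ℕ in atTop, survival (1 / n) ⌊cbrt n ^ 2 * cbrtLog n ^ 3⌋₊ 1 (n - 1) ≤ 1 / n ^ 2 := by
  have hev := ((eventually_mul_pow_le_exp (by norm_num : (0 : ℝ) < 1 / 3) 4 12).and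
    (eventually_mul_pow_le_exp (by norm_num : (0 : ℝ) < 1 / 3) 8 3)).and
    (eventually_ge_atTop 4)
  filter_upwards [tendsto_cbrtLog.eventually hev, eventually_ge_atTop 64] with n hn hn64
  obtain ⟨⟨hr12, hr3'⟩, hL⟩ := hn
  have hn0 : n ≠ 0 := by omega
  have hr := cbrt_eq_exp hn0
  have hr3 := cbrt_pow_three n
  have hrpos := cbrt_pos hn0
  set r := cbrt n with hrdef
  set L := cbrtLog n with hLdef
  rw [show 1 / 3 * L ^ 3 = L ^ 3 / 3 by ring, ← hr] at hr12 hr3'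
  have hL3 : 64 ≤ L ^ 3 := (pow_le_pow_left₀ (by norm_num) hL 3).trans' (by norm_num)
  have hr1 : 1 ≤ r := by linarith
  have hr2 : 1 ≤ r ^ 2 := one_le_pow₀ hr1
  have hA : 64 * r ^ 2 ≤ r ^ 2 * L ^ 3 := by
    have := mul_le_mul_of_nonneg_left hL3 (sq_nonneg r); linarith
  set s := ⌊r ^ 2 * L ^ 3⌋₊ with hs
  have hsu : (s : ℝ) ≤ r ^ 2 * L ^ 3 := Nat.floor_le (by positivity)
  have hsl : r ^ 2 * L ^ 3 / 2 ≤ s := by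
    have := Nat.lt_floor_add_one (r ^ 2 * L ^ 3)
    linarith
  have hnpos : (0 : ℝ) < n := by positivity
  have c1 : n ≤ s ^ 2 := by
    have : (n : ℝ) ≤ s ^ 2 := by
      rw [← hr3]
      calc r ^ 3 ≤ (r ^ 2) ^ 2 := by
            rw [← pow_mul]; exact pow_le_pow_right₀ hr1 (by norm_num)
        _ ≤ _ := pow_le_pow_left₀ (by positivity) (by linarith) 2
    exact_mod_cast this
  have c2 : 8 * s ≤ n := by
    have : (8 : ℝ) * s ≤ n := by
      rw [← hr3]
      have h1 := mul_le_mul_of_nonneg_left hr3' (sq_nonneg r)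
      have e : r ^ 3 = r ^ 2 * r := by ring
      linarith
    exact_mod_cast this
  have c0 : 0 < s := by
    have : (0 : ℝ) < s := by linarith
    exact_mod_cast this
  refine (survival_le_exp (l := 0) le_rfl (by norm_num) (by positivity) (by simp) c1 c2 c0).trans ?_
  have d1 : L ^ 9 / 64 ≤ (s : ℝ) ^ 3 / (8 * n ^ 2) := by
    rw [div_le_div_iff₀ (by norm_num) (by positivity), ← hr3]
    have := pow_le_pow_left₀ (by positivity) hsl 3
    have e : (r ^ 2 * L ^ 3 / 2) ^ 3 = L ^ 9 * (r ^ 3) ^ 2 / 8 := by ring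
    linarith
  have d3 : 4 * (s : ℝ) ^ 4 / n ^ 3 ≤ 1 := by
    rw [div_le_one (by positivity), ← hr3]
    have := pow_le_pow_left₀ (by positivity) hsu 4
    have e : (r ^ 2 * L ^ 3) ^ 4 * 4 = r ^ 8 * (4 * L ^ 12) := by ring
    have h5 := mul_le_mul_of_nonneg_left hr12 (by positivity : 0 ≤ r ^ 8)
    have e2 : (r ^ 3) ^ 3 = r ^ 8 * r := by ring
    linarith
  have d9 : 4096 * L ^ 3 ≤ L ^ 9 := by
    have := pow_le_pow_left₀ (by norm_num) hL3 2
    have h2 := mul_le_mul_of_nonneg_right this (by linarith : 0 ≤ L ^ 3)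
    have e : (L ^ 3) ^ 2 * L ^ 3 = L ^ 9 := by ring
    linarith
  have hn2 : 1 / (n : ℝ) ^ 2 = Real.exp (-(2 * L ^ 3)) := by
    rw [← hr3, hr, ← Real.exp_nat_mul, ← Real.exp_nat_mul, Real.exp_neg, one_div]
    congr 2; push_cast; ring
  have h2e : (2 : ℝ) ≤ Real.exp 1 := by linarith [Real.add_one_le_exp (1 : ℝ)]
  rw [hn2]
  refine (mul_le_mul_of_nonneg_right h2e (Real.exp_pos _).le).trans ?_
  rw [← Real.exp_add, Real.exp_le_exp]
  rw [zero_mul, zero_div]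
  linarith

theorem sum_inv_sqrt_le (K : ℕ) : ∑ s ∈ Finset.range K, 1 / √(s + 1 : ℝ) ≤ 2 * √K := by
  induction K with
  | zero => simp
  | succ K ih =>
    rw [Finset.sum_range_succ]
    have h1 : 0 < √(K + 1 : ℝ) := Real.sqrt_pos.2 (by positivity)
    have h2 := Real.sqrt_nonneg (K : ℝ)
    have h3 := Real.sq_sqrt (by positivity : (0 : ℝ) ≤ K + 1)
    have h4 := Real.sq_sqrt (by positivity : (0 : ℝ) ≤ K)
    have h5 : 1 / √(K + 1 : ℝ) ≤ 2 * (√(K + 1) - √K) := by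
      rw [div_le_iff₀ h1]
      nlinarith [sq_nonneg (√(K + 1 : ℝ) - √K)]
    push_cast
    linarith

/-- The sum is the expected size of a component. The bound 8/√(s+1) summed up to r²L³ gives order r
L^(3/2), and the rest is negligible. -/
theorem sum_survival_eventually_le :
    ∀ᶠ n : ℕ in atTop, ∑ s ∈ Finset.range n, survival (1 / n) s 1 (n - 1) ≤
      17 * (cbrt n * cbrtLog n ^ 2) := by
  filter_upwards [survival_eventually_tail, tendsto_cbrtLog.eventually (eventually_ge_atTop 1),
    eventually_ge_atTop 64] with n htail hL hn64
  have hn0 : n ≠ 0 := by omega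
  have hr := cbrt_eq_exp hn0
  have hrpos := cbrt_pos hn0
  have hn64' : (64 : ℝ) ≤ n := by exact_mod_cast hn64
  set r := cbrt n
  set L := cbrtLog n
  set K := ⌊r ^ 2 * L ^ 3⌋₊ with hK
  have hp0 : (0 : ℝ) ≤ 1 / n := by positivity
  have hp1 : (1 : ℝ) / n ≤ 1 := by rw [div_le_one (by linarith)]; linarith
  have hterm : ∀ s ∈ Finset.range n, survival (1 / n) s 1 (n - 1) ≤
      (if s < K then 8 * (1 / √(s + 1 : ℝ)) else 0) + 1 / n ^ 2 := by
    intro s _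
    split_ifs with h
    · have := survival_le_sqrt hp0 hp1 hn64 (l := 0) le_rfl (by norm_num) (by simp) s (n - 1)
        (by omega)
      have h2 : (0 : ℝ) ≤ 1 / n ^ 2 := by positivity
      rw [mul_one_div]; linarith
    · rw [zero_add]
      exact (survival_anti hp0 hp1 1 (n - 1) (not_lt.1 h)).trans htail
  refine (Finset.sum_le_sum hterm).trans ?_
  rw [Finset.sum_add_distrib]
  have h1 : ∑ s ∈ Finset.range n, (if s < K then 8 * (1 / √(s + 1 : ℝ)) else 0) ≤ 16 * √K := by
    rw [← Finset.sum_filter]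
    have : (Finset.range n).filter (fun s => s < K) ⊆ Finset.range K := fun s hs =>
      Finset.mem_range.2 (Finset.mem_filter.1 hs).2
    refine (Finset.sum_le_sum_of_subset_of_nonneg this fun _ _ _ => by positivity).trans ?_
    rw [← Finset.mul_sum]
    linarith [sum_inv_sqrt_le K]
  have h2 : √(K : ℝ) ≤ r * L ^ 2 := by
    rw [Real.sqrt_le_left (by positivity)]
    refine (Nat.floor_le (by positivity)).trans ?_
    rw [mul_pow, ← pow_mul]
    exact mul_le_mul_of_nonneg_left (pow_le_pow_right₀ hL (by norm_num)) (by positivity)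
  have h3 : ∑ s ∈ Finset.range n, (1 : ℝ) / n ^ 2 ≤ 1 := by
    rw [Finset.sum_const, Finset.card_range, nsmul_eq_mul, mul_one_div, div_le_one (by positivity)]
    nlinarith
  have h4 : 1 ≤ r * L ^ 2 := by
    have hr1 : 1 ≤ r := by rw [hr]; exact Real.one_le_exp (by positivity)
    exact one_le_mul_of_one_le_of_one_le hr1 (one_le_pow₀ hL)
  linarith

end Asymptotics

noncomputable section

/-! ### The Poisson clock of one edge -/

instance isProbabilityMeasure_expMeasure_one : IsProbabilityMeasure (expMeasure 1) :=
  isProbabilityMeasure_expMeasure one_pos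

/-- The law of the waiting times of a rate-one Poisson clock. -/
def clockLaw : Measure (ℕ → ℝ) := Measure.infinitePi fun _ : ℕ => expMeasure 1

instance : IsProbabilityMeasure clockLaw := by unfold clockLaw; infer_instance

/-- The time of the `k`-th ring, counted from `k = 1`. -/
def ringTime (k : ℕ) (τ : ℕ → ℝ) : ℝ := ∑ i ∈ Finset.range k, τ i

@[fun_prop]
lemma measurable_ringTime (k : ℕ) : Measurable (ringTime k) := by
  unfold ringTime; fun_prop

lemma ringTime_zero (τ : ℕ → ℝ) : ringTime 0 τ = 0 := by simp [ringTime]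

lemma ringTime_succ (k : ℕ) (τ : ℕ → ℝ) : ringTime (k + 1) τ = ringTime k τ + τ k := by
  simp [ringTime, Finset.sum_range_succ]

lemma expMeasure_Iic {r : ℝ} (hr : 0 ≤ r) :
    expMeasure 1 (Set.Iic r) = ENNReal.ofReal (1 - Real.exp (-r)) := by
  have h := cdf_expMeasure_eq (r := 1) one_pos r
  rw [cdf_eq_real, if_pos hr, one_mul] at h
  rw [← h, ofReal_measureReal]

lemma expMeasure_Ioi {r : ℝ} (hr : 0 ≤ r) :
    expMeasure 1 (Set.Ioi r) = ENNReal.ofReal (Real.exp (-r)) := by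
  have h := prob_compl_eq_one_sub (μ := expMeasure 1) (measurableSet_Iic (a := r))
  rw [Set.compl_Iic, expMeasure_Iic hr] at h
  rw [h, ← ENNReal.ofReal_one, ← ENNReal.ofReal_sub]
  · congr 1; ring
  · have : Real.exp (-r) ≤ 1 := Real.exp_le_one_iff.2 (by linarith)
    linarith

lemma clockLaw_ringTime_mem (k : ℕ) {A : Set (ℝ × ℝ)} (hA : MeasurableSet A) :
    clockLaw {τ | (ringTime k τ, τ k) ∈ A} =
      ∫⁻ x, expMeasure 1 {y | (x, y) ∈ A} ∂(clockLaw.map (ringTime k)) := by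
  have hind : iIndepFun (fun (i : ℕ) (τ : ℕ → ℝ) => τ i) clockLaw :=
    iIndepFun_infinitePi (P := fun _ : ℕ => expMeasure 1) (X := fun _ x => x) (by fun_prop)
  have h2 : IndepFun (ringTime k) (fun τ : ℕ → ℝ => τ k) clockLaw := by
    have := hind.indepFun_finsetSum_of_notMem (fun i => by fun_prop)
      (Finset.notMem_range_self (n := k))
    convert this using 1
    ext τ
    simp [ringTime]
  have h3 := (indepFun_iff_map_prod_eq_prod_map_map (by fun_prop) (measurable_pi_apply k).aemeasurable).1 h2
  have h4 : clockLaw.map (fun τ : ℕ → ℝ => τ k) = expMeasure 1 :=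
    Measure.infinitePi_map_eval (fun _ : ℕ => expMeasure 1) k
  rw [h4] at h3
  have h5 : clockLaw {τ | (ringTime k τ, τ k) ∈ A} =
      clockLaw.map (fun τ => (ringTime k τ, τ k)) A := by
    rw [Measure.map_apply (by fun_prop) hA]; rfl
  rw [h5, h3, Measure.prod_apply hA]
  rfl

lemma clockLaw_ae_pos : ∀ᵐ τ ∂clockLaw, ∀ i, 0 < τ i := by
  rw [ae_all_iff]
  intro i
  have h4 : clockLaw.map (fun τ : ℕ → ℝ => τ i) = expMeasure 1 :=
    Measure.infinitePi_map_eval (fun _ : ℕ => expMeasure 1) i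
  have : ∀ᵐ x ∂(clockLaw.map (fun τ : ℕ → ℝ => τ i)), 0 < x := by
    rw [h4, ae_iff]
    have : {a : ℝ | ¬ 0 < a} = Set.Iic 0 := by ext; simp
    rw [this, expMeasure_Iic le_rfl]; simp
  exact ae_of_ae_map (measurable_pi_apply i).aemeasurable this

/-- The probability that the clock rings exactly `k` times before time `s` and then not until
after time `t`. -/
lemma clockLaw_gap (k : ℕ) {s t : ℝ} (hst : s ≤ t) :
    clockLaw {τ | ringTime k τ ≤ s ∧ t < ringTime (k + 1) τ} =
      ENNReal.ofReal (Real.exp (-(t - s))) *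
        clockLaw {τ | ringTime k τ ≤ s ∧ s < ringTime (k + 1) τ} := by
  have key : ∀ r, s ≤ r → clockLaw {τ | ringTime k τ ≤ s ∧ r < ringTime (k + 1) τ} =
      ∫⁻ x in Set.Iic s, ENNReal.ofReal (Real.exp (-(r - x))) ∂(clockLaw.map (ringTime k)) := by
    intro r hr
    have hA : MeasurableSet {z : ℝ × ℝ | z.1 ≤ s ∧ r < z.1 + z.2} := by
      measurability
    have := clockLaw_ringTime_mem k hA
    simp only [Set.mem_ofPred_eq] at this
    simp only [ringTime_succ]
    rw [this, ← lintegral_indicator measurableSet_Iic]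
    refine lintegral_congr fun x => ?_
    by_cases hx : x ≤ s
    · rw [Set.indicator_of_mem (by exact hx), ← expMeasure_Ioi (by linarith)]
      congr 1
      ext y
      simp only [hx, true_and, Set.mem_ofPred_eq, Set.mem_Ioi]
      constructor <;> intro h <;> linarith
    · rw [Set.indicator_of_notMem (by exact hx)]
      simp [hx]
  rw [key t hst, key s le_rfl, ← lintegral_const_mul _ (by fun_prop)]
  refine lintegral_congr fun x => ?_
  rw [← ENNReal.ofReal_mul (Real.exp_pos _).le, ← Real.exp_add]
  congr 2; ring

lemma tsum_clockLaw_gap_le (s : ℝ) :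
    ∑' k, clockLaw {τ | ringTime k τ ≤ s ∧ s < ringTime (k + 1) τ} ≤ 1 := by
  have hmeas : ∀ k, MeasurableSet {τ : ℕ → ℝ | ringTime k τ ≤ s ∧ s < ringTime (k + 1) τ} :=
    fun k => by measurability
  rw [← measure_iUnion₀ _ (fun k => (hmeas k).nullMeasurableSet)]
  · exact prob_le_one
  · intro j k hjk
    rw [Function.onFun, AEDisjoint]
    have hmono : ∀ᵐ τ ∂clockLaw, Monotone fun k => ringTime k τ := by
      filter_upwards [clockLaw_ae_pos] with τ hτ
      exact monotone_nat_of_le_succ fun i => by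
        have := hτ i; rw [ringTime_succ]; linarith
    refine measure_mono_null (t := {τ | ¬ Monotone fun k => ringTime k τ}) ?_ (ae_iff.1 hmono)
    rintro τ ⟨⟨h1, h2⟩, h3, h4⟩ hm
    rcases lt_or_gt_of_ne hjk with h | h
    · have := hm (Nat.succ_le_of_lt h); simp only [Nat.succ_eq_add_one] at this; linarith
    · have := hm (Nat.succ_le_of_lt h); simp only [Nat.succ_eq_add_one] at this; linarith

/-- A ring in the window either is the first one after s, where the exponential law has no memory,
or follows within δ a previous ring that already lies in the window. Summed over k this becomes a
closed inequality for the expected number of rings, and the law of `ringTime` is never computed. -/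
lemma clockLaw_ring_succ_le (k : ℕ) {s δ : ℝ} (hδ : 0 ≤ δ) :
    clockLaw {τ | s < ringTime (k + 1) τ ∧ ringTime (k + 1) τ ≤ s + δ} ≤
      ENNReal.ofReal (1 - Real.exp (-δ)) *
        (clockLaw {τ | ringTime k τ ≤ s ∧ s < ringTime (k + 1) τ} +
          clockLaw {τ | s < ringTime k τ ∧ ringTime k τ ≤ s + δ}) := by
  set d := ENNReal.ofReal (1 - Real.exp (-δ)) with hd
  have hsub : {τ : ℕ → ℝ | s < ringTime (k + 1) τ ∧ ringTime (k + 1) τ ≤ s + δ} ≤ᵐ[clockLaw]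
      ({τ | ringTime k τ ≤ s ∧ s < ringTime (k + 1) τ ∧ ringTime (k + 1) τ ≤ s + δ} ∪
        {τ | (s < ringTime k τ ∧ ringTime k τ ≤ s + δ) ∧ τ k ≤ δ} : Set (ℕ → ℝ)) := by
    filter_upwards [clockLaw_ae_pos] with τ hτ h
    have h1 : s < ringTime (k + 1) τ := h.1
    have h2 : ringTime (k + 1) τ ≤ s + δ := h.2
    by_cases hk : ringTime k τ ≤ s
    · exact Or.inl ⟨hk, h1, h2⟩
    · push Not at hk
      have := hτ k
      rw [ringTime_succ] at h2
      exact Or.inr ⟨⟨hk, by linarith⟩, by linarith⟩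
  refine (measure_mono_ae hsub).trans ((measure_union_le _ _).trans ?_)
  rw [mul_add]
  refine add_le_add ?_ ?_
  · -- a single exponential waiting time, by the lack of memory
    have hA : MeasurableSet {z : ℝ × ℝ | z.1 ≤ s ∧ s < z.1 + z.2 ∧ z.1 + z.2 ≤ s + δ} := by
      measurability
    have hB : MeasurableSet {z : ℝ × ℝ | z.1 ≤ s ∧ s < z.1 + z.2} := by
      measurability
    have e1 := clockLaw_ringTime_mem k hA
    have e2 := clockLaw_ringTime_mem k hB
    simp only [Set.mem_ofPred_eq] at e1 e2
    simp only [ringTime_succ]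
    have hBm : Measurable fun x => expMeasure 1 {y | x ≤ s ∧ s < x + y} :=
      measurable_measure_prodMk_left hB
    rw [e1, e2, ← lintegral_const_mul _ hBm]
    refine lintegral_mono fun x => ?_
    by_cases hx : x ≤ s
    · have hI : {y | x ≤ s ∧ s < x + y} = Set.Ioi (s - x) := by
        ext y; simp only [hx, true_and, Set.mem_ofPred_eq, Set.mem_Ioi]
        constructor <;> intro h <;> linarith
      have hJ : {y | x ≤ s ∧ s < x + y ∧ x + y ≤ s + δ} =
          Set.Ioi (s - x) \ Set.Ioi (s + δ - x) := by
        ext y; simp only [hx, true_and, Set.mem_ofPred_eq, Set.mem_Ioi, Set.mem_sdiff, not_lt]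
        constructor <;> rintro ⟨h, h'⟩ <;> constructor <;> linarith
      change expMeasure 1 {y | x ≤ s ∧ s < x + y ∧ x + y ≤ s + δ} ≤
        d * expMeasure 1 {y | x ≤ s ∧ s < x + y}
      rw [hI, hJ, measure_sdiff (Set.Ioi_subset_Ioi (by linarith))
        measurableSet_Ioi.nullMeasurableSet (measure_ne_top _ _),
        expMeasure_Ioi (by linarith), expMeasure_Ioi (by linarith), hd,
        ← ENNReal.ofReal_sub _ (Real.exp_pos _).le, ← ENNReal.ofReal_mul]
      · apply ENNReal.ofReal_le_ofReal
        have : Real.exp (-(s + δ - x)) = Real.exp (-δ) * Real.exp (-(s - x)) := by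
          rw [← Real.exp_add]; congr 1; ring
        rw [this]; linarith
      · have : Real.exp (-δ) ≤ 1 := Real.exp_le_one_iff.2 (by linarith)
        linarith
    · simp [hx]
  · have hA : MeasurableSet {z : ℝ × ℝ | (s < z.1 ∧ z.1 ≤ s + δ) ∧ z.2 ≤ δ} := by
      measurability
    have hB : MeasurableSet {z : ℝ | s < z ∧ z ≤ s + δ} := by
      measurability
    have e1 := clockLaw_ringTime_mem k hA
    simp only [Set.mem_ofPred_eq] at e1
    rw [e1]
    have e2 : clockLaw {τ | s < ringTime k τ ∧ ringTime k τ ≤ s + δ} =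
        clockLaw.map (ringTime k) {z : ℝ | s < z ∧ z ≤ s + δ} := by
      rw [Measure.map_apply (by fun_prop) hB]; rfl
    rw [e2, ← lintegral_indicator_const hB]
    refine lintegral_mono fun x => ?_
    by_cases hx : s < x ∧ x ≤ s + δ
    · rw [Set.indicator_of_mem (by exact hx), hd, ← expMeasure_Iic hδ]
      exact measure_mono fun y hy => hy.2
    · simp [hx]

/-- The expected number of rings in a short time interval. -/
lemma tsum_clockLaw_ring_le {s δ : ℝ} (hs : 0 ≤ s) (hδ : 0 ≤ δ) :
    ∑' k, clockLaw {τ | s < ringTime (k + 1) τ ∧ ringTime (k + 1) τ ≤ s + δ} ≤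
      ENNReal.ofReal (Real.exp δ - 1) := by
  set a : ℕ → ℝ := fun k => clockLaw.real {τ | s < ringTime k τ ∧ ringTime k τ ≤ s + δ} with ha
  set c : ℕ → ENNReal :=
    fun k => clockLaw {τ | ringTime k τ ≤ s ∧ s < ringTime (k + 1) τ} with hc
  have hd0 : 0 ≤ 1 - Real.exp (-δ) := by
    have : Real.exp (-δ) ≤ 1 := Real.exp_le_one_iff.2 (by linarith)
    linarith
  have ha0 : a 0 = 0 := by
    simp only [ha, ringTime_zero]
    simp [hs.not_gt]
  have hcs : ∀ N, ∑ k ∈ Finset.range N, (c k).toReal ≤ 1 := by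
    intro N
    rw [← ENNReal.toReal_sum (fun k _ => measure_ne_top _ _)]
    refine ENNReal.toReal_le_of_le_ofReal zero_le_one ?_
    rw [ENNReal.ofReal_one]
    exact (ENNReal.sum_le_tsum _).trans (tsum_clockLaw_gap_le s)
  have hrec : ∀ k, a (k + 1) ≤ (1 - Real.exp (-δ)) * ((c k).toReal + a k) := by
    intro k
    have := ENNReal.toReal_mono (by finiteness) (clockLaw_ring_succ_le k (s := s) hδ)
    rwa [ENNReal.toReal_mul, ENNReal.toReal_ofReal hd0,
      ENNReal.toReal_add (measure_ne_top _ _) (measure_ne_top _ _)] at this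
  -- A partial sum A satisfies A ≤ (1 - e^(-δ))(1 + A); solving for A gives the bound. It exceeds
  -- the true mean δ, but only the order in δ matters.
  have hfin : ∀ N, ∑ k ∈ Finset.range N, a (k + 1) ≤ Real.exp δ - 1 := by
    intro N
    have h1 : ∑ k ∈ Finset.range N, a (k + 1) ≤
        (1 - Real.exp (-δ)) * (1 + ∑ k ∈ Finset.range N, a (k + 1)) := by
      calc _ ≤ ∑ k ∈ Finset.range N, (1 - Real.exp (-δ)) * ((c k).toReal + a k) :=
            Finset.sum_le_sum fun k _ => hrec k
        _ = (1 - Real.exp (-δ)) *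
            (∑ k ∈ Finset.range N, (c k).toReal + ∑ k ∈ Finset.range N, a k) := by
            rw [← Finset.mul_sum, Finset.sum_add_distrib]
        _ ≤ _ := by
            refine mul_le_mul_of_nonneg_left (add_le_add (hcs N) ?_) hd0
            have e1 := Finset.sum_range_succ a N
            have e2 := Finset.sum_range_succ' a N
            have : 0 ≤ a N := measureReal_nonneg
            linarith
    have h2 : Real.exp (-δ) * Real.exp δ = 1 := by rw [← Real.exp_add]; simp
    have h3 := Real.exp_pos δ
    nlinarith
  refine ENNReal.tsum_le_of_sum_range_le fun N => ?_
  have : ∑ k ∈ Finset.range N,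
      clockLaw {τ | s < ringTime (k + 1) τ ∧ ringTime (k + 1) τ ≤ s + δ} =
      ENNReal.ofReal (∑ k ∈ Finset.range N, a (k + 1)) := by
    rw [ENNReal.ofReal_sum_of_nonneg fun k _ => measureReal_nonneg]
    exact Finset.sum_congr rfl fun k _ => (ofReal_measureReal (measure_ne_top _ _)).symm
  rw [this]
  exact ENNReal.ofReal_le_ofReal (hfin N)

/-- The probabilities that the k-th ring falls in (0,1] are summable, hence tend to zero. This
excludes infinitely many rings by time 1, for which `Set.ncard` would return the default value 0 in
`ringCount`. -/
lemma clockLaw_ae_exists_lt : ∀ᵐ τ ∂clockLaw, ∃ k, 1 < ringTime k τ := by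
  have h := tsum_clockLaw_ring_le (s := 0) (δ := 1) le_rfl zero_le_one
  have ht := ENNReal.tendsto_atTop_zero_of_tsum_ne_top (ne_top_of_le_ne_top ENNReal.ofReal_ne_top h)
  have h0 : clockLaw {τ | ¬ ∃ k, 1 < ringTime k τ} ≤ 0 := by
    refine ge_of_tendsto' ht fun k => measure_mono_ae ?_
    filter_upwards [clockLaw_ae_pos] with τ hτ h
    have h' : ¬ ∃ k, 1 < ringTime k τ := h
    push Not at h'
    refine ⟨?_, by rw [zero_add]; exact h' (k + 1)⟩
    exact Finset.sum_pos (fun i _ => hτ i) ⟨0, by simp⟩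
  exact ae_iff.2 (le_antisymm h0 zero_le)

/-- On a regular clock, the `k`-th ring happens before `t` exactly if `k ≤ ringCount τ t`. -/
lemma ringTime_le_iff {τ : ℕ → ℝ} (h1 : ∀ i, 0 < τ i) (h2 : ∃ k, 1 < ringTime k τ) {t : ℝ}
    (h0t : 0 ≤ t) (ht : t ≤ 1) (k : ℕ) : ringTime k τ ≤ t ↔ k ≤ ringCount τ t := by
  classical
  have hmono : StrictMono fun k => ringTime k τ :=
    strictMono_nat_of_lt_succ fun i => by
      have := h1 i; rw [ringTime_succ]; linarith
  have h3 : ∃ k, t < ringTime k τ := h2.imp fun k hk => ht.trans_lt hk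
  set m := Nat.find h3 with hm
  have hm1 : t < ringTime m τ := Nat.find_spec h3
  have hiff : ∀ k, ringTime k τ ≤ t ↔ k < m := fun k => by
    constructor
    · intro h
      by_contra hcon
      push Not at hcon
      have : ringTime m τ ≤ ringTime k τ := hmono.monotone hcon
      linarith
    · intro h
      exact not_lt.1 (Nat.find_min h3 h)
  have hm0 : 0 < m := (hiff 0).1 (by rw [ringTime_zero]; exact h0t)
  have hcount : ringCount τ t = m - 1 := by
    have : {k : ℕ | ∑ i ∈ Finset.range (k + 1), τ i ≤ t} = Set.Iio (m - 1) := by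
      ext k
      change ringTime (k + 1) τ ≤ t ↔ k < m - 1
      rw [hiff]; omega
    rw [ringCount, this, ← Finset.coe_Iio, Set.ncard_coe_finset, Nat.card_Iio]
  rw [hiff, hcount]; omega

@[fun_prop]
lemma measurable_ringCount (t : ℝ) : Measurable fun τ => ringCount τ t := by
  unfold ringCount
  refine measurable_ncard.comp (measurable_set_iff.2 fun k => ?_)
  change Measurable fun τ : ℕ → ℝ => ringTime (k + 1) τ ≤ t
  exact measurableSet_setOfPred.1 (by measurability)

/-- The probability that a clock does not ring in `(s, t]`. -/
lemma clockLaw_ringCount_eq_le {s t : ℝ} (h0 : 0 ≤ s) (hst : s ≤ t) (ht : t ≤ 1) :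
    clockLaw.real {τ | ringCount τ s = ringCount τ t} ≤ Real.exp (-(t - s)) := by
  refine ENNReal.toReal_le_of_le_ofReal (Real.exp_pos _).le ?_
  calc clockLaw {τ | ringCount τ s = ringCount τ t}
      ≤ clockLaw (⋃ k, {τ | ringTime k τ ≤ s ∧ t < ringTime (k + 1) τ}) := by
        refine measure_mono_ae ?_
        filter_upwards [clockLaw_ae_pos, clockLaw_ae_exists_lt] with τ h1 h2 h
        have h' : ringCount τ s = ringCount τ t := h
        refine Set.mem_iUnion.2 ⟨ringCount τ s, ?_, ?_⟩
        · exact (ringTime_le_iff h1 h2 h0 (hst.trans ht) _).2 le_rfl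
        · rw [← not_le, ringTime_le_iff h1 h2 (h0.trans hst) ht]
          omega
    _ ≤ ∑' k, clockLaw {τ | ringTime k τ ≤ s ∧ t < ringTime (k + 1) τ} := measure_iUnion_le _
    _ ≤ ENNReal.ofReal (Real.exp (-(t - s))) * 1 := by
        simp_rw [clockLaw_gap _ hst]
        rw [ENNReal.tsum_mul_left]
        gcongr
        exact tsum_clockLaw_gap_le s
    _ = _ := mul_one _

end

noncomputable section

/-! ### The state of one edge -/

/-- The law of the initial state of an edge. -/
def coinLaw (n : ℕ) : Measure Bool := bernoulliMeasure true false (edgeProb n)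

/-- The law of the resampling outcomes of an edge. -/
def outcomeLaw (n : ℕ) : Measure (ℕ → Bool) := Measure.infinitePi fun _ : ℕ => coinLaw n

instance (n : ℕ) : IsProbabilityMeasure (coinLaw n) := by unfold coinLaw; infer_instance

instance (n : ℕ) : IsProbabilityMeasure (outcomeLaw n) := by unfold outcomeLaw; infer_instance

/-- The law of the initial state, the clock and the outcomes of one edge. -/
def edgeModel (n : ℕ) : Measure (Bool × EdgeSample) := (coinLaw n).prod (edgeLaw n)

lemma edgeLaw_eq (n : ℕ) : edgeLaw n = clockLaw.prod (outcomeLaw n) := rfl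

instance (n : ℕ) : IsProbabilityMeasure (edgeLaw n) := by rw [edgeLaw_eq]; infer_instance

instance (n : ℕ) : IsProbabilityMeasure (edgeModel n) := by unfold edgeModel; infer_instance

/-- Fubini with the clock outermost: given the clock, the ring counts are constants and only coin
outcomes remain random. -/
lemma edgeModel_apply (n : ℕ) {A : Set (Bool × EdgeSample)} (hA : MeasurableSet A) :
    edgeModel n A =
      ∫⁻ τ, ((coinLaw n).prod (outcomeLaw n)) {z | (z.1, τ, z.2) ∈ A} ∂clockLaw := by
  have hB : MeasurableSet {z : (Bool × (ℕ → ℝ)) × (ℕ → Bool) | (z.1.1, z.1.2, z.2) ∈ A} :=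
    (by fun_prop : Measurable fun z : (Bool × (ℕ → ℝ)) × (ℕ → Bool) =>
      ((z.1.1, z.1.2, z.2) : Bool × EdgeSample)) hA
  have hm : Measurable fun z : Bool × (ℕ → ℝ) => outcomeLaw n {o | (z.1, z.2, o) ∈ A} :=
    measurable_measure_prodMk_left hB
  rw [edgeModel, Measure.prod_apply hA]
  calc ∫⁻ b, edgeLaw n (Prod.mk b ⁻¹' A) ∂coinLaw n
      = ∫⁻ b, ∫⁻ τ, outcomeLaw n {o | (b, τ, o) ∈ A} ∂clockLaw ∂coinLaw n := by
        refine lintegral_congr fun b => ?_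
        rw [edgeLaw_eq, Measure.prod_apply (measurable_prodMk_left hA)]
        rfl
    _ = ∫⁻ τ, ∫⁻ b, outcomeLaw n {o | (b, τ, o) ∈ A} ∂coinLaw n ∂clockLaw :=
        lintegral_lintegral_swap hm.aemeasurable
    _ = _ := by
        refine lintegral_congr fun τ => ?_
        rw [Measure.prod_apply]
        · rfl
        · exact (by fun_prop : Measurable fun z : Bool × (ℕ → Bool) =>
            ((z.1, τ, z.2) : Bool × EdgeSample)) hA

/-- The state of an edge after `i` rings. -/
def stateAfter (z : Bool × (ℕ → Bool)) (i : ℕ) : Bool :=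
  match i with
  | 0 => z.1
  | k + 1 => z.2 k

/-- The state of an edge at time `t`. -/
def edgeState (t : ℝ) (x : Bool × EdgeSample) : Bool :=
  stateAfter (x.1, x.2.2) (ringCount x.2.1 t)

@[fun_prop]
lemma measurable_stateAfter (i : ℕ) : Measurable fun z => stateAfter z i := by
  cases i <;> simp only [stateAfter] <;> fun_prop

@[fun_prop]
lemma measurable_edgeState (t : ℝ) : Measurable (edgeState t) := by
  unfold edgeState
  have h : Measurable fun q : (Bool × (ℕ → Bool)) × ℕ => stateAfter q.1 q.2 :=
    measurable_from_prod_countable_left fun i => measurable_stateAfter i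
  exact h.comp (by fun_prop : Measurable fun x : Bool × EdgeSample =>
    ((x.1, x.2.2), ringCount x.2.1 t))

lemma coinLaw_singleton (n : ℕ) (α : Bool) :
    coinLaw n {α} = ENNReal.ofReal (bern (1 / n) α) := by
  have h : (coinLaw n).real {α} = bern (1 / n) α := by
    cases α
    · rw [coinLaw, bernoulliMeasure_real_apply_of_notMem_of_mem _ (measurableSet_singleton _)
        (by simp) (by simp)]
      simp [bern, edgeProb]
    · rw [coinLaw, bernoulliMeasure_real_apply_of_mem_of_notMem _ (measurableSet_singleton _)
        (by simp) (by simp)]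
      simp [bern, edgeProb]
  rw [← h, ofReal_measureReal]

lemma outcomeLaw_eval (n k : ℕ) (α : Bool) : outcomeLaw n {o | o k = α} = coinLaw n {α} := by
  have h := Measure.infinitePi_map_eval (fun _ : ℕ => coinLaw n) k
  conv_rhs => rw [← h]
  rw [Measure.map_apply (by fun_prop) (measurableSet_singleton α)]
  rfl

lemma outcomeLaw_eval_pair (n : ℕ) {k l : ℕ} (hkl : k ≠ l) (α α' : Bool) :
    outcomeLaw n {o | o k = α ∧ o l = α'} = coinLaw n {α} * coinLaw n {α'} := by
  classical
  have h := Measure.infinitePi_pi (fun _ : ℕ => coinLaw n) (s := {k, l})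
    (t := fun i => if i = k then {α} else {α'}) (fun i _ => MeasurableSet.of_discrete)
  rw [Finset.prod_pair hkl] at h
  simp only [if_true, if_neg hkl.symm] at h
  rw [← h, outcomeLaw]
  congr 1
  ext o
  simp [hkl.symm]

lemma stateAfter_law (n i : ℕ) (α : Bool) :
    ((coinLaw n).prod (outcomeLaw n)) {z | stateAfter z i = α} = coinLaw n {α} := by
  cases i with
  | zero =>
    have : {z : Bool × (ℕ → Bool) | stateAfter z 0 = α} = {α} ×ˢ Set.univ := by
      ext z; simp [stateAfter]
    rw [this, Measure.prod_prod, measure_univ, mul_one]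
  | succ k =>
    have : {z : Bool × (ℕ → Bool) | stateAfter z (k + 1) = α} =
        Set.univ ×ˢ {o | o k = α} := by
      ext z; simp [stateAfter]
    rw [this, Measure.prod_prod, measure_univ, one_mul, outcomeLaw_eval]

lemma stateAfter_law_pair (n : ℕ) {i j : ℕ} (hij : i ≠ j) (α α' : Bool) :
    ((coinLaw n).prod (outcomeLaw n)) {z | stateAfter z i = α ∧ stateAfter z j = α'} =
      coinLaw n {α} * coinLaw n {α'} := by
  cases i with
  | zero =>
    cases j with
    | zero => exact absurd rfl hij
    | succ l =>
      have : {z : Bool × (ℕ → Bool) | stateAfter z 0 = α ∧ stateAfter z (l + 1) = α'} =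
          {α} ×ˢ {o | o l = α'} := by
        ext z; simp [stateAfter]
      rw [this, Measure.prod_prod, outcomeLaw_eval]
  | succ k =>
    cases j with
    | zero =>
      have : {z : Bool × (ℕ → Bool) | stateAfter z (k + 1) = α ∧ stateAfter z 0 = α'} =
          {α'} ×ˢ {o | o k = α} := by
        ext z; simp [stateAfter, and_comm]
      rw [this, Measure.prod_prod, outcomeLaw_eval, mul_comm]
    | succ l =>
      have : {z : Bool × (ℕ → Bool) | stateAfter z (k + 1) = α ∧ stateAfter z (l + 1) = α'} =
          Set.univ ×ˢ {o | o k = α ∧ o l = α'} := by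
        ext z; simp [stateAfter]
      rw [this, Measure.prod_prod, measure_univ, one_mul,
        outcomeLaw_eval_pair n (fun h => hij (by rw [h]))]

lemma edgeProb_nonneg (n : ℕ) : 0 ≤ 1 / (n : ℝ) := (edgeProb n).2.1

lemma edgeProb_le_one (n : ℕ) : 1 / (n : ℝ) ≤ 1 := (edgeProb n).2.2

lemma edgeModel_state (n : ℕ) (t : ℝ) (α : Bool) :
    (edgeModel n).real {x | edgeState t x = α} = bern (1 / n) α := by
  have hA : MeasurableSet {x : Bool × EdgeSample | edgeState t x = α} :=
    measurable_edgeState t (measurableSet_singleton α)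
  have : edgeModel n {x | edgeState t x = α} = coinLaw n {α} := by
    rw [edgeModel_apply n hA]
    simp only [Set.mem_ofPred_eq, edgeState, stateAfter_law, lintegral_const, measure_univ, mul_one]
  rw [measureReal_def, this, coinLaw_singleton,
    ENNReal.toReal_ofReal (bern_nonneg (edgeProb_nonneg n) (edgeProb_le_one n) α)]

/-- The states of an edge at two times: with the probability that the clock does not ring in
between they agree, and otherwise they are independent. -/
lemma edgeModel_state_pair (n : ℕ) (s t : ℝ) (α α' : Bool) :
    (edgeModel n).real {x | edgeState s x = α ∧ edgeState t x = α'} =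
      bern (1 / n) α *
        noise (1 / n) (clockLaw.real {τ | ringCount τ s = ringCount τ t}) α α' := by
  have hA : MeasurableSet {x : Bool × EdgeSample | edgeState s x = α ∧ edgeState t x = α'} :=
    (measurable_edgeState s (measurableSet_singleton α)).inter
      (measurable_edgeState t (measurableSet_singleton α'))
  set R : Set (ℕ → ℝ) := {τ | ringCount τ s = ringCount τ t} with hR
  have hRm : MeasurableSet R := measurableSet_eq_fun (by fun_prop) (by fun_prop)
  have h0 := bern_nonneg (edgeProb_nonneg n) (edgeProb_le_one n)
  have hval : edgeModel n {x | edgeState s x = α ∧ edgeState t x = α'} =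
      (if α = α' then coinLaw n {α} else 0) * clockLaw R +
        coinLaw n {α} * coinLaw n {α'} * clockLaw Rᶜ := by
    rw [edgeModel_apply n hA, ← lintegral_indicator_const hRm,
      ← lintegral_indicator_const hRm.compl,
      ← lintegral_add_left (measurable_const.indicator hRm)]
    refine lintegral_congr fun τ => ?_
    by_cases hτ : τ ∈ R
    · rw [Set.indicator_of_mem hτ, Set.indicator_of_notMem (by simpa using hτ), add_zero]
      have hτ' : ringCount τ s = ringCount τ t := hτ
      simp only [Set.mem_ofPred_eq, edgeState, hτ']
      split_ifs with h
      · subst h; simp only [and_self, stateAfter_law]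
      · have : {z | stateAfter z (ringCount τ t) = α ∧ stateAfter z (ringCount τ t) = α'} = ∅ := by
          ext z
          simp only [Set.mem_ofPred_eq, Set.mem_empty_iff_false, iff_false]
          rintro ⟨h1, h2⟩
          exact h (h1.symm.trans h2)
        rw [this, measure_empty]
    · rw [Set.indicator_of_notMem hτ, Set.indicator_of_mem (by simpa using hτ), zero_add]
      have hτ' : ringCount τ s ≠ ringCount τ t := hτ
      simp only [Set.mem_ofPred_eq, edgeState]
      exact stateAfter_law_pair n hτ' α α'
  rw [measureReal_def, hval, ENNReal.toReal_add (by finiteness) (by finiteness), ENNReal.toReal_mul,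
    ENNReal.toReal_mul, ENNReal.toReal_mul, ← measureReal_def, ← measureReal_def (s := Rᶜ),
    probReal_compl_eq_one_sub hRm, noise]
  simp only [coinLaw_singleton, ENNReal.toReal_ofReal (h0 _)]
  split_ifs
  · rw [ENNReal.toReal_ofReal (h0 _)]; ring
  · simp; ring

/-- The edge is present at time `s`, or is placed at a ring in `(s, s + δ]`. -/
def everPresent (s δ : ℝ) : Set (Bool × EdgeSample) :=
  {x | edgeState s x = true} ∪
    ⋃ k, {x | (s < ringTime (k + 1) x.2.1 ∧ ringTime (k + 1) x.2.1 ≤ s + δ) ∧ x.2.2 k = true}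

lemma measurableSet_ring (s δ : ℝ) (k : ℕ) :
    MeasurableSet {τ : ℕ → ℝ | s < ringTime (k + 1) τ ∧ ringTime (k + 1) τ ≤ s + δ} := by
  measurability

lemma measurableSet_ring_true (s δ : ℝ) (k : ℕ) :
    MeasurableSet {x : Bool × EdgeSample |
      (s < ringTime (k + 1) x.2.1 ∧ ringTime (k + 1) x.2.1 ≤ s + δ) ∧ x.2.2 k = true} :=
  ((by fun_prop : Measurable fun x : Bool × EdgeSample => x.2.1) (measurableSet_ring s δ k)).inter
    ((by fun_prop : Measurable fun x : Bool × EdgeSample => x.2.2 k) (measurableSet_singleton true))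

lemma measurableSet_everPresent (s δ : ℝ) : MeasurableSet (everPresent s δ) :=
  (measurable_edgeState s (measurableSet_singleton true)).union
    (MeasurableSet.iUnion fun k => measurableSet_ring_true s δ k)

/-- The outcomes are independent of the clock, so each expected ring costs 1/n, and at most e^δ - 1
≤ 2δ rings are expected. -/
lemma edgeModel_everPresent_le (n : ℕ) {s δ : ℝ} (hs : 0 ≤ s) (h0 : 0 ≤ δ) (h1 : δ ≤ 1) :
    (edgeModel n).real (everPresent s δ) ≤ (1 + 2 * δ) / n := by
  have hk : ∀ k, edgeModel n {x |
      (s < ringTime (k + 1) x.2.1 ∧ ringTime (k + 1) x.2.1 ≤ s + δ) ∧ x.2.2 k = true} =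
      clockLaw {τ | s < ringTime (k + 1) τ ∧ ringTime (k + 1) τ ≤ s + δ} * coinLaw n {true} := by
    intro k
    have : {x : Bool × EdgeSample |
        (s < ringTime (k + 1) x.2.1 ∧ ringTime (k + 1) x.2.1 ≤ s + δ) ∧ x.2.2 k = true} =
        Set.univ ×ˢ ({τ | s < ringTime (k + 1) τ ∧ ringTime (k + 1) τ ≤ s + δ} ×ˢ
          {o | o k = true}) := by
      ext x; simp
    rw [this, edgeModel, Measure.prod_prod, edgeLaw_eq, Measure.prod_prod, measure_univ, one_mul,
      outcomeLaw_eval]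
  have hexp : Real.exp δ - 1 ≤ 2 * δ := by
    have := Real.abs_exp_sub_one_le (x := δ) (by rwa [abs_of_nonneg h0])
    rw [abs_of_nonneg h0] at this
    exact (le_abs_self _).trans this
  refine ENNReal.toReal_le_of_le_ofReal (by positivity) ?_
  calc edgeModel n (everPresent s δ)
      ≤ edgeModel n {x | edgeState s x = true} + ∑' k, edgeModel n {x |
        (s < ringTime (k + 1) x.2.1 ∧ ringTime (k + 1) x.2.1 ≤ s + δ) ∧ x.2.2 k = true} :=
        (measure_union_le _ _).trans (add_le_add le_rfl (measure_iUnion_le _))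
    _ ≤ ENNReal.ofReal (1 / n) + ENNReal.ofReal (2 * δ) * ENNReal.ofReal (1 / n) := by
        refine add_le_add ?_ ?_
        · rw [← ofReal_measureReal, edgeModel_state]; simp [bern]
        · simp_rw [hk]
          rw [ENNReal.tsum_mul_right, coinLaw_singleton]
          simp only [bern, if_true]
          gcongr
          exact (tsum_clockLaw_ring_le hs h0).trans (ENNReal.ofReal_le_ofReal hexp)
    _ = ENNReal.ofReal ((1 + 2 * δ) / n) := by
        rw [← ENNReal.ofReal_mul (by positivity), ← ENNReal.ofReal_add (by positivity)
          (by positivity)]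
        congr 1; ring

/-- Either the clock is silent in (s, t], or its last ring up to t lies in that interval and has
placed the edge. -/
lemma mem_everPresent {s δ t : ℝ} {x : Bool × EdgeSample} (h1 : ∀ i, 0 < x.2.1 i)
    (h2 : ∃ k, 1 < ringTime k x.2.1) (h0 : 0 ≤ s) (hst : s ≤ t) (hts : t ≤ s + δ) (ht : t ≤ 1)
    (h : edgeState t x = true) : x ∈ everPresent s δ := by
  have hS := ringTime_le_iff h1 h2 h0 (hst.trans ht)
  have hT := ringTime_le_iff h1 h2 (h0.trans hst) ht
  have hle : ringCount x.2.1 s ≤ ringCount x.2.1 t :=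
    (hT _).1 (((hS _).2 le_rfl).trans hst)
  by_cases heq : ringCount x.2.1 s = ringCount x.2.1 t
  · left
    change edgeState s x = true
    rw [edgeState, heq]; exact h
  · right
    obtain ⟨k, hk⟩ : ∃ k, ringCount x.2.1 t = k + 1 := ⟨ringCount x.2.1 t - 1, by omega⟩
    refine Set.mem_iUnion.2 ⟨k, ⟨?_, ?_⟩, ?_⟩
    · rw [← not_le, hS]; omega
    · exact ((hT _).2 hk.ge).trans hts
    · rw [edgeState, hk] at h; exact h

/-! ### The configuration of all edges -/

/-- The initial state and the sample of the edge `e`. -/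
def edgeData {n : ℕ} (ω : Sample n) (e : Sym2 (Fin n)) : Bool × EdgeSample :=
  (@decide (e ∈ ω.1.edgeSet) (Classical.propDecidable _), ω.2 e)

/-- The states of all edges at time `t`. -/
def config {n : ℕ} (ω : Sample n) (t : ℝ) (e : Sym2 (Fin n)) : Bool := edgeState t (edgeData ω e)

@[fun_prop]
lemma measurable_edgeData {n : ℕ} (e : Sym2 (Fin n)) :
    Measurable fun ω : Sample n => edgeData ω e := by
  unfold edgeData
  refine Measurable.prodMk ?_ (by fun_prop)
  have h1 : Measurable fun ω : Sample n => e ∈ ω.1.edgeSet :=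
    measurable_set_mem e |>.comp (SimpleGraph.measurable_edgeSet.comp measurable_fst)
  exact (Measurable.of_discrete (f := fun P : Prop => @decide P (Classical.propDecidable _))).comp h1

lemma graphAt_eq {n : ℕ} (ω : Sample n) (t : ℝ) : graphAt ω t = toGraph (config ω t) := by
  rw [graphAt, toGraph]
  congr 1
  ext e
  change present ω t e ↔ config ω t e = true
  rw [present, config, edgeState, edgeData]
  dsimp only
  cases ringCount (ω.2 e).1 t <;> simp [stateAfter]

lemma binomialRandom_eq_map_toGraph (n : ℕ) :
    SimpleGraph.binomialRandom (Fin n) (edgeProb n) =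
      (Measure.infinitePi fun _ : Sym2 (Fin n) => coinLaw n).map toGraph := by
  have h1 : ∀ e : Sym2 (Fin n),
      (unitInterval.toNNReal (edgeProb n) • Measure.dirac (e ∈ (Sym2.diagSetᶜ : Set (Sym2 (Fin n)))) +
        unitInterval.toNNReal (unitInterval.symm (edgeProb n)) • Measure.dirac False) =
      (coinLaw n).map fun b => b = true ∧ e ∈ (Sym2.diagSetᶜ : Set (Sym2 (Fin n))) := by
    intro e
    rw [coinLaw, map_bernoulliMeasure', bernoulliMeasure_def]
    · simp
    · exact Measurable.of_discrete
  rw [SimpleGraph.binomialRandom_eq_map, setBernoulli_eq_map]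
  simp_rw [h1]
  rw [← Measure.infinitePi_map_pi _ (fun e => Measurable.of_discrete), Measure.map_map,
    Measure.map_map]
  · congr 1
    ext b x y
    simp [toGraph]
  · exact Measurable.of_discrete
  · exact Measurable.of_discrete
  · exact SimpleGraph.measurable_fromEdgeSet
  · exact Measurable.of_discrete

lemma measurable_toGraph (n : ℕ) : Measurable (toGraph (V := Fin n)) :=
  Measurable.of_discrete

/-- The data of all edges are independent copies of the data of one edge. -/
lemma law_eq_map (n : ℕ) :
    law n = (Measure.infinitePi fun _ : Sym2 (Fin n) => edgeModel n).map
      fun x => (toGraph fun e => (x e).1, fun e => (x e).2) := by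
  have h := (measurePreserving_arrowProdEquivProdArrow Bool EdgeSample (Sym2 (Fin n))
    (fun _ => coinLaw n) (fun _ => edgeLaw n)).map_eq
  rw [law, binomialRandom_eq_map_toGraph,
    ← Measure.map_id (μ := Measure.infinitePi fun _ : Sym2 (Fin n) => edgeLaw n),
    Measure.map_prod_map _ _ (measurable_toGraph n) measurable_id, Measure.infinitePi_eq_pi,
    Measure.infinitePi_eq_pi, Measure.infinitePi_eq_pi, ← h, Measure.map_map]
  · rfl
  · exact (measurable_toGraph n).prodMap measurable_id
  · exact MeasurableEquiv.measurable _

instance (n : ℕ) : IsProbabilityMeasure (law n) := isProbabilityMeasure_law n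

/-- The bridge from the continuous model to finite weighted sums. F must ignore the diagonal pairs,
because the initial graph carries no coin for them. -/
lemma integral_law {n : ℕ} [Fintype (Sym2 (Fin n))] [DecidableEq (Sym2 (Fin n))]
    {Y : Type*} [Fintype Y] [MeasurableSpace Y] [DiscreteMeasurableSpace Y]
    {g : Bool × EdgeSample → Y} (hg : Measurable g) {F : (Sym2 (Fin n) → Y) → ℝ}
    (hF : ∀ y y' : Sym2 (Fin n) → Y, (∀ e, ¬ e.IsDiag → y e = y' e) → F y = F y') :
    ∫ ω, F (fun e => g (edgeData ω e)) ∂law n =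
      ∑ y : Sym2 (Fin n) → Y, (∏ e, (edgeModel n).real {x | g x = y e}) * F y := by
  have hFm : Measurable F := Measurable.of_discrete
  have hprob : IsProbabilityMeasure ((edgeModel n).map g) :=
    Measure.isProbabilityMeasure_map hg.aemeasurable
  have hm : Measurable fun ω : Sample n => F fun e => g (edgeData ω e) :=
    hFm.comp (measurable_pi_lambda _ fun e => hg.comp (measurable_edgeData e))
  have hΦ : Measurable fun x : Sym2 (Fin n) → Bool × EdgeSample =>
      ((toGraph fun e => (x e).1, fun e => (x e).2) : Sample n) :=
    ((measurable_toGraph n).comp (by fun_prop)).prodMk (by fun_prop)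
  rw [law_eq_map, integral_map hΦ.aemeasurable hm.aestronglyMeasurable]
  have h1 : ∀ x : Sym2 (Fin n) → Bool × EdgeSample,
      F (fun e => g (edgeData ((toGraph fun e => (x e).1, fun e => (x e).2) : Sample n) e)) =
        F (fun e => g (x e)) := by
    intro x
    refine hF _ _ fun e he => ?_
    congr 1
    refine Prod.ext ?_ rfl
    simp [edgeData, toGraph, he]
  simp_rw [h1]
  have h2 := integral_map (μ := Measure.infinitePi fun _ : Sym2 (Fin n) => edgeModel n)
    (φ := fun x e => g (x e))
    (measurable_pi_lambda _ fun e => hg.comp (measurable_pi_apply e)).aemeasurable hFm.aestronglyMeasurable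
  rw [← h2, Measure.infinitePi_map_pi _ (fun _ => hg), integral_fintype Integrable.of_finite]
  refine Finset.sum_congr rfl fun y _ => ?_
  rw [smul_eq_mul, measureReal_def, Measure.infinitePi_singleton_of_fintype, ENNReal.toReal_prod]
  congr 1
  refine Finset.prod_congr rfl fun e _ => ?_
  rw [measureReal_def, Measure.map_apply hg (measurableSet_singleton _)]
  rfl

lemma integral_config {n : ℕ} [Fintype (Sym2 (Fin n))] [DecidableEq (Sym2 (Fin n))] (t : ℝ)
    (F : SimpleGraph (Fin n) → ℝ) :
    ∫ ω, F (graphAt ω t) ∂law n = ex (1 / n) fun y => F (toGraph y) := by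
  simp_rw [graphAt_eq]
  refine (integral_law (measurable_edgeState t) (F := fun y => F (toGraph y)) ?_).trans ?_
  · intro y y' h
    congr 1
    ext u v
    rw [toGraph_adj, toGraph_adj]
    by_cases huv : u = v
    · simp [huv]
    · rw [h s(u, v) (by simpa using huv)]
  · refine Finset.sum_congr rfl fun y _ => ?_
    simp_rw [edgeModel_state]
    rfl

lemma integral_config_pair {n : ℕ} [Fintype (Sym2 (Fin n))] [DecidableEq (Sym2 (Fin n))] (s t : ℝ)
    (F F' : SimpleGraph (Fin n) → ℝ) :
    ∫ ω, F (graphAt ω s) * F' (graphAt ω t) ∂law n =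
      ex₂ (1 / n) (clockLaw.real {τ | ringCount τ s = ringCount τ t})
        fun y y' => F (toGraph y) * F' (toGraph y') := by
  simp_rw [graphAt_eq]
  have hg : Measurable fun x => (edgeState s x, edgeState t x) := by fun_prop
  refine (integral_law hg
    (F := fun y => F (toGraph fun e => (y e).1) * F' (toGraph fun e => (y e).2)) ?_).trans ?_
  · intro y y' h
    congr 2
    all_goals
      ext u v
      rw [toGraph_adj, toGraph_adj]
      by_cases huv : u = v
      · simp [huv]
      · rw [h s(u, v) (by simpa using huv)]
  · rw [ex₂, ← Fintype.sum_prod_type']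
    refine Fintype.sum_equiv (Equiv.arrowProdEquivProdArrow _ _ _) _ _ fun y => ?_
    simp only [Equiv.arrowProdEquivProdArrow_apply]
    congr 1
    refine Finset.prod_congr rfl fun e _ => ?_
    rw [← edgeModel_state_pair]
    congr 1
    ext x
    simp [Prod.ext_iff]

/-- The pairs that are edges at some time in `[s, s + δ]`, with negligible exceptions. -/
def everConfig {n : ℕ} (ω : Sample n) (s δ : ℝ) (e : Sym2 (Fin n)) : Bool :=
  @decide (edgeData ω e ∈ everPresent s δ) (Classical.propDecidable _)

lemma integral_everConfig {n : ℕ} [Fintype (Sym2 (Fin n))] [DecidableEq (Sym2 (Fin n))] (s δ : ℝ)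
    (F : SimpleGraph (Fin n) → ℝ) :
    ∫ ω, F (toGraph (everConfig ω s δ)) ∂law n =
      ex ((edgeModel n).real (everPresent s δ)) fun y => F (toGraph y) := by
  have hm : Measurable fun x => x ∈ everPresent s δ :=
    measurableSet_setOfPred.1 (measurableSet_everPresent s δ)
  have hg := (Measurable.of_discrete
    (f := fun P : Prop => @decide P (Classical.propDecidable _))).comp hm
  refine (integral_law hg (F := fun y => F (toGraph y)) ?_).trans ?_
  · intro y y' h
    congr 1
    ext u v
    rw [toGraph_adj, toGraph_adj]
    by_cases huv : u = v
    · simp [huv]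
    · rw [h s(u, v) (by simpa using huv)]
  · refine Finset.sum_congr rfl fun y _ => ?_
    rw [wt]
    congr 1
    refine Finset.prod_congr rfl fun e _ => ?_
    cases y e
    · simp only [Function.comp, decide_eq_false_iff_not, bern]
      rw [← Set.compl_def, probReal_compl_eq_one_sub (measurableSet_everPresent s δ)]
      simp
    · simp [bern]

lemma law_ae_regular (n : ℕ) : ∀ᵐ ω ∂law n, ∀ e,
    (∀ i, 0 < (edgeData ω e).2.1 i) ∧ ∃ k, 1 < ringTime k (edgeData ω e).2.1 := by
  rw [ae_all_iff]
  intro e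
  have h1 : (law n).map (fun ω => (ω.2 e).1) = clockLaw := by
    have : (fun ω : Sample n => (ω.2 e).1) = Prod.fst ∘ (fun f => f e) ∘ Prod.snd := rfl
    rw [this, ← Measure.map_map measurable_fst (by fun_prop),
      ← Measure.map_map (by fun_prop) measurable_snd, law, Measure.map_snd_prod, measure_univ,
      one_smul, Measure.infinitePi_map_eval (fun _ : Sym2 (Fin n) => edgeLaw n) e, edgeLaw_eq,
      Measure.map_fst_prod, measure_univ, one_smul]
  have h2 : ∀ᵐ τ ∂((law n).map (fun ω => (ω.2 e).1)),
      (∀ i, 0 < τ i) ∧ ∃ k, 1 < ringTime k τ := by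
    rw [h1]
    exact clockLaw_ae_pos.and clockLaw_ae_exists_lt
  exact ae_of_ae_map (by fun_prop) h2

/-- A single null set serves all times at once, as a supremum over uncountably many times requires.
-/
lemma law_ae_le_everConfig (n : ℕ) : ∀ᵐ ω ∂law n, ∀ s δ t, 0 ≤ s → s ≤ t → t ≤ s + δ → t ≤ 1 →
    graphAt ω t ≤ toGraph (everConfig ω s δ) := by
  filter_upwards [law_ae_regular n] with ω hω s δ t h0 hst hts ht
  rw [graphAt_eq]
  intro u v huv
  rw [toGraph_adj] at huv ⊢
  refine ⟨?_, huv.2⟩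
  rw [everConfig]
  simpa using mem_everPresent (hω _).1 (hω _).2 h0 hst hts ht huv.1

end

/-! ### Moments of the number of vertices in large components. -/

section LargeComponents

open scoped Finset Classical

variable {V : Type*} [Fintype V]

/-- The number of vertices whose component has at least `k` vertices. -/
noncomputable def largeCount (k : ℕ) (G : SimpleGraph V) : ℝ :=
  ∑ v, if k ≤ #(comp G v) then 1 else 0

theorem largeCount_nonneg (k : ℕ) (G : SimpleGraph V) : 0 ≤ largeCount k G :=
  Finset.sum_nonneg fun _ _ => by split_ifs <;> norm_num

theorem largeCount_le (k : ℕ) (G : SimpleGraph V) : largeCount k G ≤ Fintype.card V := by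
  rw [largeCount, Finset.sum_boole]
  exact_mod_cast Finset.card_le_univ _

theorem comp_mono {G G' : SimpleGraph V} (h : G ≤ G') (v : V) : comp G v ⊆ comp G' v :=
  fun _ hw => mem_comp.2 ((mem_comp.1 hw).mono h)

theorem le_largeCount {k : ℕ} {G : SimpleGraph V} (h : ∃ v, k ≤ #(comp G v)) :
    (k : ℝ) ≤ largeCount k G := by
  obtain ⟨v, hv⟩ := h
  rw [largeCount, Finset.sum_boole]
  norm_cast
  refine hv.trans (Finset.card_le_card fun w hw => ?_)
  have hw' := mem_comp.1 hw
  have : comp G w = comp G v := by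
    ext u
    rw [mem_comp, mem_comp]
    exact ⟨fun h => hw'.trans h, fun h => hw'.symm.trans h⟩
  simpa [this] using hv

theorem exists_of_largeCount_ne_zero {k : ℕ} {G : SimpleGraph V} (h : largeCount k G ≠ 0) :
    ∃ v, k ≤ #(comp G v) := by
  obtain ⟨v, -, hv⟩ := Finset.exists_ne_zero_of_sum_ne_zero h
  exact ⟨v, by by_contra hcon; simp [hcon] at hv⟩

theorem ex_largeCount (p : ℝ) (s : ℕ) :
    ex p (fun ω : Sym2 V → Bool => largeCount (s + 1) (toGraph ω)) =
      Fintype.card V * survival p s 1 (Fintype.card V - 1) := by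
  simp only [largeCount]
  rw [ex_sum]
  simp only [ex_comp]
  rw [Finset.sum_const, Finset.card_univ, nsmul_eq_mul]

theorem ex_card_comp (p : ℝ) (v : V) :
    ex p (fun ω : Sym2 V → Bool => (#(comp (toGraph ω) v) : ℝ)) =
      ∑ s ∈ Finset.range (Fintype.card V), survival p s 1 (Fintype.card V - 1) := by
  simp only [← ex_comp p _ v]
  rw [← ex_sum]
  congr 1
  ext ω
  rw [Finset.sum_boole]
  congr 1
  have : (Finset.range (Fintype.card V)).filter (fun s => s + 1 ≤ #(comp (toGraph ω) v)) =
      Finset.range #(comp (toGraph ω) v) := by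
    ext s
    have := Finset.card_le_univ (comp (toGraph ω) v)
    simp only [Finset.mem_filter, Finset.mem_range]
    omega
  rw [this, Finset.card_range]

/-- The indicator that v has a large component is determined by the pairs touching that component.
The total revealment of a pair is at most twice the mean component size, and indicators equal their
squares. -/
theorem ex₂_largeCount_le {p : ℝ} (h0 : 0 < p) (h1 : p < 1) (s : ℕ) {ρ : ℝ} (hρ0 : 0 ≤ ρ)
    (hρ1 : ρ < 1) :
    ex₂ p ρ (fun ω ω' : Sym2 V → Bool =>
        largeCount (s + 1) (toGraph ω) * largeCount (s + 1) (toGraph ω')) ≤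
      (Fintype.card V * survival p s 1 (Fintype.card V - 1)) ^ 2 +
        2 * (∑ i ∈ Finset.range (Fintype.card V), survival p i 1 (Fintype.card V - 1)) *
          (Fintype.card V * survival p s 1 (Fintype.card V - 1)) / (1 - ρ) ^ 2 := by
  set D := ∑ i ∈ Finset.range (Fintype.card V), survival p i 1 (Fintype.card V - 1) with hD
  have hD0 : 0 ≤ D := Finset.sum_nonneg fun i _ => survival_nonneg h0.le h1.le _ _ _
  have h := ex₂_mul_self_le h0 h1 (fun v : V => isStopping_touching v)
    (f := fun v ω => if s + 1 ≤ #(comp (toGraph ω) v) then (1 : ℝ) else 0)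
    (fun v ω ω' hω => by simp only [comp_congr hω]) (D := 2 * D) (by positivity)
    (fun e => ex_touching_le h0.le h1.le e fun v => (ex_card_comp p v).le) hρ0 hρ1
  have hsq : ∀ v : V, ex p (fun ω : Sym2 V → Bool =>
      (if s + 1 ≤ #(comp (toGraph ω) v) then (1 : ℝ) else 0) ^ 2) =
      survival p s 1 (Fintype.card V - 1) := fun v => by
    rw [← ex_comp p s v]
    congr 1
    ext ω
    split_ifs <;> norm_num
  simp only [hsq, Finset.sum_const, Finset.card_univ, nsmul_eq_mul] at h
  have h2 := ex_largeCount (V := V) p s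
  simp only [largeCount] at h2 ⊢
  rwa [h2] at h

/-- For a given v in a large component, the vertices w of the same component number at most K, or at
most n on the rare event that its size exceeds K. Vertices w of other components are handled by
`ex_two_comps_le`. -/
theorem ex_largeCount_sq_le {p : ℝ} (h0 : 0 ≤ p) (h1 : p ≤ 1) (s K : ℕ) :
    ex p (fun ω : Sym2 V → Bool => largeCount (s + 1) (toGraph ω) ^ 2) ≤
      Fintype.card V * (K * survival p s 1 (Fintype.card V - 1) +
        Fintype.card V * survival p K 1 (Fintype.card V - 1)) +
      (Fintype.card V * survival p s 1 (Fintype.card V - 1)) ^ 2 := by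
  set q := survival p s 1 (Fintype.card V - 1)
  have hpt : ∀ ω : Sym2 V → Bool, largeCount (s + 1) (toGraph ω) ^ 2 ≤
      ∑ v, ((K * (if s + 1 ≤ #(comp (toGraph ω) v) then (1 : ℝ) else 0) +
        Fintype.card V * (if K + 1 ≤ #(comp (toGraph ω) v) then (1 : ℝ) else 0)) +
        ∑ w, (if s + 1 ≤ #(comp (toGraph ω) v) then (1 : ℝ) else 0) *
          (if w ∉ comp (toGraph ω) v ∧ s + 1 ≤ #(comp (toGraph ω) w) then 1 else 0)) := by
    intro ω
    rw [sq, largeCount, Finset.sum_mul]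
    refine Finset.sum_le_sum fun v _ => ?_
    rw [Finset.mul_sum]
    have e1 : ∀ w, (if s + 1 ≤ #(comp (toGraph ω) v) then (1 : ℝ) else 0) *
        (if s + 1 ≤ #(comp (toGraph ω) w) then (1 : ℝ) else 0) ≤
        (if s + 1 ≤ #(comp (toGraph ω) v) then (1 : ℝ) else 0) *
          (if w ∈ comp (toGraph ω) v then 1 else 0) +
        (if s + 1 ≤ #(comp (toGraph ω) v) then (1 : ℝ) else 0) *
          (if w ∉ comp (toGraph ω) v ∧ s + 1 ≤ #(comp (toGraph ω) w) then 1 else 0) := by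
      intro w
      by_cases hw : w ∈ comp (toGraph ω) v
      · simp only [hw]; split_ifs <;> simp_all
      · simp only [hw]; split_ifs <;> simp_all
    refine (Finset.sum_le_sum fun w _ => e1 w).trans ?_
    rw [Finset.sum_add_distrib]
    refine add_le_add ?_ le_rfl
    rw [← Finset.mul_sum, Finset.sum_boole]
    have e2 : (Finset.univ.filter fun w => w ∈ comp (toGraph ω) v) = comp (toGraph ω) v := by
      ext; simp
    rw [e2]
    have e3 : (#(comp (toGraph ω) v) : ℝ) ≤ Fintype.card V := by
      exact_mod_cast Finset.card_le_univ _
    have e4 : (0 : ℝ) ≤ Fintype.card V := Nat.cast_nonneg _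
    by_cases hs : s + 1 ≤ #(comp (toGraph ω) v)
    · by_cases hK : K + 1 ≤ #(comp (toGraph ω) v)
      · simp only [hs, hK, if_true]
        have : (0 : ℝ) ≤ K := Nat.cast_nonneg _
        linarith
      · have : (#(comp (toGraph ω) v) : ℝ) ≤ K := by
          exact_mod_cast Nat.lt_succ_iff.1 (not_le.1 hK)
        simp only [hs, hK, if_true, if_false]
        linarith
    · simp only [hs, if_false]
      split_ifs <;> simp
  refine (ex_mono h0 h1 hpt).trans ?_
  rw [ex_sum]
  have hv : ∀ v : V, ex p (fun ω : Sym2 V → Bool =>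
      (K * (if s + 1 ≤ #(comp (toGraph ω) v) then (1 : ℝ) else 0) +
        Fintype.card V * (if K + 1 ≤ #(comp (toGraph ω) v) then (1 : ℝ) else 0)) +
        ∑ w, (if s + 1 ≤ #(comp (toGraph ω) v) then (1 : ℝ) else 0) *
          (if w ∉ comp (toGraph ω) v ∧ s + 1 ≤ #(comp (toGraph ω) w) then 1 else 0)) ≤
      (K * q + Fintype.card V * survival p K 1 (Fintype.card V - 1)) + Fintype.card V * q ^ 2 := by
    intro v
    rw [ex_add, ex_add, ex_const_mul, ex_const_mul, ex_comp, ex_comp, ex_sum]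
    refine add_le_add le_rfl ?_
    refine (Finset.sum_le_sum fun w _ => ex_two_comps_le h0 h1 (s + 1) v w).trans ?_
    simp only [ex_comp]
    rw [Finset.sum_const, Finset.card_univ, nsmul_eq_mul, sq]
  refine (Finset.sum_le_sum fun v _ => hv v).trans ?_
  rw [Finset.sum_const, Finset.card_univ, nsmul_eq_mul]
  apply le_of_eq; ring

end LargeComponents

/-! ### The size of the largest component -/

theorem succ_le_iSup_iff {ι : Type*} {f : ι → ℕ} (hf : BddAbove (Set.range f)) (k : ℕ) :
    k + 1 ≤ ⨆ i, f i ↔ ∃ i, k + 1 ≤ f i := by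
  constructor
  · intro h
    by_contra! hcon
    have := ciSup_le' (f := f) (a := k) fun i => Nat.lt_succ_iff.1 (hcon i)
    omega
  · rintro ⟨i, hi⟩
    exact hi.trans (le_ciSup hf i)

open scoped Finset in
theorem succ_le_largestSize_iff {n : ℕ} (G : SimpleGraph (Fin n)) (k : ℕ) :
    k + 1 ≤ largestSize G ↔ ∃ v, k + 1 ≤ #(comp G v) := by
  have hcard : ∀ v, (G.connectedComponentMk v).supp.ncard = #(comp G v) := fun v => by
    rw [← Set.ncard_coe_finset]
    congr 1
    ext w
    rw [Finset.mem_coe, mem_comp, SimpleGraph.ConnectedComponent.mem_supp_iff,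
      SimpleGraph.ConnectedComponent.eq]
    exact SimpleGraph.reachable_comm
  rw [largestSize, succ_le_iSup_iff (Set.toFinite _).bddAbove]
  constructor
  · rintro ⟨c, hc⟩
    induction c using SimpleGraph.ConnectedComponent.ind with
    | _ v => exact ⟨v, hcard v ▸ hc⟩
  · rintro ⟨v, hv⟩
    exact ⟨G.connectedComponentMk v, (hcard v).symm ▸ hv⟩

open scoped Finset in
theorem succ_le_supLargestSize_iff {n : ℕ} (ω : Sample n) (k : ℕ) :
    k + 1 ≤ supLargestSize ω ↔ ∃ t, 0 ≤ t ∧ t ≤ 1 ∧ ∃ v, k + 1 ≤ #(comp (graphAt ω t) v) := by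
  have hb : BddAbove (Set.range fun t : Set.Icc (0 : ℝ) 1 => largestSize (graphAt ω t)) := by
    refine ⟨n, ?_⟩
    rintro _ ⟨t, rfl⟩
    by_contra! hcon
    obtain ⟨v, hv⟩ := (succ_le_largestSize_iff _ n).1 hcon
    have := Finset.card_le_univ (comp (graphAt ω t) v)
    rw [Fintype.card_fin] at this
    omega
  rw [supLargestSize, succ_le_iSup_iff hb]
  simp only [succ_le_largestSize_iff]
  constructor
  · rintro ⟨t, h⟩; exact ⟨t, t.2.1, t.2.2, h⟩
  · rintro ⟨t, h0, h1, h⟩; exact ⟨⟨t, h0, h1⟩, h⟩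

/-! ### The upper bound -/

theorem measurable_toGraph_everConfig {n : ℕ} (s δ : ℝ) :
    Measurable fun ω : Sample n => toGraph (everConfig ω s δ) := by
  refine (measurable_toGraph n).comp (measurable_pi_lambda _ fun e => ?_)
  have hm : Measurable fun ω : Sample n => edgeData ω e ∈ everPresent s δ :=
    measurableSet_setOfPred.1 ((measurable_edgeData e) (measurableSet_everPresent s δ))
  exact (Measurable.of_discrete
    (f := fun P : Prop => @decide P (Classical.propDecidable _))).comp hm

theorem measurable_graphAt {n : ℕ} (t : ℝ) : Measurable fun ω : Sample n => graphAt ω t := by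
  simp_rw [graphAt_eq]
  exact (measurable_toGraph n).comp
    (measurable_pi_lambda _ fun e => (measurable_edgeState t).comp (measurable_edgeData e))

theorem measurable_largeCount (n k : ℕ) :
    Measurable fun G : SimpleGraph (Fin n) => largeCount k G := by
  have h : (fun G : SimpleGraph (Fin n) => largeCount k G) =
      (fun S => largeCount k (SimpleGraph.fromEdgeSet S)) ∘ SimpleGraph.edgeSet := by
    ext G; simp
  rw [h]
  exact Measurable.of_discrete.comp SimpleGraph.measurable_edgeSet

theorem law_everConfig_le {n : ℕ} {s δ : ℝ} (hs : 0 ≤ s) (h0 : 0 ≤ δ) (h1 : δ ≤ 1)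
    {k : ℕ} {Q : ℝ}
    (hQ : ∀ p : ℝ, 0 ≤ p → p ≤ (1 + 2 * δ) / n → survival p k 1 (n - 1) ≤ Q) :
    (law n).real {ω | ((k + 1 : ℕ) : ℝ) ≤ largeCount (k + 1) (toGraph (everConfig ω s δ))} ≤
      n * Q / (k + 1 : ℕ) := by
  classical
  have hm : Measurable fun ω : Sample n => largeCount (k + 1) (toGraph (everConfig ω s δ)) :=
    (measurable_largeCount n _).comp (measurable_toGraph_everConfig s δ)
  have hint : Integrable (fun ω : Sample n => largeCount (k + 1) (toGraph (everConfig ω s δ)))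
      (law n) := by
    refine Integrable.of_bound hm.aestronglyMeasurable (n : ℝ) (ae_of_all _ fun ω => ?_)
    rw [Real.norm_of_nonneg (largeCount_nonneg _ _)]
    simpa using largeCount_le (k + 1) (toGraph (everConfig ω s δ))
  have h := mul_meas_ge_le_integral_of_nonneg (ae_of_all _ fun ω => largeCount_nonneg _ _) hint
    ((k + 1 : ℕ) : ℝ)
  rw [integral_everConfig s δ (largeCount (k + 1))] at h
  have h2 := ex_largeCount (V := Fin n) ((edgeModel n).real (everPresent s δ)) k
  rw [Fintype.card_fin] at h2
  have h3 : ((k + 1 : ℕ) : ℝ) *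
      (law n).real {ω | ((k + 1 : ℕ) : ℝ) ≤ largeCount (k + 1) (toGraph (everConfig ω s δ))} ≤
      n * survival ((edgeModel n).real (everPresent s δ)) k 1 (n - 1) := by
    refine h.trans (le_of_eq ?_)
    convert h2
  rw [le_div_iff₀ (by positivity), mul_comm]
  refine h3.trans (mul_le_mul_of_nonneg_left ?_ (Nat.cast_nonneg _))
  exact hQ _ measureReal_nonneg (edgeModel_everPresent_le n hs h0 h1)

/-- Union bound over the windows [j/r, (j+1)/r], each handled by Markov's inequality for the graph
of all edges ever present in it. -/
theorem law_supLargestSize_le {n : ℕ} {r : ℝ} (hr : 1 ≤ r)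
    {k : ℕ} {Q : ℝ}
    (hQ : ∀ p : ℝ, 0 ≤ p → p ≤ (1 + 2 / r) / n → survival p k 1 (n - 1) ≤ Q) :
    law n {ω | k + 1 ≤ supLargestSize ω} ≤
      ENNReal.ofReal ((r + 1) * (n * Q / (k + 1 : ℕ))) := by
  have hr0 : 0 < r := by linarith
  set B : ℕ → Set (Sample n) := fun j => {ω | ((k + 1 : ℕ) : ℝ) ≤
    largeCount (k + 1) (toGraph (everConfig ω (j / r) (1 / r)))} with hB
  have hBle : ∀ j, (law n).real (B j) ≤ n * Q / (k + 1 : ℕ) := fun j =>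
    law_everConfig_le (by positivity) (by positivity) (by rwa [div_le_one hr0])
      (by rw [mul_one_div]; exact hQ)
  have hC0 : 0 ≤ n * Q / (k + 1 : ℕ) := measureReal_nonneg.trans (hBle 0)
  calc law n {ω | k + 1 ≤ supLargestSize ω}
      ≤ law n (⋃ j ∈ Finset.range (⌊r⌋₊ + 1), B j) := by
        refine measure_mono_ae ?_
        filter_upwards [law_ae_le_everConfig n] with ω hω h
        obtain ⟨t, h0, h1, v, hv⟩ := (succ_le_supLargestSize_iff ω k).1 h
        have htr : 0 ≤ t * r := by positivity
        refine Set.mem_biUnion (x := ⌊t * r⌋₊) ?_ ?_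
        · simp only [Finset.coe_range, Set.mem_Iio, Nat.lt_succ_iff]
          exact Nat.floor_le_floor (by nlinarith)
        · refine le_largeCount ⟨v, hv.trans (Finset.card_le_card (comp_mono ?_ v))⟩
          refine hω _ _ t (by positivity) ?_ ?_ h1
          · rw [div_le_iff₀ hr0]; exact Nat.floor_le htr
          · rw [← add_div, le_div_iff₀ hr0]; exact (Nat.lt_floor_add_one _).le
    _ ≤ ∑ j ∈ Finset.range (⌊r⌋₊ + 1), law n (B j) := measure_biUnion_finset_le _ _
    _ ≤ ∑ j ∈ Finset.range (⌊r⌋₊ + 1), ENNReal.ofReal (n * Q / (k + 1 : ℕ)) :=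
        Finset.sum_le_sum fun j _ => by
          rw [← ofReal_measureReal]; exact ENNReal.ofReal_le_ofReal (hBle j)
    _ = ENNReal.ofReal (((⌊r⌋₊ + 1 : ℕ) : ℝ) * (n * Q / (k + 1 : ℕ))) := by
        rw [Finset.sum_const, Finset.card_range, nsmul_eq_mul, ENNReal.ofReal_mul (by positivity),
          ENNReal.ofReal_natCast]
    _ ≤ _ := by
        refine ENNReal.ofReal_le_ofReal (mul_le_mul_of_nonneg_right ?_ hC0)
        push_cast
        linarith [Nat.floor_le hr0.le]

theorem tendsto_law_upper {β : ℝ} (hβ0 : 0 < β) (hβ : 8 / 3 < β ^ 3) :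
    Tendsto (fun n : ℕ => law n {ω | β * (cbrt n ^ 2 * cbrtLog n) < (supLargestSize ω : ℝ)})
      atTop (𝓝 0) := by
  have hlim : Tendsto (fun n : ℕ => ENNReal.ofReal (2 / β * (cbrtLog n)⁻¹)) atTop (𝓝 0) := by
    have := (tendsto_cbrtLog.inv_tendsto_atTop).const_mul (2 / β)
    rw [mul_zero] at this
    simpa using ENNReal.tendsto_ofReal this
  refine tendsto_of_tendsto_of_tendsto_of_le_of_le' tendsto_const_nhds hlim
    (Eventually.of_forall fun _ => zero_le) ?_
  filter_upwards [survival_eventually_le hβ0 hβ one_pos, eventually_ge_atTop 1,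
    tendsto_cbrtLog.eventually_gt_atTop 0] with n hn hn1 hL
  have hn0 : n ≠ 0 := by omega
  have hr1 : 1 ≤ cbrt n := Real.one_le_rpow (by exact_mod_cast hn1) (by norm_num)
  have hr0 : 0 < cbrt n := by linarith
  set k := ⌊β * (cbrt n ^ 2 * cbrtLog n)⌋₊ with hk
  have hset : {ω : Sample n | β * (cbrt n ^ 2 * cbrtLog n) < (supLargestSize ω : ℝ)} =
      {ω | k + 1 ≤ supLargestSize ω} := by
    ext ω
    change _ < (supLargestSize ω : ℝ) ↔ k + 1 ≤ supLargestSize ω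
    rw [← Nat.floor_lt (by positivity), Nat.succ_le_iff]
  rw [hset]
  refine (law_supLargestSize_le hr1 hn).trans (ENNReal.ofReal_le_ofReal ?_)
  have hk1 : β * (cbrt n ^ 2 * cbrtLog n) ≤ ((k + 1 : ℕ) : ℝ) := by
    push_cast; exact (Nat.lt_floor_add_one _).le
  calc (cbrt n + 1) * (n * (1 / cbrt n ^ 2) / (k + 1 : ℕ))
      ≤ (cbrt n + cbrt n) * (n * (1 / cbrt n ^ 2) / (β * (cbrt n ^ 2 * cbrtLog n))) := by
        gcongr
    _ = 2 / β * (cbrtLog n)⁻¹ * (n / cbrt n ^ 3) := by field_simp; ring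
    _ = 2 / β * (cbrtLog n)⁻¹ := by
        rw [cbrt_pow_three, div_self (by exact_mod_cast hn0), mul_one]

/-! ### The lower bound -/

/-- The second moment method. -/
theorem measureReal_eq_zero_mul_sq_le {Ω : Type*} [MeasurableSpace Ω] {μ : Measure Ω}
    [IsProbabilityMeasure μ] {X : Ω → ℝ} (hX : Integrable X μ)
    (hX2 : Integrable (fun ω => X ω ^ 2) μ) :
    μ.real {ω | X ω = 0} * (∫ ω, X ω ∂μ) ^ 2 ≤ ∫ ω, X ω ^ 2 ∂μ - (∫ ω, X ω ∂μ) ^ 2 := by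
  set m := ∫ ω, X ω ∂μ with hm
  have hlin : Integrable (fun ω => 2 * m * X ω) μ := hX.const_mul _
  have hsub : Integrable (fun ω => X ω ^ 2 - 2 * m * X ω) μ := hX2.sub hlin
  have hexp : ∀ ω, (X ω - m) ^ 2 = (X ω ^ 2 - 2 * m * X ω) + m ^ 2 := fun ω => by ring
  have hint : Integrable (fun ω => (X ω - m) ^ 2) μ := by
    simp_rw [hexp]; exact hsub.add (integrable_const _)
  have h1 := mul_meas_ge_le_integral_of_nonneg (ae_of_all _ fun ω => sq_nonneg (X ω - m)) hint
    (m ^ 2)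
  have h2 : ∫ ω, (X ω - m) ^ 2 ∂μ = ∫ ω, X ω ^ 2 ∂μ - m ^ 2 := by
    simp_rw [hexp]
    rw [integral_add hsub (integrable_const _), integral_sub hX2 hlin, integral_const_mul,
      integral_const, ← hm, probReal_univ, one_smul]
    ring
  rw [h2] at h1
  rw [mul_comm]
  refine (mul_le_mul_of_nonneg_left (measureReal_mono fun ω hω => ?_) (sq_nonneg m)).trans h1
  have : X ω = 0 := hω
  change m ^ 2 ≤ (X ω - m) ^ 2
  rw [this]
  exact le_of_eq (by ring)

theorem sum_inv_sq_le (N : ℕ) : ∑ k ∈ Finset.range N, 1 / ((k : ℝ) + 1) ^ 2 ≤ 2 := by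
  have h : ∀ N : ℕ, ∑ k ∈ Finset.range (N + 1), 1 / ((k : ℝ) + 1) ^ 2 ≤ 2 - 1 / ((N : ℝ) + 1) := by
    intro N
    induction N with
    | zero => norm_num
    | succ N ih =>
      rw [Finset.sum_range_succ]
      push_cast
      have : 1 / ((N : ℝ) + 1 + 1) ^ 2 ≤ 1 / ((N : ℝ) + 1) - 1 / ((N : ℝ) + 1 + 1) := by
        rw [div_sub_div _ _ (by positivity) (by positivity)]
        apply div_le_div₀ <;> nlinarith [(Nat.cast_nonneg N : (0 : ℝ) ≤ N)]
      linarith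
  calc _ ≤ ∑ k ∈ Finset.range (N + 1), 1 / ((k : ℝ) + 1) ^ 2 :=
        Finset.sum_le_sum_of_subset_of_nonneg (Finset.range_mono N.le_succ)
          fun _ _ _ => by positivity
    _ ≤ 2 - 1 / ((N : ℝ) + 1) := h N
    _ ≤ 2 := by linarith [show (0 : ℝ) ≤ 1 / ((N : ℝ) + 1) by positivity]

/-- The term j = i is 1/0 = 0 and does no harm; each side of i contributes at most 2. -/
theorem sum_inv_sub_sq_le (i M : ℕ) : ∑ j ∈ Finset.range M, 1 / ((j : ℝ) - i) ^ 2 ≤ 4 := by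
  have h1 : ∑ j ∈ Finset.range i, 1 / ((j : ℝ) - i) ^ 2 ≤ 2 := by
    rw [← Finset.sum_range_reflect]
    refine le_of_eq_of_le (Finset.sum_congr rfl fun j hj => ?_) (sum_inv_sq_le i)
    have hj' : j + 1 ≤ i := Finset.mem_range.1 hj
    rw [show i - 1 - j = i - (j + 1) by omega, Nat.cast_sub hj']
    push_cast
    congr 1; ring
  have h2 : ∑ k ∈ Finset.range (M + 1), 1 / (((i + k : ℕ) : ℝ) - i) ^ 2 ≤ 2 := by
    rw [Finset.sum_range_succ']
    simpa using sum_inv_sq_le M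
  calc _ ≤ ∑ j ∈ Finset.range (i + (M + 1)), 1 / ((j : ℝ) - i) ^ 2 :=
        Finset.sum_le_sum_of_subset_of_nonneg (Finset.range_mono (by omega))
          fun _ _ _ => by positivity
    _ ≤ 4 := by rw [Finset.sum_range_add]; linarith

theorem integrable_largeCount_comp {n : ℕ} (k : ℕ) (t : ℝ) :
    Integrable (fun ω : Sample n => largeCount k (graphAt ω t)) (law n) := by
  refine Integrable.of_bound
    ((measurable_largeCount n k).comp (measurable_graphAt t)).aestronglyMeasurable (n : ℝ)
    (ae_of_all _ fun ω => ?_)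
  rw [Real.norm_of_nonneg (largeCount_nonneg _ _)]
  simpa using largeCount_le k (graphAt ω t)

theorem integrable_largeCount_mul {n : ℕ} (k : ℕ) (s t : ℝ) :
    Integrable (fun ω : Sample n => largeCount k (graphAt ω s) * largeCount k (graphAt ω t))
      (law n) := by
  refine Integrable.of_bound
    (((measurable_largeCount n k).comp (measurable_graphAt s)).mul
      ((measurable_largeCount n k).comp (measurable_graphAt t))).aestronglyMeasurable
      ((n : ℝ) * n) (ae_of_all _ fun ω => ?_)
  rw [Real.norm_of_nonneg (mul_nonneg (largeCount_nonneg _ _) (largeCount_nonneg _ _))]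
  have h1 := largeCount_le k (graphAt ω s)
  have h2 := largeCount_le k (graphAt ω t)
  rw [Fintype.card_fin] at h1 h2
  exact mul_le_mul h1 h2 (largeCount_nonneg _ _) (Nat.cast_nonneg _)

theorem integral_largeCount {n : ℕ} (s : ℕ) (t : ℝ) :
    ∫ ω : Sample n, largeCount (s + 1) (graphAt ω t) ∂law n =
      n * survival (1 / n) s 1 (n - 1) := by
  classical
  rw [integral_config t (largeCount (s + 1))]
  have h := ex_largeCount (V := Fin n) (1 / n) s
  rw [Fintype.card_fin] at h
  convert h

theorem integral_largeCount_sq_le {n : ℕ} (s K : ℕ) (t : ℝ) :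
    ∫ ω : Sample n, largeCount (s + 1) (graphAt ω t) * largeCount (s + 1) (graphAt ω t) ∂law n ≤
      n * (K * survival (1 / n) s 1 (n - 1) + n * survival (1 / n) K 1 (n - 1)) +
        (n * survival (1 / n) s 1 (n - 1)) ^ 2 := by
  classical
  rw [integral_config t fun G => largeCount (s + 1) G * largeCount (s + 1) G]
  have h := ex_largeCount_sq_le (V := Fin n) (edgeProb_nonneg n) (edgeProb_le_one n) s K
  rw [Fintype.card_fin] at h
  simp only [sq (largeCount _ _)] at h
  convert h

/-- An edge is refreshed with probability 1 - ρ ≥ 1 - e^(-(t-s)) ≥ (t-s)/2, which turns the constant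
2 of `ex₂_largeCount_le` into 8. -/
theorem integral_largeCount_mul_le {n : ℕ} (hn : 2 ≤ n) (k : ℕ) {s t : ℝ} (h0 : 0 ≤ s)
    (hst : s < t) (ht : t ≤ 1) :
    ∫ ω : Sample n, largeCount (k + 1) (graphAt ω s) * largeCount (k + 1) (graphAt ω t) ∂law n ≤
      (n * survival (1 / n) k 1 (n - 1)) ^ 2 +
        8 * (∑ i ∈ Finset.range n, survival (1 / n) i 1 (n - 1)) *
          (n * survival (1 / n) k 1 (n - 1)) * (1 / (t - s) ^ 2) := by
  classical
  have hn' : (2 : ℝ) ≤ n := by exact_mod_cast hn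
  have hp0 : 0 < 1 / (n : ℝ) := by positivity
  have hp1 : 1 / (n : ℝ) < 1 := by rw [div_lt_one (by linarith)]; linarith
  set ρ := clockLaw.real {τ | ringCount τ s = ringCount τ t} with hρ
  set x := t - s with hx
  have hx0 : 0 < x := by linarith
  have hx1 : x ≤ 1 := by linarith
  have hρx : ρ ≤ 1 - x / 2 := by
    refine (clockLaw_ringCount_eq_le h0 hst.le ht).trans ?_
    have h1 : Real.exp (-x) * Real.exp x = 1 := by rw [← Real.exp_add]; simp
    have h2 := Real.add_one_le_exp x
    have h3 := Real.exp_pos (-x)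
    nlinarith
  rw [integral_config_pair s t (largeCount (k + 1)) (largeCount (k + 1))]
  have h := ex₂_largeCount_le (V := Fin n) hp0 hp1 k (measureReal_nonneg : 0 ≤ ρ) (by linarith)
  rw [Fintype.card_fin] at h
  set D := ∑ i ∈ Finset.range n, survival (1 / n : ℝ) i 1 (n - 1) with hD
  have hD0 : 0 ≤ D := Finset.sum_nonneg fun i _ => survival_nonneg hp0.le hp1.le _ _ _
  set m := (n : ℝ) * survival (1 / n) k 1 (n - 1) with hm
  have hm0 : 0 ≤ m := mul_nonneg (Nat.cast_nonneg _) (survival_nonneg hp0.le hp1.le _ _ _)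
  have h' : 2 * D * m / (1 - ρ) ^ 2 ≤ 8 * D * m * (1 / x ^ 2) := by
    calc 2 * D * m / (1 - ρ) ^ 2 ≤ 2 * D * m / (x / 2) ^ 2 := by
          gcongr; linarith
      _ = _ := by field_simp; ring
  refine le_trans (le_of_eq ?_) (h.trans (add_le_add le_rfl h'))
  convert rfl

/-- The probability that no component is large at any of the times `0, 1/M, …, (M-1)/M`. -/
theorem law_forall_largeCount_eq_zero_le {n : ℕ} (hn : 2 ≤ n) (k K : ℕ) {M : ℕ} (hM : 0 < M)
    (hm : 0 < survival (1 / n) k 1 (n - 1)) :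
    (law n).real {ω | ∑ j ∈ Finset.range M, largeCount (k + 1) (graphAt ω (j / M)) = 0} ≤
      (K * survival (1 / n) k 1 (n - 1) + n * survival (1 / n) K 1 (n - 1)) /
          (M * n * survival (1 / n) k 1 (n - 1) ^ 2) + 1 / M +
        32 * M * (∑ i ∈ Finset.range n, survival (1 / n) i 1 (n - 1)) /
          (n * survival (1 / n) k 1 (n - 1)) := by
  set q := survival (1 / n : ℝ) k 1 (n - 1) with hq
  set D := ∑ i ∈ Finset.range n, survival (1 / n : ℝ) i 1 (n - 1) with hD
  set B := (n : ℝ) * (K * q + n * survival (1 / n) K 1 (n - 1)) + (n * q) ^ 2 with hB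
  set Y : ℕ → Sample n → ℝ := fun j ω => largeCount (k + 1) (graphAt ω (j / M)) with hY
  have hn0 : (0 : ℝ) < n := by exact_mod_cast (by omega : 0 < n)
  have hM0 : (0 : ℝ) < M := by exact_mod_cast hM
  have hD0 : 0 ≤ D := Finset.sum_nonneg fun i _ =>
    survival_nonneg (edgeProb_nonneg n) (edgeProb_le_one n) _ _ _
  have hB0 : 0 ≤ B := by
    have := survival_nonneg (edgeProb_nonneg n) (edgeProb_le_one n) K 1 (n - 1)
    positivity
  have hX : Integrable (fun ω => ∑ j ∈ Finset.range M, Y j ω) (law n) :=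
    integrable_finsetSum _ fun j _ => integrable_largeCount_comp _ _
  have hsq : ∀ ω, (∑ j ∈ Finset.range M, Y j ω) ^ 2 =
      ∑ i ∈ Finset.range M, ∑ j ∈ Finset.range M, Y i ω * Y j ω := fun ω => by
    rw [sq, Finset.sum_mul_sum]
  have hint : ∀ i j, Integrable (fun ω => Y i ω * Y j ω) (law n) := fun i j =>
    integrable_largeCount_mul _ _ _
  have hX2 : Integrable (fun ω => (∑ j ∈ Finset.range M, Y j ω) ^ 2) (law n) := by
    simp_rw [hsq]
    exact integrable_finsetSum _ fun i _ => integrable_finsetSum _ fun j _ => hint i j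
  have hmean : ∫ ω, ∑ j ∈ Finset.range M, Y j ω ∂law n = M * (n * q) := by
    rw [integral_finsetSum _ fun j _ => integrable_largeCount_comp _ _]
    simp only [integral_largeCount]
    rw [Finset.sum_const, Finset.card_range, nsmul_eq_mul]
  have hlt : ∀ i j : ℕ, i < j → j < M → ∫ ω, Y i ω * Y j ω ∂law n ≤
      (n * q) ^ 2 + 8 * D * (n * q) * M ^ 2 * (1 / ((j : ℝ) - i) ^ 2) := by
    intro i j hij hj
    have hij' : (i : ℝ) < j := by exact_mod_cast hij
    have hj' : (j : ℝ) ≤ M := by exact_mod_cast hj.le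
    refine (integral_largeCount_mul_le hn k (s := i / M) (t := j / M) (by positivity)
      (by gcongr) (by rwa [div_le_one hM0])).trans (le_of_eq ?_)
    have : (j : ℝ) - i ≠ 0 := by linarith
    rw [← sub_div, ← hq, ← hD]
    field_simp
  -- The diagonal uses only B, since there the middle term is a division by zero and vanishes.
  have hcov : ∀ i ∈ Finset.range M, ∀ j ∈ Finset.range M, ∫ ω, Y i ω * Y j ω ∂law n ≤
      (n * q) ^ 2 + 8 * D * (n * q) * M ^ 2 * (1 / ((j : ℝ) - i) ^ 2) +
        (if i = j then B else 0) := by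
    intro i hi j hj
    rw [Finset.mem_range] at hi hj
    rcases lt_trichotomy i j with h | h | h
    · rw [if_neg h.ne, add_zero]; exact hlt i j h hj
    · subst h
      rw [if_pos rfl]
      have h1 := integral_largeCount_sq_le (n := n) k K (i / M)
      have h2 : 0 ≤ (n * q) ^ 2 + 8 * D * (n * q) * M ^ 2 * (1 / ((i : ℝ) - i) ^ 2) := by
        positivity
      linarith
    · rw [if_neg h.ne', add_zero]
      have h1 := hlt j i h hi
      rw [show ((j : ℝ) - i) ^ 2 = ((i : ℝ) - j) ^ 2 by ring]
      simp_rw [mul_comm (Y i _)]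
      exact h1
  have hsecond : ∫ ω, (∑ j ∈ Finset.range M, Y j ω) ^ 2 ∂law n ≤
      M * (M * (n * q) ^ 2 + 8 * D * (n * q) * M ^ 2 * 4 + B) := by
    simp_rw [hsq]
    rw [integral_finsetSum _ fun i _ => integrable_finsetSum _ fun j _ => hint i j]
    have hrow : ∀ i ∈ Finset.range M, ∫ ω, ∑ j ∈ Finset.range M, Y i ω * Y j ω ∂law n ≤
        M * (n * q) ^ 2 + 8 * D * (n * q) * M ^ 2 * 4 + B := by
      intro i hi
      rw [integral_finsetSum _ fun j _ => hint i j]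
      refine (Finset.sum_le_sum fun j hj => hcov i hi j hj).trans ?_
      rw [Finset.sum_add_distrib, Finset.sum_add_distrib, Finset.sum_const, Finset.card_range,
        nsmul_eq_mul, ← Finset.mul_sum, Finset.sum_ite_eq, if_pos hi]
      gcongr
      exact sum_inv_sub_sq_le i M
    refine (Finset.sum_le_sum hrow).trans (le_of_eq ?_)
    rw [Finset.sum_const, Finset.card_range, nsmul_eq_mul]
  have h := measureReal_eq_zero_mul_sq_le hX hX2
  rw [hmean] at h
  have h2 : (law n).real {ω | ∑ j ∈ Finset.range M, Y j ω = 0} * (M * (n * q)) ^ 2 ≤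
      M * (8 * D * (n * q) * M ^ 2 * 4 + B) := by
    refine h.trans ?_
    linarith
  rw [← le_div_iff₀ (by positivity)] at h2
  refine h2.trans (le_of_eq ?_)
  rw [hB]
  field_simp
  ring

theorem measurable_sum_largeCount (n k M : ℕ) : Measurable fun ω : Sample n =>
    ∑ j ∈ Finset.range M, largeCount k (graphAt ω (j / M)) :=
  Finset.measurable_sum _ fun _ _ => (measurable_largeCount n k).comp (measurable_graphAt _)

/-- Here Z = n^(1/48), so n = Z^48, r = Z^16 and q is at least Z^(-22). Up to powers of L, M must
exceed r²/(nq), about Z^6, for the single-time variance to average out, and stay below nq/r, about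
Z^10, for the covariances to be negligible; M about Z^7 does both. -/
theorem largeCount_sum_bound_le {Z L q K τ M D : ℝ} (hZ : 1 ≤ Z) (hL : 1 ≤ L) (hq : 1 / Z ^ 22 ≤ q)
    (hK : K ≤ Z ^ 32 * L ^ 3) (hτ : τ ≤ 1 / (Z ^ 48) ^ 2) (hM : Z ^ 7 ≤ M) (hM2 : M ≤ 2 * Z ^ 7)
    (hD0 : 0 ≤ D) (hD : D ≤ 17 * (Z ^ 16 * L ^ 2)) :
    (K * q + Z ^ 48 * τ) / (M * Z ^ 48 * q ^ 2) + 1 / M + 32 * M * D / (Z ^ 48 * q) ≤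
      1091 * L ^ 3 / Z := by
  have hZ0 : 0 < Z := by linarith
  have hq0 : 0 < q := lt_of_lt_of_le (by positivity) hq
  have hM0 : 0 < M := lt_of_lt_of_le (by positivity) hM
  have hL3 : 1 ≤ L ^ 3 := one_le_pow₀ hL
  have hL23 : L ^ 2 ≤ L ^ 3 := pow_le_pow_right₀ hL (by norm_num)
  have e1 : (K * q) / (M * Z ^ 48 * q ^ 2) ≤ L ^ 3 / Z := by
    calc (K * q) / (M * Z ^ 48 * q ^ 2) = K / (M * Z ^ 48 * q) := by field_simp
      _ ≤ Z ^ 32 * L ^ 3 / (Z ^ 7 * Z ^ 48 * (1 / Z ^ 22)) := by gcongr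
      _ = L ^ 3 / Z := by field_simp
  have e2 : (Z ^ 48 * τ) / (M * Z ^ 48 * q ^ 2) ≤ 1 / Z := by
    calc (Z ^ 48 * τ) / (M * Z ^ 48 * q ^ 2)
        ≤ (Z ^ 48 * (1 / (Z ^ 48) ^ 2)) / (Z ^ 7 * Z ^ 48 * (1 / Z ^ 22) ^ 2) := by gcongr
      _ = 1 / Z ^ 59 := by field_simp
      _ ≤ 1 / Z := one_div_le_one_div_of_le hZ0 (le_self_pow₀ hZ (by norm_num))
  have e3 : 1 / M ≤ 1 / Z :=
    one_div_le_one_div_of_le hZ0 ((le_self_pow₀ hZ (by norm_num)).trans hM)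
  have e4 : 32 * M * D / (Z ^ 48 * q) ≤ 1088 * L ^ 3 / Z := by
    calc 32 * M * D / (Z ^ 48 * q)
        ≤ 32 * (2 * Z ^ 7) * (17 * (Z ^ 16 * L ^ 3)) / (Z ^ 48 * (1 / Z ^ 22)) := by
          gcongr
          exact hD.trans (by gcongr)
      _ = 1088 * L ^ 3 / Z ^ 3 := by field_simp; norm_num
      _ ≤ 1088 * L ^ 3 / Z := by
          gcongr
          exact le_self_pow₀ hZ (by norm_num)
  have e5 : 1 / Z ≤ L ^ 3 / Z := by gcongr
  rw [add_div]
  have : 1091 * L ^ 3 / Z = L ^ 3 / Z + L ^ 3 / Z + L ^ 3 / Z + 1088 * L ^ 3 / Z := by ring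
  linarith

theorem tendsto_law_lower {b β : ℝ} (hb0 : 0 < b) (hb : b ^ 3 = 8 / 9) (hβ : β < b) :
    Tendsto (fun n : ℕ => law n {ω | β * (cbrt n ^ 2 * cbrtLog n) < (supLargestSize ω : ℝ)})
      atTop (𝓝 1) := by
  set S : ℕ → ℕ := fun n => ⌈b * (cbrt n ^ 2 * cbrtLog n)⌉₊ with hS
  set M : ℕ → ℕ := fun n => ⌈Real.exp (cbrtLog n ^ 3 / 48) ^ 7⌉₊ with hM
  set A : (n : ℕ) → Set (Sample n) := fun n =>
    {ω | ∑ j ∈ Finset.range (M n), largeCount (S n + 1) (graphAt ω (j / M n)) = 0} with hA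
  have hAm : ∀ n, MeasurableSet (A n) := fun n =>
    measurable_sum_largeCount n _ _ (measurableSet_singleton 0)
  have hMpos : ∀ n, 0 < M n := fun n => Nat.ceil_pos.2 (by positivity)
  have hlim : Tendsto (fun n => (law n).real (A n)) atTop (𝓝 0) := by
    refine tendsto_order.2 ⟨fun a ha => Eventually.of_forall fun n =>
      ha.trans_le measureReal_nonneg, fun ε hε => ?_⟩
    filter_upwards [survival_eventually_ge hb0 hb, survival_eventually_tail,
      sum_survival_eventually_le, tendsto_cbrtLog.eventually (eventually_ge_atTop 1),
      tendsto_cbrtLog.eventually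
        (eventually_mul_pow_le_exp (by norm_num : (0 : ℝ) < 1 / 48) (1091 * (2 / ε)) 3),
      eventually_ge_atTop 2] with n hq hτ hD hL hZε hn
    have hn0 : n ≠ 0 := by omega
    set L := cbrtLog n with hLdef
    set Z := Real.exp (L ^ 3 / 48) with hZ
    have hZk : ∀ k : ℕ, Real.exp (k * (L ^ 3 / 48)) = Z ^ k := fun k => Real.exp_nat_mul _ _
    have hZ1 : 1 ≤ Z := Real.one_le_exp (by positivity)
    have hr : cbrt n = Z ^ 16 := by
      rw [cbrt_eq_exp hn0, ← hZk]; congr 1; push_cast; ring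
    have hnZ : (n : ℝ) = Z ^ 48 := by rw [← cbrt_pow_three, hr]; ring
    have hq' : 1 / Z ^ 22 ≤ survival (1 / n) (S n) 1 (n - 1) := by
      refine le_trans (le_of_eq ?_) hq
      rw [← hZk, one_div, ← Real.exp_neg]; congr 1; push_cast; ring
    have hq0 : 0 < survival (1 / n : ℝ) (S n) 1 (n - 1) := lt_of_lt_of_le (by positivity) hq'
    have hZ7 : 1 ≤ Z ^ 7 := one_le_pow₀ hZ1
    have hMle : (M n : ℝ) ≤ 2 * Z ^ 7 := by
      have := Nat.ceil_lt_add_one (a := Z ^ 7) (by positivity)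
      change ((⌈Z ^ 7⌉₊ : ℕ) : ℝ) ≤ _
      linarith
    have h := law_forall_largeCount_eq_zero_le hn (S n) ⌊cbrt n ^ 2 * L ^ 3⌋₊ (hMpos n) hq0
    have h2 := largeCount_sum_bound_le (Z := Z) (L := L)
      (q := survival (1 / n : ℝ) (S n) 1 (n - 1))
      (K := (⌊cbrt n ^ 2 * L ^ 3⌋₊ : ℕ))
      (τ := survival (1 / n) ⌊cbrt n ^ 2 * L ^ 3⌋₊ 1 (n - 1)) (M := M n)
      (D := ∑ i ∈ Finset.range n, survival (1 / n : ℝ) i 1 (n - 1)) hZ1 hL hq'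
      ((Nat.floor_le (by positivity)).trans (le_of_eq (by rw [hr]; ring)))
      (by rw [← hnZ]; exact hτ) (Nat.le_ceil _) hMle
      (Finset.sum_nonneg fun i _ =>
        survival_nonneg (edgeProb_nonneg n) (edgeProb_le_one n) _ _ _)
      (by rw [← hr]; exact hD)
    rw [← hnZ] at h2
    refine (h.trans h2).trans_lt ?_
    rw [show 1 / 48 * L ^ 3 = L ^ 3 / 48 by ring, ← hZ] at hZε
    have hZ0 : 0 < Z := by linarith
    calc 1091 * L ^ 3 / Z ≤ ε / 2 := by
          rw [div_le_iff₀ hZ0]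
          calc 1091 * L ^ 3 = ε / 2 * (1091 * (2 / ε) * L ^ 3) := by field_simp
            _ ≤ ε / 2 * Z := by gcongr
      _ < ε := by linarith
  have hlim' : Tendsto (fun n => 1 - ENNReal.ofReal ((law n).real (A n))) atTop (𝓝 1) := by
    have h1 := ENNReal.tendsto_ofReal hlim
    rw [ENNReal.ofReal_zero] at h1
    have h2 := ENNReal.Tendsto.sub (tendsto_const_nhds (x := (1 : ENNReal))) h1
      (Or.inl ENNReal.one_ne_top)
    rwa [tsub_zero] at h2
  refine tendsto_of_tendsto_of_tendsto_of_le_of_le' hlim' tendsto_const_nhds ?_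
    (Eventually.of_forall fun n => prob_le_one)
  filter_upwards [tendsto_cbrtLog.eventually (eventually_ge_atTop 0)] with n hL
  rw [ofReal_measureReal, ← prob_compl_eq_one_sub (hAm n)]
  -- If the sum is nonzero, some sampled time has a component with at least S n + 1 vertices, hence
  -- the supremum exceeds S n.
  refine measure_mono fun ω hω => ?_
  have hω' : ∑ j ∈ Finset.range (M n), largeCount (S n + 1) (graphAt ω (j / M n)) ≠ 0 := hω
  obtain ⟨j, hj, hne⟩ := Finset.exists_ne_zero_of_sum_ne_zero hω'
  obtain ⟨v, hv⟩ := exists_of_largeCount_ne_zero hne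
  have hMn : (0 : ℝ) < M n := by exact_mod_cast hMpos n
  have hjM : (j : ℝ) ≤ M n := by exact_mod_cast (Finset.mem_range.1 hj).le
  have h := (succ_le_supLargestSize_iff ω (S n)).2
    ⟨j / M n, by positivity, by rwa [div_le_one hMn], v, hv⟩
  change β * (cbrt n ^ 2 * cbrtLog n) < (supLargestSize ω : ℝ)
  calc β * (cbrt n ^ 2 * cbrtLog n) ≤ b * (cbrt n ^ 2 * cbrtLog n) := by
        have : 0 ≤ cbrt n ^ 2 := sq_nonneg _
        gcongr
    _ ≤ (S n : ℝ) := Nat.le_ceil _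
    _ < (supLargestSize ω : ℝ) := by exact_mod_cast h

end DynamicalER
theorem theorem1 (β : ℝ) :
    (β < 2 / (3 : ℝ) ^ (2 / 3 : ℝ) →
      Tendsto (fun n : ℕ => DynamicalER.law n
          {ω | β * ((n : ℝ) ^ (2 / 3 : ℝ) * Real.log n ^ (1 / 3 : ℝ)) <
            (DynamicalER.supLargestSize ω : ℝ)})
        atTop (𝓝 1)) ∧
    (2 / (3 : ℝ) ^ (1 / 3 : ℝ) < β →
      Tendsto (fun n : ℕ => DynamicalER.law n
          {ω | β * ((n : ℝ) ^ (2 / 3 : ℝ) * Real.log n ^ (1 / 3 : ℝ)) <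
            (DynamicalER.supLargestSize ω : ℝ)})
        atTop (𝓝 0)) := by
  have h3 : ∀ x : ℝ, ((3 : ℝ) ^ x) ^ 3 = 3 ^ (x * 3) := fun x => by
    rw [Real.rpow_mul (by norm_num)]; norm_cast
  constructor
  · intro h
    have hb : (2 / (3 : ℝ) ^ (2 / 3 : ℝ)) ^ 3 = 8 / 9 := by
      rw [div_pow, h3]; norm_num
    simpa only [DynamicalER.cbrt_sq, DynamicalER.cbrtLog] using
      DynamicalER.tendsto_law_lower (by positivity) hb h
  · intro h
    have hb0 : 0 < 2 / (3 : ℝ) ^ (1 / 3 : ℝ) := by positivity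
    have hb : (2 / (3 : ℝ) ^ (1 / 3 : ℝ)) ^ 3 = 8 / 3 := by
      rw [div_pow, h3]; norm_num
    have hβ : 8 / 3 < β ^ 3 := hb ▸ pow_lt_pow_left₀ h hb0.le three_ne_zero
    simpa only [DynamicalER.cbrt_sq, DynamicalER.cbrtLog] using
      DynamicalER.tendsto_law_upper (hb0.trans h) hβ
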